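/- **Dual graphs.** A graph $\Gamma$ consists of finite sets $V(\Gamma)$ (vertices) and $F(\Gamma)$ (flags), a map $p:F(\Gamma)\to V(\Gamma)$ and an involution $\sigma$ of $F(\Gamma)$. The fixed points of $\sigma$ are the legs, forming the set $L(\Gamma)$; the remaining orbits are the edges. The set $\pi_0(\Gamma)$ of components is the set of classes of the equivalence relation on $V(\Gamma)$ generated by the edges. A dual graph is a graph with a function $g:V(\Gamma)\to\mathbb N$, and the genus of a component $C$ is $g(C)=\sum_{v\in C}g(v)+1-(|V(C)|-|E(C)|)$. **The category $\mathcal G$.** An object is a pair of finite sets $L,V$ with functions $p:L\to V$ and $g:V\to\mathbb N$ (a dual graph without edges); the finite sets are taken from a small collection, closed under disjoint union, containing sets of every finite cardinality, so that $\mathcal G$ is small. A morphism $(L_1,V_1,p_1,g_1)\to(L_2,V_2,p_2,g_2)$ is a dual graph $\Gamma$ with $F(\Gamma)=L_1$, $V(\Gamma)=V_1$, $p=p_1$ and $g=g_1$, together with bijections $\alpha:L_2\to L(\Gamma)$ and $\beta:V_2\to\pi_0(\Gamma)$ such that $\alpha(l)$ meets the component $\beta(p_2(l))$ for every $l\in L_2$,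 and $g(\beta(v))=g_2(v)$ for every $v\in V_2$. In the composite $\Gamma_2\circ\Gamma_1$ the involution is $\sigma_1$ on the edges of $\Gamma_1$ and $\alpha_1\sigma_2\alpha_1^{-1}$ on the legs of $\Gamma_1$, and the bijections are those of $\Gamma_2$, transported along $\alpha_1$ and $\beta_1$. Disjoint union makes $\mathcal G$ a symmetric monoidal category. Let $\tau:\mathcal H\hookrightarrow\mathcal G$ be the inclusion of the symmetric monoidal groupoid of all invertible morphisms of $\mathcal G$. **Modular operads.** Let $\mathcal C$ be a cocomplete symmetric monoidal category such that $A\otimes B$ preserves colimits in each variable. Let $\mathrm{Mod}(\mathcal C)$ (modular operads) and $\mathrm{PreMod}(\mathcal C)$ (modular preoperads) be the categories of (strong) symmetric monoidal functors $\mathcal G\to\mathcal C$, respectively $\mathcal H\to\mathcal C$, and monoidal natural transformations. Let $\tau^*:\mathrm{Mod}(\mathcal C)\to\mathrm{PreMod}(\mathcal C)$ be restriction along $\tau$. **Theorem.** (i) There is an adjunction $\tau_*\dashv\tau^*$ between $\mathrm{PreMod}(\mathcal C)$ and $\mathrm{Mod}(\mathcal C)$, where the functor underlying $\tau_*\mathcal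 P$ is the coend $$\tau_*\mathcal P=\int^{A\in\mathcal H}\mathcal G(A,-)\times\mathcal P(A),$$ naturally in $\mathcal P$; here $S\times X$ denotes the coproduct of copies of $X$ indexed by the set $S$. Under this identification the unit $\mathcal P(A)\to(\tau_*\mathcal P)(A)$ is the canonical map into the coend from the summand at $\mathrm{id}_A\in\mathcal G(A,A)$. (ii) The functor $\tau^*$ is monadic: with $\mathbb T=\tau^*\tau_*$ the monad of this adjunction, the comparison functor $\mathrm{Mod}(\mathcal C)\to\mathrm{PreMod}(\mathcal C)^{\mathbb T}$ is an equivalence of categories. (iii) If $\mathcal C$ is locally finitely presentable, then so is $\mathrm{Mod}(\mathcal C)$. -/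

import Mathlib

open CategoryTheory CategoryTheory.Limits Opposite

universe v u v₁ v₂ v₃ u₁ u₂ u₃

/-! ## Graphs and dual graphs -/

/-- A dual graph with flags `F` and vertices `V`: a graph (the map `p` sends a flag to the vertex
it meets, `σ` is an involution of the flags) together with a genus `g v` for every vertex. -/
structure DualGraph (F V : Type) where
  p : F → V
  σ : F → F
  σ_invol : Function.Involutive σ
  g : V → ℕ

namespace DualGraph

variable {F V : Type} (Γ : DualGraph F V)

/-- The legs are the fixed points of the involution. -/
def Leg : Type := {f : F // Γ.σ f = f}

/-- The edges are the remaining orbits of the involution. -/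
def Edge : Type := {e : Set F // ∃ f, Γ.σ f ≠ f ∧ e = {f, Γ.σ f}}

/-- The set `π₀(Γ)` of components: the classes of the equivalence relation on the vertices
generated by the edges. -/
def Component : Type :=
  Quot fun v w : V => ∃ f, Γ.σ f ≠ f ∧ Γ.p f = v ∧ Γ.p (Γ.σ f) = w

/-- The component of a vertex. -/
def component (v : V) : Γ.Component := Quot.mk _ v

/-- The Euler characteristic `|V(C)| - |E(C)|` of a component. -/
noncomputable def eulerChar (C : Γ.Component) : ℤ :=
  (Nat.card {v : V // Γ.component v = C} : ℤ) -
    (Nat.card {e : Γ.Edge // ∀ f ∈ e.1, Γ.component (Γ.p f) = C} : ℤ)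

open scoped Classical in
/-- The genus `∑_{v ∈ C} g(v) + 1 - e(C)` of a component. -/
noncomputable def genus [Fintype V] (C : Γ.Component) : ℤ :=
  (∑ v : V with Γ.component v = C, (Γ.g v : ℤ)) + 1 - Γ.eulerChar C

theorem component_p_σ (f : F) : Γ.component (Γ.p (Γ.σ f)) = Γ.component (Γ.p f) := by
  by_cases h : Γ.σ f = f
  · rw [h]
  · exact (Quot.sound ⟨f, h, rfl, rfl⟩).symm

/-- Every edge consists of two flags. -/
theorem two_mul_card_edge [Finite F] (C : Γ.Component) :
    2 * Nat.card {e : Γ.Edge // ∀ f ∈ e.1, Γ.component (Γ.p f) = C} =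
      Nat.card {f : F // Γ.σ f ≠ f ∧ Γ.component (Γ.p f) = C} := by
  classical
  have key : ∀ (e : Γ.Edge) (f : F), f ∈ e.1 → Γ.σ f ≠ f ∧ e.1 = {f, Γ.σ f} := by
    rintro ⟨e, f₀, h₀, rfl⟩ f hf
    rcases hf with rfl | hf
    · exact ⟨h₀, rfl⟩
    · have hf' : f = Γ.σ f₀ := hf
      subst hf'
      rw [Γ.σ_invol f₀]
      exact ⟨fun h => h₀ h.symm, Set.pair_comm _ _⟩
  let E := {e : Γ.Edge // ∀ f ∈ e.1, Γ.component (Γ.p f) = C}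
  let φ : {f : F // Γ.σ f ≠ f ∧ Γ.component (Γ.p f) = C} ≃ Σ e : E, {f : F // f ∈ e.1.1} :=
    { toFun := fun f => ⟨⟨⟨{f.1, Γ.σ f.1}, f.1, f.2.1, rfl⟩, by
          rintro f' (rfl | h)
          · exact f.2.2
          · have h' : f' = Γ.σ f.1 := h
            rw [h', component_p_σ, f.2.2]⟩, ⟨f.1, Or.inl rfl⟩⟩
      invFun := fun x => ⟨x.2.1, (key x.1.1 x.2.1 x.2.2).1, x.1.2 _ x.2.2⟩
      left_inv := fun f => rfl
      right_inv := by
        rintro ⟨⟨e, he⟩, ⟨f, hf⟩⟩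
        have h1 := (key e f hf).2
        obtain ⟨e, he'⟩ := e
        dsimp only at h1 hf
        subst h1
        rfl }
  have : Finite Γ.Edge := Subtype.finite
  have : Fintype E := Fintype.ofFinite _
  rw [Nat.card_congr φ, Nat.card_sigma]
  have h2 : ∀ e : E, Nat.card {f : F // f ∈ e.1.1} = 2 := by
    rintro ⟨⟨e, f, hf, rfl⟩, he⟩
    exact Set.ncard_pair (Ne.symm hf)
  simp only [h2, Finset.sum_const, Finset.card_univ, smul_eq_mul, E]
  rw [Nat.card_eq_fintype_card, mul_comm]

end DualGraph

/-! ## The category of dual graphs -/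

/-- A small collection of finite sets, containing one of each cardinality and closed under
disjoint union. -/
inductive FinSetCode : Type
  | fin (n : ℕ)
  | sum (A B : FinSetCode)

namespace FinSetCode

/-- The finite set with a given code. -/
def El : FinSetCode → Type
  | fin n => Fin n
  | sum A B => A.El ⊕ B.El

instance : CoeSort FinSetCode Type := ⟨El⟩

@[reducible] def fintypeEl : (A : FinSetCode) → Fintype A.El
  | fin n => inferInstanceAs (Fintype (Fin n))
  | sum A B => @instFintypeSum _ _ A.fintypeEl B.fintypeEl

instance (A : FinSetCode) : Fintype A.El := A.fintypeEl

end FinSetCode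

/-- An object of the category `𝒢`: a dual graph without edges, that is, finite sets `L` and `V`
with functions `p : L → V` and `g : V → ℕ`. The finite sets are taken from a small collection, so
that `𝒢` is small. -/
structure 𝒢 : Type where
  L : FinSetCode
  V : FinSetCode
  p : L → V
  g : V → ℕ

namespace 𝒢

/-- The dual graph with the flags, vertices and genera of `X` and with involution `σ`. -/
def graph (X : 𝒢) (σ : X.L → X.L) (hσ : Function.Involutive σ) : DualGraph X.L X.V where
  p := X.p
  σ := σ
  σ_invol := hσ
  g := X.g

/-- A morphism from `X` to `Y`: a dual graph `Γ` with the flags, vertices and genera of `X`,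
together with bijections `α : L(Y) ≃ L(Γ)` and `β : V(Y) ≃ π₀(Γ)` such that `p ∘ α = β ∘ p` and the
genus of the component `β v` is the genus of `v`. -/
structure Hom (X Y : 𝒢) where
  σ : X.L → X.L
  σ_invol : Function.Involutive σ
  α : Y.L ≃ (X.graph σ σ_invol).Leg
  β : Y.V ≃ (X.graph σ σ_invol).Component
  p_comm : ∀ l : Y.L, (X.graph σ σ_invol).component (X.p (α l).1) = β (Y.p l)
  g_comm : ∀ v : Y.V, (X.graph σ σ_invol).genus (β v) = Y.g v

namespace Hom

variable {X Y Z : 𝒢}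

/-- The dual graph of a morphism. -/
abbrev Γ (f : Hom X Y) : DualGraph X.L X.V := X.graph f.σ f.σ_invol

/-- The map `α`, with values in the flags. -/
def leg (f : Hom X Y) (l : Y.L) : X.L := (f.α l).1

/-- The map sending a vertex of the source to the vertex of the target that corresponds to its
component. -/
def vert (f : Hom X Y) (v : X.V) : Y.V := f.β.symm (f.Γ.component v)

theorem leg_injective (f : Hom X Y) : Function.Injective f.leg := fun _ _ h =>
  f.α.injective (Subtype.ext h)

theorem σ_leg (f : Hom X Y) (l : Y.L) : f.σ (f.leg l) = f.leg l := (f.α l).2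

theorem leg_symm (f : Hom X Y) (l : X.L) (h : f.σ l = l) : f.leg (f.α.symm ⟨l, h⟩) = l :=
  congrArg Subtype.val (f.α.apply_symm_apply ⟨l, h⟩)

theorem symm_leg (f : Hom X Y) (m : Y.L) (h : f.σ (f.leg m) = f.leg m) :
    f.α.symm ⟨f.leg m, h⟩ = m :=
  f.α.symm_apply_apply m

theorem exists_leg (f : Hom X Y) (l : X.L) (h : f.σ l = l) : ∃ m, f.leg m = l :=
  ⟨_, f.leg_symm l h⟩

theorem vert_surjective (f : Hom X Y) : Function.Surjective f.vert := fun y => by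
  obtain ⟨v, hv⟩ := Quot.exists_rep (f.β y)
  refine ⟨v, ?_⟩
  rw [vert, Equiv.symm_apply_eq]
  exact hv

theorem component_eq_iff (f : Hom X Y) (v w : X.V) :
    f.Γ.component v = f.Γ.component w ↔ f.vert v = f.vert w :=
  f.β.symm.injective.eq_iff.symm

theorem vert_p_σ (f : Hom X Y) (l : X.L) : f.vert (X.p (f.σ l)) = f.vert (X.p l) :=
  congrArg f.β.symm (f.Γ.component_p_σ l)

theorem vert_p_leg (f : Hom X Y) (m : Y.L) : f.vert (X.p (f.leg m)) = Y.p m := by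
  rw [vert, Equiv.symm_apply_eq]
  exact f.p_comm m

open scoped Classical in
/-- Auxiliary count, equal to `2 g(C) - 2` for the component `C` corresponding to `y`. -/
noncomputable def count (X : 𝒢) {W : Type} (σ : X.L → X.L) (q : X.V → W) (y : W) : ℤ :=
  (∑ v : X.V, if q v = y then 2 * (X.g v : ℤ) - 2 else 0) +
    ∑ l : X.L, if σ l ≠ l ∧ q (X.p l) = y then 1 else 0

open scoped Classical in
theorem two_mul_genus (X : 𝒢) (σ : X.L → X.L) (hσ : Function.Involutive σ)
    (C : (X.graph σ hσ).Component) :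
    2 * (X.graph σ hσ).genus C = count X σ (X.graph σ hσ).component C + 2 := by
  have h := (X.graph σ hσ).two_mul_card_edge C
  have h' : (Nat.card {f : X.L // σ f ≠ f ∧ (X.graph σ hσ).component (X.p f) = C} : ℤ) =
      ∑ l : X.L, if σ l ≠ l ∧ (X.graph σ hσ).component (X.p l) = C then 1 else 0 := by
    rw [Nat.card_eq_fintype_card, Fintype.card_subtype, Finset.sum_boole]
  have h'' : (Nat.card {v : X.V // (X.graph σ hσ).component v = C} : ℤ) =
      ∑ v : X.V, if (X.graph σ hσ).component v = C then 1 else 0 := by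
    rw [Nat.card_eq_fintype_card, Fintype.card_subtype, Finset.sum_boole]
  have h3 : (∑ v : X.V, if (X.graph σ hσ).component v = C then 2 * (X.g v : ℤ) - 2 else 0) =
      2 * (∑ v : X.V, if (X.graph σ hσ).component v = C then (X.g v : ℤ) else 0) -
      2 * (∑ v : X.V, if (X.graph σ hσ).component v = C then 1 else 0) := by
    rw [Finset.mul_sum, Finset.mul_sum, ← Finset.sum_sub_distrib]
    refine Finset.sum_congr rfl fun v _ => ?_
    split_ifs <;> ring
  have h4 : ((2 * Nat.card {e : (X.graph σ hσ).Edge //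
      ∀ f ∈ e.1, (X.graph σ hσ).component (X.p f) = C} : ℕ) : ℤ) =
      ∑ l : X.L, if σ l ≠ l ∧ (X.graph σ hσ).component (X.p l) = C then 1 else 0 := by
    rw [← h']
    exact congrArg Nat.cast h
  push_cast at h4
  rw [DualGraph.genus, DualGraph.eulerChar, count, h3, ← h4, h'', Finset.sum_filter]
  change 2 * ((∑ v : X.V, if (X.graph σ hσ).component v = C then (X.g v : ℤ) else 0) + 1 - _) = _
  simp only [graph]
  ring

theorem count_congr (X : 𝒢) {W W' : Type} (σ : X.L → X.L) (q : X.V → W) (q' : X.V → W') (y : W)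
    (y' : W') (h : ∀ v, q v = y ↔ q' v = y') : count X σ q y = count X σ q' y' := by
  classical
  unfold count
  congr 1
  · exact Finset.sum_congr rfl fun v _ => if_congr (h v) rfl rfl
  · exact Finset.sum_congr rfl fun l _ => if_congr (and_congr_right fun _ => h _) rfl rfl

theorem count_vert (f : Hom X Y) (y : Y.V) : count X f.σ f.vert y = 2 * (Y.g y : ℤ) - 2 := by
  have h := two_mul_genus X f.σ f.σ_invol (f.β y)
  rw [f.g_comm] at h
  rw [count_congr X f.σ f.vert f.Γ.component y (f.β y) fun v => f.β.symm_apply_eq]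
  linarith

theorem ext' {f f' : Hom X Y} (hσ : ∀ l, f.σ l = f'.σ l) (hα : ∀ l, f.leg l = f'.leg l)
    (hβ : ∀ v, f.vert v = f'.vert v) : f = f' := by
  obtain ⟨σ, i, α, β, hp, hg⟩ := f
  obtain ⟨σ', i', α', β', hp', hg'⟩ := f'
  obtain rfl : σ = σ' := funext hσ
  obtain rfl : α = α' := Equiv.ext fun l => Subtype.ext (hα l)
  have : β.symm = β'.symm := Equiv.ext fun c => by
    obtain ⟨v, rfl⟩ := Quot.exists_rep c
    exact hβ v
  obtain rfl : β = β' := by rw [← β.symm_symm, this, β'.symm_symm]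
  rfl

/-- A constructor for morphisms. -/
noncomputable def mk' (σ : X.L → X.L) (σ_invol : Function.Involutive σ) (leg : Y.L → X.L)
    (leg_inj : Function.Injective leg) (leg_range : ∀ l, σ l = l ↔ ∃ m, leg m = l)
    (vert : X.V → Y.V) (vert_surj : Function.Surjective vert)
    (vert_p_σ : ∀ l, vert (X.p (σ l)) = vert (X.p l))
    (exact : ∀ v w, vert v = vert w →
      (X.graph σ σ_invol).component v = (X.graph σ σ_invol).component w)
    (p_comm : ∀ m, vert (X.p (leg m)) = Y.p m)
    (g_comm : ∀ y, count X σ vert y = 2 * (Y.g y : ℤ) - 2) : Hom X Y :=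
  have bij : Function.Bijective
      (Quot.lift (r := fun v w : X.V => ∃ f, σ f ≠ f ∧ X.p f = v ∧ X.p (σ f) = w) vert
        (by rintro _ _ ⟨f, -, rfl, rfl⟩; exact (vert_p_σ f).symm)) := by
    constructor
    · intro a b h
      obtain ⟨v, rfl⟩ := Quot.exists_rep a
      obtain ⟨w, rfl⟩ := Quot.exists_rep b
      exact exact v w h
    · intro y
      obtain ⟨v, rfl⟩ := vert_surj y
      exact ⟨Quot.mk _ v, rfl⟩
  let β : Y.V ≃ (X.graph σ σ_invol).Component := (Equiv.ofBijective _ bij).symm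
  have hβ : ∀ v, β (vert v) = (X.graph σ σ_invol).component v := fun v => by
    exact (Equiv.symm_apply_eq _).2 rfl
  { σ := σ
    σ_invol := σ_invol
    α := Equiv.ofBijective (fun m => ⟨leg m, (leg_range _).2 ⟨m, rfl⟩⟩)
      ⟨fun _ _ h => leg_inj (congrArg Subtype.val h), fun l => by
        obtain ⟨m, hm⟩ := (leg_range l.1).1 l.2
        exact ⟨m, Subtype.ext hm⟩⟩
    β := β
    p_comm := fun m => by
      rw [← p_comm m, hβ]
      rfl
    g_comm := fun y => by
      have h := two_mul_genus X σ σ_invol (β y)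
      rw [← count_congr X σ vert (X.graph σ σ_invol).component y (β y) fun v => by
        rw [← hβ v, β.injective.eq_iff], g_comm] at h
      linarith }

section

variable (σ : X.L → X.L) (σ_invol : Function.Involutive σ) (leg : Y.L → X.L)
    (leg_inj : Function.Injective leg) (leg_range : ∀ l, σ l = l ↔ ∃ m, leg m = l)
    (vert : X.V → Y.V) (vert_surj : Function.Surjective vert)
    (vert_p_σ : ∀ l, vert (X.p (σ l)) = vert (X.p l))
    (exact : ∀ v w, vert v = vert w →
      (X.graph σ σ_invol).component v = (X.graph σ σ_invol).component w)
    (p_comm : ∀ m, vert (X.p (leg m)) = Y.p m)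
    (g_comm : ∀ y, count X σ vert y = 2 * (Y.g y : ℤ) - 2)

@[simp] theorem mk'_σ : (mk' σ σ_invol leg leg_inj leg_range vert vert_surj vert_p_σ exact p_comm
    g_comm).σ = σ := rfl

@[simp] theorem mk'_leg : (mk' σ σ_invol leg leg_inj leg_range vert vert_surj vert_p_σ exact p_comm
    g_comm).leg = leg := rfl

@[simp] theorem mk'_vert : (mk' σ σ_invol leg leg_inj leg_range vert vert_surj vert_p_σ exact p_comm
    g_comm).vert = vert := rfl

end

open scoped Classical in
/-- The involution of the composite `Γ₂ ∘ Γ₁`: it is `σ₁` on the edges of `Γ₁`, and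
`α₁ ∘ σ₂ ∘ α₁⁻¹` on the legs of `Γ₁`. -/
noncomputable def compσ (f : Hom X Y) (g : Hom Y Z) (l : X.L) : X.L :=
  if h : f.σ l = l then f.leg (g.σ (f.α.symm ⟨l, h⟩)) else f.σ l

theorem compσ_leg (f : Hom X Y) (g : Hom Y Z) (m : Y.L) :
    compσ f g (f.leg m) = f.leg (g.σ m) := by
  rw [compσ, dif_pos (f.σ_leg m), symm_leg]

theorem compσ_of_ne (f : Hom X Y) (g : Hom Y Z) (l : X.L) (h : f.σ l ≠ l) :
    compσ f g l = f.σ l := by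
  rw [compσ, dif_neg h]

theorem compσ_involutive (f : Hom X Y) (g : Hom Y Z) : Function.Involutive (compσ f g) := by
  intro l
  by_cases h : f.σ l = l
  · obtain ⟨m, rfl⟩ := f.exists_leg l h
    rw [compσ_leg, compσ_leg, g.σ_invol]
  · rw [compσ_of_ne f g l h, compσ_of_ne, f.σ_invol]
    rw [f.σ_invol]
    exact fun h' => h h'.symm

theorem comp_exact (f : Hom X Y) (g : Hom Y Z) (v w : X.V)
    (h : g.vert (f.vert v) = g.vert (f.vert w)) :
    (X.graph (compσ f g) (compσ_involutive f g)).component v =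
      (X.graph (compσ f g) (compσ_involutive f g)).component w := by
  let Γ := X.graph (compσ f g) (compσ_involutive f g)
  let A : f.Γ.Component → Γ.Component := Quot.lift Γ.component (by
    rintro _ _ ⟨l, hl, rfl, rfl⟩
    have h1 := Γ.component_p_σ l
    change Γ.component (X.p (compσ f g l)) = _ at h1
    rw [compσ_of_ne f g l hl] at h1
    exact h1.symm)
  let B : g.Γ.Component → Γ.Component := Quot.lift (fun y => A (f.β y)) (by
    rintro _ _ ⟨m, hm, rfl, rfl⟩
    have h1 := Γ.component_p_σ (f.leg m)
    change Γ.component (X.p (compσ f g (f.leg m))) = _ at h1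
    rw [compσ_leg] at h1
    change A (f.β (Y.p m)) = A (f.β (Y.p (g.σ m)))
    rw [← f.p_comm, ← f.p_comm]
    exact h1.symm)
  have hB : ∀ v, B (g.Γ.component (f.vert v)) = Γ.component v := fun v => by
    change A (f.β (f.β.symm (f.Γ.component v))) = _
    rw [f.β.apply_symm_apply]
    rfl
  change Γ.component v = Γ.component w
  rw [← hB, ← hB, (g.component_eq_iff _ _).2 h]

open scoped Classical in
theorem comp_count (f : Hom X Y) (g : Hom Y Z) (z : Z.V) :
    count X (compσ f g) (fun v => g.vert (f.vert v)) z = 2 * (Z.g z : ℤ) - 2 := by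
  rw [← g.count_vert z]
  have hV : (∑ v : X.V, if g.vert (f.vert v) = z then 2 * (X.g v : ℤ) - 2 else 0) =
      ∑ y : Y.V, if g.vert y = z then
        (∑ v : X.V, if f.vert v = y then 2 * (X.g v : ℤ) - 2 else 0) else 0 := by
    simp only [← Finset.sum_filter]
    rw [← Finset.sum_fiberwise_of_maps_to (s := Finset.univ.filter fun v => g.vert (f.vert v) = z)
      (t := Finset.univ.filter fun y => g.vert y = z) (g := f.vert) (fun v hv => by simpa using hv)]
    refine Finset.sum_congr rfl fun y hy => Finset.sum_congr ?_ fun _ _ => rfl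
    ext v
    simp only [Finset.mem_filter, Finset.mem_univ, true_and] at hy ⊢
    constructor
    · exact fun h => h.2
    · rintro rfl
      exact ⟨hy, rfl⟩
  have hE : (∑ l : X.L, if f.σ l ≠ l ∧ g.vert (f.vert (X.p l)) = z then (1 : ℤ) else 0) =
      ∑ y : Y.V, if g.vert y = z then
        (∑ l : X.L, if f.σ l ≠ l ∧ f.vert (X.p l) = y then 1 else 0) else 0 := by
    simp only [← Finset.sum_filter]
    rw [← Finset.sum_fiberwise_of_maps_to
      (s := Finset.univ.filter fun l => f.σ l ≠ l ∧ g.vert (f.vert (X.p l)) = z)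
      (t := Finset.univ.filter fun y => g.vert y = z) (g := fun l => f.vert (X.p l))
      (fun v hv => by simpa using (Finset.mem_filter.1 hv).2.2)]
    refine Finset.sum_congr rfl fun y hy => Finset.sum_congr ?_ fun _ _ => rfl
    ext l
    simp only [Finset.mem_filter, Finset.mem_univ, true_and] at hy ⊢
    constructor
    · exact fun h => ⟨h.1.1, h.2⟩
    · rintro ⟨h, rfl⟩
      exact ⟨⟨h, hy⟩, rfl⟩
  have hL : (∑ l : X.L, if compσ f g l ≠ l ∧ g.vert (f.vert (X.p l)) = z then (1 : ℤ) else 0) =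
      (∑ l : X.L, if f.σ l ≠ l ∧ g.vert (f.vert (X.p l)) = z then 1 else 0) +
      ∑ m : Y.L, if g.σ m ≠ m ∧ g.vert (Y.p m) = z then 1 else 0 := by
    have h1 : (∑ m : Y.L, if g.σ m ≠ m ∧ g.vert (Y.p m) = z then (1 : ℤ) else 0) =
        ∑ l : X.L, if f.σ l = l ∧ compσ f g l ≠ l ∧ g.vert (f.vert (X.p l)) = z
          then 1 else 0 := by
      simp only [← Finset.sum_filter]
      refine Finset.sum_bij (fun m _ => f.leg m) ?_ ?_ ?_ ?_
      · intro m hm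
        simp only [Finset.mem_filter, Finset.mem_univ, true_and] at hm ⊢
        rw [compσ_leg, vert_p_leg]
        exact ⟨f.σ_leg m, fun h => hm.1 (f.leg_injective h), hm.2⟩
      · intro a _ b _ h
        exact f.leg_injective h
      · intro l hl
        simp only [Finset.mem_filter, Finset.mem_univ, true_and] at hl
        obtain ⟨m, rfl⟩ := f.exists_leg l hl.1
        rw [compσ_leg, vert_p_leg] at hl
        refine ⟨m, ?_, rfl⟩
        simp only [Finset.mem_filter, Finset.mem_univ, true_and]
        exact ⟨fun h => hl.2.1 (congrArg _ h), hl.2.2⟩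
      · intros
        rfl
    rw [h1, ← Finset.sum_add_distrib]
    refine Finset.sum_congr rfl fun l _ => ?_
    by_cases h : f.σ l = l
    · simp [h]
    · simp [h, compσ_of_ne f g l h]
  rw [count, hV, hL, hE, ← add_assoc, ← Finset.sum_add_distrib, count]
  congr 1
  refine Finset.sum_congr rfl fun y _ => ?_
  split_ifs
  · exact f.count_vert y
  · simp

/-- Composition. The bijections `α` and `β` of the composite are those of the second morphism,
transported along the identifications of the legs and components given by the first one. -/
noncomputable def comp (f : Hom X Y) (g : Hom Y Z) : Hom X Z :=
  mk' (compσ f g) (compσ_involutive f g) (fun l => f.leg (g.leg l))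
    (f.leg_injective.comp g.leg_injective)
    (fun l => by
      constructor
      · intro h
        by_cases hf : f.σ l = l
        · obtain ⟨m, rfl⟩ := f.exists_leg l hf
          rw [compσ_leg] at h
          obtain ⟨k, rfl⟩ := g.exists_leg m (f.leg_injective h)
          exact ⟨k, rfl⟩
        · rw [compσ_of_ne f g l hf] at h
          exact absurd h hf
      · rintro ⟨m, rfl⟩
        rw [compσ_leg, σ_leg])
    (fun v => g.vert (f.vert v)) (g.vert_surjective.comp f.vert_surjective)
    (fun l => by
      by_cases hf : f.σ l = l
      · obtain ⟨m, rfl⟩ := f.exists_leg l hf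
        rw [compσ_leg, vert_p_leg, vert_p_leg, vert_p_σ]
      · rw [compσ_of_ne f g l hf, vert_p_σ])
    (comp_exact f g) (fun m => by rw [vert_p_leg, vert_p_leg]) (comp_count f g)

theorem comp_σ (f : Hom X Y) (g : Hom Y Z) (l : X.L) : (comp f g).σ l = compσ f g l := rfl

@[simp] theorem comp_σ_leg (f : Hom X Y) (g : Hom Y Z) (m : Y.L) :
    (comp f g).σ (f.leg m) = f.leg (g.σ m) := compσ_leg f g m

theorem comp_σ_of_ne (f : Hom X Y) (g : Hom Y Z) (l : X.L) (h : f.σ l ≠ l) :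
    (comp f g).σ l = f.σ l := compσ_of_ne f g l h

@[simp] theorem comp_leg (f : Hom X Y) (g : Hom Y Z) (l : Z.L) :
    (comp f g).leg l = f.leg (g.leg l) := rfl

@[simp] theorem comp_vert (f : Hom X Y) (g : Hom Y Z) (v : X.V) :
    (comp f g).vert v = g.vert (f.vert v) := rfl

theorem involutive_self (X : 𝒢) : Function.Involutive fun l : X.L => l := fun _ => rfl

/-- The morphism without edges given by an isomorphism of objects. -/
noncomputable def ofEquiv (eL : X.L ≃ Y.L) (eV : X.V ≃ Y.V)
    (hp : ∀ l, eV (X.p l) = Y.p (eL l)) (hg : ∀ v, Y.g (eV v) = X.g v) : Hom X Y :=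
  mk' (fun l => l) (involutive_self X) eL.symm eL.symm.injective
    (fun l => ⟨fun _ => ⟨eL l, eL.symm_apply_apply l⟩, fun _ => rfl⟩) eV eV.surjective
    (fun _ => rfl) (fun v w h => by rw [eV.injective h])
    (fun m => by rw [hp, Equiv.apply_symm_apply])
    (fun y => by
      classical
      have : ∀ v, eV v = y ↔ v = eV.symm y := fun v => eV.eq_symm_apply.symm
      simp [count, this, ← hg])

section

variable (eL : X.L ≃ Y.L) (eV : X.V ≃ Y.V)
    (hp : ∀ l, eV (X.p l) = Y.p (eL l)) (hg : ∀ v, Y.g (eV v) = X.g v)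

@[simp] theorem ofEquiv_σ (l : X.L) : (ofEquiv eL eV hp hg).σ l = l := rfl

@[simp] theorem ofEquiv_leg (l : Y.L) : (ofEquiv eL eV hp hg).leg l = eL.symm l := rfl

@[simp] theorem ofEquiv_vert (v : X.V) : (ofEquiv eL eV hp hg).vert v = eV v := rfl

@[simp] theorem comp_ofEquiv_σ (f : Hom Z X) (l : Z.L) :
    (comp f (ofEquiv eL eV hp hg)).σ l = f.σ l := by
  by_cases hf : f.σ l = l
  · obtain ⟨m, rfl⟩ := f.exists_leg l hf
    rw [comp_σ_leg, ofEquiv_σ, hf]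
  · rw [comp_σ_of_ne _ _ _ hf]

@[simp] theorem ofEquiv_comp_σ (f : Hom Y Z) (l : X.L) :
    (comp (ofEquiv eL eV hp hg) f).σ l = eL.symm (f.σ (eL l)) := by
  have := comp_σ_leg (ofEquiv eL eV hp hg) f (eL l)
  simpa using this

end

/-- The identity: the graph without edges, with identity bijections. -/
noncomputable def id (X : 𝒢) : Hom X X := ofEquiv (Equiv.refl _) (Equiv.refl _) (fun _ => rfl)
  (fun _ => rfl)

@[simp] theorem id_σ (l : X.L) : (id X).σ l = l := rfl

@[simp] theorem id_leg (l : X.L) : (id X).leg l = l := rfl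

@[simp] theorem id_vert (v : X.V) : (id X).vert v = v := rfl

@[simp] theorem comp_id_σ (f : Hom X Y) (l : X.L) : (comp f (id Y)).σ l = f.σ l :=
  comp_ofEquiv_σ _ _ _ _ f l

@[simp] theorem id_comp_σ (f : Hom X Y) (l : X.L) : (comp (id X) f).σ l = f.σ l :=
  ofEquiv_comp_σ _ _ _ _ f l

end Hom

noncomputable instance : Category.{0} 𝒢 where
  Hom := Hom
  id := Hom.id
  comp := Hom.comp
  id_comp f := by
    refine Hom.ext' (fun l => ?_) (fun l => ?_) (fun v => ?_) <;> simp
  comp_id f := by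
    refine Hom.ext' (fun l => ?_) (fun l => ?_) (fun v => ?_) <;> simp
  assoc f g h := by
    refine Hom.ext' (fun l => ?_) (fun l => ?_) (fun v => ?_)
    · by_cases hf : f.σ l = l
      · obtain ⟨m, rfl⟩ := f.exists_leg l hf
        rw [Hom.comp_σ_leg]
        by_cases hg : g.σ m = m
        · obtain ⟨k, rfl⟩ := g.exists_leg m hg
          rw [Hom.comp_σ_leg, ← Hom.comp_leg, Hom.comp_σ_leg, Hom.comp_leg]
        · rw [Hom.comp_σ_of_ne g h m hg, Hom.comp_σ_of_ne, Hom.comp_σ_leg]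
          rw [Hom.comp_σ_leg]
          exact fun h => hg (f.leg_injective h)
      · rw [Hom.comp_σ_of_ne f _ l hf, Hom.comp_σ_of_ne, Hom.comp_σ_of_ne f g l hf]
        rwa [Hom.comp_σ_of_ne f g l hf]
    · simp
    · simp

theorem hom_ext {X Y : 𝒢} {f f' : X ⟶ Y} (hσ : ∀ l, Hom.σ f l = Hom.σ f' l)
    (hα : ∀ l, Hom.leg f l = Hom.leg f' l) (hβ : ∀ v, Hom.vert f v = Hom.vert f' v) : f = f' :=
  Hom.ext' hσ hα hβ

section

variable {X Y Z : 𝒢} (f : X ⟶ Y) (g : Y ⟶ Z)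

@[simp] theorem comp_σ_leg (m : Y.L) : Hom.σ (f ≫ g) (Hom.leg f m) = Hom.leg f (Hom.σ g m) :=
  Hom.comp_σ_leg f g m

theorem comp_σ_of_ne (l : X.L) (h : Hom.σ f l ≠ l) : Hom.σ (f ≫ g) l = Hom.σ f l :=
  Hom.comp_σ_of_ne f g l h

@[simp] theorem comp_leg (l : Z.L) : Hom.leg (f ≫ g) l = Hom.leg f (Hom.leg g l) := rfl

@[simp] theorem comp_vert (v : X.V) : Hom.vert (f ≫ g) v = Hom.vert g (Hom.vert f v) :=
  Hom.comp_vert f g v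

@[simp] theorem id_σ (l : X.L) : Hom.σ (𝟙 X) l = l := rfl

@[simp] theorem id_leg (l : X.L) : Hom.leg (𝟙 X) l = l := rfl

@[simp] theorem id_vert (v : X.V) : Hom.vert (𝟙 X) v = v := rfl

end

/-- An isomorphism of objects, as an isomorphism of `𝒢`. -/
noncomputable def isoOfEquiv {X Y : 𝒢} (eL : X.L ≃ Y.L) (eV : X.V ≃ Y.V)
    (hp : ∀ l, eV (X.p l) = Y.p (eL l)) (hg : ∀ v, Y.g (eV v) = X.g v) : X ≅ Y where
  hom := Hom.ofEquiv eL eV hp hg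
  inv := Hom.ofEquiv eL.symm eV.symm
    (fun l => by rw [Equiv.symm_apply_eq, hp, Equiv.apply_symm_apply])
    (fun v => by rw [← hg, Equiv.apply_symm_apply])
  hom_inv_id := hom_ext (fun l => Hom.comp_ofEquiv_σ _ _ _ _ _ l)
    (fun l => eL.symm_apply_apply l)
    (fun v => eV.symm_apply_apply v)
  inv_hom_id := hom_ext (fun l => Hom.comp_ofEquiv_σ _ _ _ _ _ l)
    (fun l => eL.apply_symm_apply l)
    (fun v => eV.apply_symm_apply v)

/-! ### The symmetric monoidal structure: disjoint union -/

/-- The disjoint union of two objects. -/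
def tensor (X Y : 𝒢) : 𝒢 where
  L := .sum X.L Y.L
  V := .sum X.V Y.V
  p := Sum.map X.p Y.p
  g := Sum.elim X.g Y.g

/-- The empty graph. -/
def empty : 𝒢 where
  L := .fin 0
  V := .fin 0
  p := Fin.elim0
  g := Fin.elim0

instance : IsEmpty empty.L := inferInstanceAs (IsEmpty (Fin 0))
instance : IsEmpty empty.V := inferInstanceAs (IsEmpty (Fin 0))

theorem ite_eq_of_iff {P Q : Prop} {_ : Decidable P} {_ : Decidable Q} (h : P ↔ Q) {a b : ℤ} :
    (if P then a else b) = if Q then a else b := if_congr h rfl rfl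

/-- The disjoint union of two morphisms. -/
noncomputable def tensorHom {X₁ Y₁ X₂ Y₂ : 𝒢} (f₁ : Hom X₁ Y₁) (f₂ : Hom X₂ Y₂) :
    Hom (tensor X₁ X₂) (tensor Y₁ Y₂) :=
  have inv : Function.Involutive
      (Sum.map f₁.σ f₂.σ : (tensor X₁ X₂).L → (tensor X₁ X₂).L) := by
    rintro (l | l)
    · exact congrArg Sum.inl (f₁.σ_invol l)
    · exact congrArg Sum.inr (f₂.σ_invol l)
  Hom.mk' (X := tensor X₁ X₂) (Y := tensor Y₁ Y₂) (Sum.map f₁.σ f₂.σ) inv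
    (Sum.map f₁.leg f₂.leg) (f₁.leg_injective.sumMap f₂.leg_injective)
    (by
      rintro (l | l)
      · constructor
        · intro h
          obtain ⟨m, hm⟩ := f₁.exists_leg l (Sum.inl_injective h)
          exact ⟨Sum.inl m, congrArg Sum.inl hm⟩
        · rintro ⟨m | m, hm⟩
          · obtain rfl := Sum.inl_injective hm
            exact congrArg Sum.inl (f₁.σ_leg m)
          · cases hm
      · constructor
        · intro h
          obtain ⟨m, hm⟩ := f₂.exists_leg l (Sum.inr_injective h)
          exact ⟨Sum.inr m, congrArg Sum.inr hm⟩
        · rintro ⟨m | m, hm⟩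
          · cases hm
          · obtain rfl := Sum.inr_injective hm
            exact congrArg Sum.inr (f₂.σ_leg m))
    (Sum.map f₁.vert f₂.vert) (f₁.vert_surjective.sumMap f₂.vert_surjective)
    (by
      rintro (l | l)
      · exact congrArg Sum.inl (f₁.vert_p_σ l)
      · exact congrArg Sum.inr (f₂.vert_p_σ l))
    (by
      let Γ := (tensor X₁ X₂).graph (Sum.map f₁.σ f₂.σ) inv
      let A : f₁.Γ.Component → Γ.Component := Quot.lift (fun v => Γ.component (Sum.inl v)) (by
        rintro _ _ ⟨l, hl, rfl, rfl⟩
        exact (Γ.component_p_σ (Sum.inl l)).symm)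
      let B : f₂.Γ.Component → Γ.Component := Quot.lift (fun v => Γ.component (Sum.inr v)) (by
        rintro _ _ ⟨l, hl, rfl, rfl⟩
        exact (Γ.component_p_σ (Sum.inr l)).symm)
      rintro (v | v) (w | w) h
      · exact congrArg A ((f₁.component_eq_iff v w).2 (Sum.inl_injective h))
      · cases h
      · cases h
      · exact congrArg B ((f₂.component_eq_iff v w).2 (Sum.inr_injective h)))
    (by
      rintro (l | l)
      · exact congrArg Sum.inl (f₁.vert_p_leg l)
      · exact congrArg Sum.inr (f₂.vert_p_leg l))
    (by
      classical
      rintro (y | y)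
      · refine Eq.trans ?_ (f₁.count_vert y)
        unfold Hom.count
        refine congrArg₂ (· + ·) ((Fintype.sum_sum_type _).trans ?_)
          ((Fintype.sum_sum_type _).trans ?_)
        · exact (congrArg₂ (· + ·) (Finset.sum_congr rfl fun v _ =>
            ite_eq_of_iff (Sum.inl_injective.eq_iff (a := f₁.vert v) (b := y)))
            (Finset.sum_eq_zero fun v _ => if_neg (fun h => by cases h))).trans (add_zero _)
        · exact (congrArg₂ (· + ·) (Finset.sum_congr rfl fun l _ => ite_eq_of_iff (and_congr
            (not_congr (Sum.inl_injective.eq_iff (a := f₁.σ l) (b := l)))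
            (Sum.inl_injective.eq_iff (a := f₁.vert (X₁.p l)) (b := y))))
            (Finset.sum_eq_zero fun l _ => if_neg (fun h => by cases h.2))).trans (add_zero _)
      · refine Eq.trans ?_ (f₂.count_vert y)
        unfold Hom.count
        refine congrArg₂ (· + ·) ((Fintype.sum_sum_type _).trans ?_)
          ((Fintype.sum_sum_type _).trans ?_)
        · exact (congrArg₂ (· + ·) (Finset.sum_eq_zero fun v _ => if_neg (fun h => by cases h))
            (Finset.sum_congr rfl fun v _ =>
            ite_eq_of_iff (Sum.inr_injective.eq_iff (a := f₂.vert v) (b := y)))).trans (zero_add _)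
        · exact (congrArg₂ (· + ·) (Finset.sum_eq_zero fun l _ => if_neg (fun h => by cases h.2))
            (Finset.sum_congr rfl fun l _ => ite_eq_of_iff (and_congr
            (not_congr (Sum.inr_injective.eq_iff (a := f₂.σ l) (b := l)))
            (Sum.inr_injective.eq_iff (a := f₂.vert (X₂.p l)) (b := y))))).trans (zero_add _))

section

variable {X₁ Y₁ Z₁ X₂ Y₂ Z₂ : 𝒢}

theorem tensorHom_comp (f₁ : Hom X₁ Y₁) (f₂ : Hom X₂ Y₂) (g₁ : Hom Y₁ Z₁) (g₂ : Hom Y₂ Z₂) :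
    (tensorHom f₁ f₂).comp (tensorHom g₁ g₂) = tensorHom (f₁.comp g₁) (f₂.comp g₂) := by
  refine Hom.ext' ?_ ?_ ?_
  · rintro (l | l)
    · by_cases h : f₁.σ l = l
      · obtain ⟨m, rfl⟩ := f₁.exists_leg l h
        exact (Hom.compσ_leg (tensorHom f₁ f₂) (tensorHom g₁ g₂) (Sum.inl m)).trans
          (congrArg Sum.inl (Hom.compσ_leg f₁ g₁ m).symm)
      · exact (Hom.compσ_of_ne (tensorHom f₁ f₂) (tensorHom g₁ g₂) (Sum.inl l)
          (fun h' => h (Sum.inl_injective h'))).trans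
          (congrArg Sum.inl (Hom.compσ_of_ne f₁ g₁ l h).symm)
    · by_cases h : f₂.σ l = l
      · obtain ⟨m, rfl⟩ := f₂.exists_leg l h
        exact (Hom.compσ_leg (tensorHom f₁ f₂) (tensorHom g₁ g₂) (Sum.inr m)).trans
          (congrArg Sum.inr (Hom.compσ_leg f₂ g₂ m).symm)
      · exact (Hom.compσ_of_ne (tensorHom f₁ f₂) (tensorHom g₁ g₂) (Sum.inr l)
          (fun h' => h (Sum.inr_injective h'))).trans
          (congrArg Sum.inr (Hom.compσ_of_ne f₂ g₂ l h).symm)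
  · rintro (l | l) <;> rfl
  · rintro (v | v) <;> rfl

end

/-- The associativity isomorphism. -/
noncomputable def assocIso (X Y Z : 𝒢) : tensor (tensor X Y) Z ≅ tensor X (tensor Y Z) :=
  isoOfEquiv (X := tensor (tensor X Y) Z) (Y := tensor X (tensor Y Z))
    (Equiv.sumAssoc X.L Y.L Z.L) (Equiv.sumAssoc X.V Y.V Z.V)
    (by rintro ((l | l) | l) <;> rfl) (by rintro ((l | l) | l) <;> rfl)

/-- The left unit isomorphism. -/
noncomputable def leftUnitIso (X : 𝒢) : tensor empty X ≅ X :=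
  isoOfEquiv (X := tensor empty X) (Y := X)
    (Equiv.emptySum empty.L X.L) (Equiv.emptySum empty.V X.V)
    (by rintro (l | l); exacts [isEmptyElim l, rfl])
    (by rintro (l | l); exacts [isEmptyElim l, rfl])

/-- The right unit isomorphism. -/
noncomputable def rightUnitIso (X : 𝒢) : tensor X empty ≅ X :=
  isoOfEquiv (X := tensor X empty) (Y := X)
    (Equiv.sumEmpty X.L empty.L) (Equiv.sumEmpty X.V empty.V)
    (by rintro (l | l); exacts [rfl, isEmptyElim l])
    (by rintro (l | l); exacts [rfl, isEmptyElim l])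

/-- The symmetry isomorphism. -/
noncomputable def swapIso (X Y : 𝒢) : tensor X Y ≅ tensor Y X :=
  isoOfEquiv (X := tensor X Y) (Y := tensor Y X)
    (Equiv.sumComm X.L Y.L) (Equiv.sumComm X.V Y.V)
    (by rintro (l | l) <;> rfl) (by rintro (l | l) <;> rfl)

noncomputable instance : MonoidalCategoryStruct 𝒢 where
  tensorObj := tensor
  tensorUnit := empty
  tensorHom f g := tensorHom f g
  whiskerLeft X _ _ f := tensorHom (𝟙 X) f
  whiskerRight f Y := tensorHom f (𝟙 Y)
  associator := assocIso
  leftUnitor := leftUnitIso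
  rightUnitor := rightUnitIso

section

variable {X Y Z W : 𝒢}

/-- The morphism has no edges. -/
def NoEdge (f : X ⟶ Y) : Prop := ∀ l, Hom.σ f l = l

theorem NoEdge.comp {f : X ⟶ Y} {g : Y ⟶ Z} (hf : NoEdge f) (hg : NoEdge g) : NoEdge (f ≫ g) := by
  intro l
  obtain ⟨m, rfl⟩ := Hom.exists_leg f l (hf l)
  rw [comp_σ_leg, hg]

theorem NoEdge.tensorHom {X₁ Y₁ X₂ Y₂ : 𝒢} {f₁ : X₁ ⟶ Y₁} {f₂ : X₂ ⟶ Y₂} (h₁ : NoEdge f₁)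
    (h₂ : NoEdge f₂) : NoEdge (𝒢.tensorHom f₁ f₂ : tensor X₁ X₂ ⟶ tensor Y₁ Y₂) := by
  rintro (l | l)
  · exact congrArg Sum.inl (h₁ l)
  · exact congrArg Sum.inr (h₂ l)

theorem noEdge_id (X : 𝒢) : NoEdge (𝟙 X) := fun _ => rfl

theorem NoEdge.ext {f f' : X ⟶ Y} (h : NoEdge f) (h' : NoEdge f')
    (hα : ∀ l, Hom.leg f l = Hom.leg f' l) (hβ : ∀ v, Hom.vert f v = Hom.vert f' v) : f = f' :=
  hom_ext (fun l => (h l).trans (h' l).symm) hα hβ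

theorem noEdge_assocIso (X Y Z : 𝒢) : NoEdge (assocIso X Y Z).hom := fun _ => rfl
theorem noEdge_leftUnitIso (X : 𝒢) : NoEdge (leftUnitIso X).hom := fun _ => rfl
theorem noEdge_rightUnitIso (X : 𝒢) : NoEdge (rightUnitIso X).hom := fun _ => rfl
theorem noEdge_swapIso (X Y : 𝒢) : NoEdge (swapIso X Y).hom := fun _ => rfl

/-- Composing with a morphism without edges on the right does not change the involution. -/
theorem NoEdge.comp_σ (f : X ⟶ Y) {g : Y ⟶ Z} (hg : NoEdge g) (l : X.L) :
    Hom.σ (f ≫ g) l = Hom.σ f l := by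
  by_cases h : Hom.σ f l = l
  · obtain ⟨m, rfl⟩ := Hom.exists_leg f l h
    rw [comp_σ_leg, hg, h]
  · exact comp_σ_of_ne f g l h

/-- To check that a square with two sides without edges commutes. -/
theorem square_ext {f : X ⟶ Y} {e : Y ⟶ W} {e' : X ⟶ Z} {f' : Z ⟶ W} (he : NoEdge e)
    (he' : NoEdge e') (hσ : ∀ l, Hom.σ f (Hom.leg e' l) = Hom.leg e' (Hom.σ f' l))
    (hα : ∀ l, Hom.leg f (Hom.leg e l) = Hom.leg e' (Hom.leg f' l))
    (hβ : ∀ v, Hom.vert e (Hom.vert f v) = Hom.vert f' (Hom.vert e' v)) :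
    f ≫ e = e' ≫ f' := by
  refine hom_ext (fun l => ?_) hα hβ
  rw [NoEdge.comp_σ f he]
  obtain ⟨m, rfl⟩ := Hom.exists_leg e' l (he' l)
  rw [comp_σ_leg, hσ]

end

theorem assocIso_naturality {X₁ X₂ X₃ Y₁ Y₂ Y₃ : 𝒢} (f₁ : X₁ ⟶ Y₁) (f₂ : X₂ ⟶ Y₂)
    (f₃ : X₃ ⟶ Y₃) :
    (tensorHom (tensorHom f₁ f₂) f₃ : tensor (tensor X₁ X₂) X₃ ⟶ tensor (tensor Y₁ Y₂) Y₃) ≫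
      (assocIso Y₁ Y₂ Y₃).hom = (assocIso X₁ X₂ X₃).hom ≫
        (tensorHom f₁ (tensorHom f₂ f₃) : tensor X₁ (tensor X₂ X₃) ⟶ tensor Y₁ (tensor Y₂ Y₃)) := by
  refine square_ext (noEdge_assocIso _ _ _) (noEdge_assocIso _ _ _) ?_ ?_ ?_
  · rintro (l | l | l) <;> rfl
  · rintro (l | l | l) <;> rfl
  · rintro ((v | v) | v) <;> rfl

theorem leftUnitIso_naturality {X Y : 𝒢} (f : X ⟶ Y) :
    (tensorHom (𝟙 empty) f : tensor empty X ⟶ tensor empty Y) ≫ (leftUnitIso Y).hom =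
      (leftUnitIso X).hom ≫ f := by
  refine square_ext (noEdge_leftUnitIso _) (noEdge_leftUnitIso _) (fun _ => rfl) (fun _ => rfl) ?_
  rintro (v | v)
  · exact isEmptyElim v
  · rfl

theorem rightUnitIso_naturality {X Y : 𝒢} (f : X ⟶ Y) :
    (tensorHom f (𝟙 empty) : tensor X empty ⟶ tensor Y empty) ≫ (rightUnitIso Y).hom =
      (rightUnitIso X).hom ≫ f := by
  refine square_ext (noEdge_rightUnitIso _) (noEdge_rightUnitIso _) (fun _ => rfl)
    (fun _ => rfl) ?_
  rintro (v | v)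
  · rfl
  · exact isEmptyElim v

theorem swapIso_naturality {X₁ X₂ Y₁ Y₂ : 𝒢} (f₁ : X₁ ⟶ Y₁) (f₂ : X₂ ⟶ Y₂) :
    (tensorHom f₁ f₂ : tensor X₁ X₂ ⟶ tensor Y₁ Y₂) ≫ (swapIso Y₁ Y₂).hom =
      (swapIso X₁ X₂).hom ≫ (tensorHom f₂ f₁ : tensor X₂ X₁ ⟶ tensor Y₂ Y₁) := by
  refine square_ext (noEdge_swapIso _ _) (noEdge_swapIso _ _) ?_ ?_ ?_
  · rintro (l | l) <;> rfl
  · rintro (l | l) <;> rfl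
  · rintro (v | v) <;> rfl

noncomputable instance : MonoidalCategory 𝒢 :=
  MonoidalCategory.ofTensorHom
    (id_tensorHom_id := fun X Y => by
      refine hom_ext ?_ ?_ ?_ <;> rintro (l | l) <;> rfl)
    (id_tensorHom := fun _ _ _ _ => rfl)
    (tensorHom_id := fun _ _ => rfl)
    (tensorHom_comp_tensorHom := tensorHom_comp)
    (associator_naturality := assocIso_naturality)
    (leftUnitor_naturality := leftUnitIso_naturality)
    (rightUnitor_naturality := rightUnitIso_naturality)
    (pentagon := fun W X Y Z => by
      refine NoEdge.ext ?_ ?_ ?_ ?_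
      · exact (NoEdge.tensorHom (noEdge_assocIso _ _ _) (noEdge_id _)).comp
          ((noEdge_assocIso _ _ _).comp (NoEdge.tensorHom (noEdge_id _) (noEdge_assocIso _ _ _)))
      · exact (noEdge_assocIso _ _ _).comp (noEdge_assocIso _ _ _)
      · rintro (l | l | l | l) <;> rfl
      · rintro (((v | v) | v) | v) <;> rfl)
    (triangle := fun X Y => by
      refine NoEdge.ext ?_ ?_ ?_ ?_
      · exact (noEdge_assocIso _ _ _).comp (NoEdge.tensorHom (noEdge_id _) (noEdge_leftUnitIso _))
      · exact NoEdge.tensorHom (noEdge_rightUnitIso _) (noEdge_id _)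
      · rintro (l | l) <;> rfl
      · rintro ((v | v) | v)
        · rfl
        · exact Fin.elim0 v
        · rfl)

noncomputable instance : SymmetricCategory 𝒢 where
  braiding := swapIso
  braiding_naturality_left f Z := swapIso_naturality f (𝟙 Z)
  braiding_naturality_right X _ _ f := swapIso_naturality (𝟙 X) f
  hexagon_forward X Y Z := by
    refine NoEdge.ext ?_ ?_ ?_ ?_
    · exact (noEdge_assocIso _ _ _).comp ((noEdge_swapIso _ _).comp (noEdge_assocIso _ _ _))
    · exact (NoEdge.tensorHom (noEdge_swapIso _ _) (noEdge_id _)).comp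
        ((noEdge_assocIso _ _ _).comp (NoEdge.tensorHom (noEdge_id _) (noEdge_swapIso _ _)))
    · rintro (l | l | l) <;> rfl
    · rintro ((v | v) | v) <;> rfl
  hexagon_reverse X Y Z := by
    have h (X Y Z : 𝒢) : NoEdge (assocIso X Y Z).inv := fun _ => rfl
    refine NoEdge.ext ?_ ?_ ?_ ?_
    · exact (h _ _ _).comp ((noEdge_swapIso _ _).comp (h _ _ _))
    · exact (NoEdge.tensorHom (noEdge_id _) (noEdge_swapIso _ _)).comp
        ((h _ _ _).comp (NoEdge.tensorHom (noEdge_swapIso _ _) (noEdge_id _)))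
    · rintro ((l | l) | l) <;> rfl
    · rintro (v | v | v) <;> rfl
  symmetry X Y := by
    refine NoEdge.ext ((noEdge_swapIso _ _).comp (noEdge_swapIso _ _)) (noEdge_id _) ?_ ?_
    · rintro (l | l) <;> rfl
    · rintro (v | v) <;> rfl

end 𝒢

open MonoidalCategory

instance : (MorphismProperty.isomorphisms 𝒢).IsStableUnderBraiding where
  whiskerLeft X _ _ f (_ : IsIso f) := (inferInstance : IsIso (X ◁ f))
  whiskerRight f (_ : IsIso f) Y := (inferInstance : IsIso (f ▷ Y))
  associator_hom_mem X Y Z := (inferInstance : IsIso (α_ X Y Z).hom)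
  associator_inv_mem X Y Z := (inferInstance : IsIso (α_ X Y Z).inv)
  leftUnitor_hom_mem X := (inferInstance : IsIso (λ_ X).hom)
  leftUnitor_inv_mem X := (inferInstance : IsIso (λ_ X).inv)
  rightUnitor_hom_mem X := (inferInstance : IsIso (ρ_ X).hom)
  rightUnitor_inv_mem X := (inferInstance : IsIso (ρ_ X).inv)
  braiding_hom_mem X Y := (inferInstance : IsIso (β_ X Y).hom)
  braiding_inv_mem X Y := (inferInstance : IsIso (β_ X Y).inv)

/-- The groupoid `ℋ` of invertible morphisms of `𝒢`, with the symmetric monoidal structure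
of `𝒢`. -/
abbrev ℋ : Type := WideSubcategory (MorphismProperty.isomorphisms 𝒢)

/-- The inclusion `τ : ℋ ⥤ 𝒢`. -/
noncomputable abbrev τ : ℋ ⥤ 𝒢 := wideSubcategoryInclusion (MorphismProperty.isomorphisms 𝒢)

/-- The inclusion is a symmetric monoidal functor, with identity structure morphisms. -/
noncomputable instance : τ.Braided where
  toMonoidal := Functor.CoreMonoidal.toMonoidal
    { εIso := Iso.refl _
      μIso := fun _ _ => Iso.refl _ }
  braided X Y := (Category.id_comp _).trans (Category.comp_id _).symm

/-! ## Symmetric monoidal functors -/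

/-- Symmetric monoidal functors: functors with natural isomorphisms `F X ⊗ F Y ≅ F (X ⊗ Y)` and
`𝟙 ≅ F 𝟙`, coherent with the associativity, unit and symmetry isomorphisms. -/
structure SymmMonFunctor (A : Type u₁) [Category.{v₁} A] [MonoidalCategory A] [SymmetricCategory A]
    (B : Type u₂) [Category.{v₂} B] [MonoidalCategory B] [SymmetricCategory B] extends A ⥤ B where
  braided : toFunctor.Braided

namespace SymmMonFunctor

attribute [instance] braided

variable {A : Type u₁} [Category.{v₁} A] [MonoidalCategory A] [SymmetricCategory A]
  {B : Type u₂} [Category.{v₂} B] [MonoidalCategory B] [SymmetricCategory B]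

/-- Monoidal natural transformations. -/
@[ext]
structure Hom (F G : SymmMonFunctor A B) where
  hom : F.toFunctor ⟶ G.toFunctor
  isMonoidal : NatTrans.IsMonoidal hom

attribute [instance] Hom.isMonoidal

instance : Category (SymmMonFunctor A B) where
  Hom F G := Hom F G
  id F := ⟨𝟙 F.toFunctor, inferInstance⟩
  comp α β := ⟨α.hom ≫ β.hom, inferInstance⟩

variable (A B) in
/-- The functor underlying a symmetric monoidal functor. -/
def forget : SymmMonFunctor A B ⥤ A ⥤ B where
  obj F := F.toFunctor
  map α := α.hom

/-- Restriction along a symmetric monoidal functor. -/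
def restrict (T : A ⥤ B) [T.Braided] (C : Type u₃) [Category.{v₃} C] [MonoidalCategory C]
    [SymmetricCategory C] : SymmMonFunctor B C ⥤ SymmMonFunctor A C where
  obj F := ⟨T ⋙ F.toFunctor, inferInstance⟩
  map α := ⟨Functor.whiskerLeft T α.hom, inferInstance⟩

end SymmMonFunctor

section

variable (C : Type u) [Category.{v} C] [MonoidalCategory C] [SymmetricCategory C]

/-- Modular operads in `C`. -/
abbrev ModularOperad := SymmMonFunctor 𝒢 C

/-- Modular preoperads in `C`. -/
abbrev ModularPreoperad := SymmMonFunctor ℋ C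

/-- The functor `τ^*`. -/
noncomputable abbrev τUpperStar : ModularOperad C ⥤ ModularPreoperad C :=
  SymmMonFunctor.restrict τ C

end

/-! ## The coend -/

section

variable {C : Type u} [Category.{v} C] [HasColimits C]

variable (C) in
/-- The functor sending `P : ℋ ⥤ C` and `B : 𝒢` to the bifunctor `(A', A) ↦ 𝒢(A', B) × P(A)`,
where `S × X` is the coproduct of copies of `X` indexed by the set `S`. -/
noncomputable def coendIntegrand : (ℋ ⥤ C) ⥤ 𝒢 ⥤ ℋᵒᵖ ⥤ ℋ ⥤ C :=
  (Functor.whiskeringRight ℋ C (Type 0 ⥤ C)).obj sigmaConst.{0} ⋙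
    flipFunctor ℋ (Type 0) C ⋙
      Functor.whiskeringRight ℋᵒᵖ (Type 0) (ℋ ⥤ C) ⋙
        (Functor.whiskeringLeft 𝒢 (ℋᵒᵖ ⥤ Type 0) (ℋᵒᵖ ⥤ ℋ ⥤ C)).obj
          (yoneda ⋙ (Functor.whiskeringLeft ℋᵒᵖ 𝒢ᵒᵖ (Type 0)).obj τ.op)

theorem coendIntegrand_obj (P : ℋ ⥤ C) (B : 𝒢) (A' A : ℋ) :
    ((((coendIntegrand C).obj P).obj B).obj (op A')).obj A =
      ∐ fun _ : (τ.obj A' ⟶ B) => P.obj A := rfl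

variable (C) in
/-- The coend `∫^{A ∈ ℋ} 𝒢(A, B) × P(A)`, as a functor of `P : ℋ ⥤ C` and of `B : 𝒢`. -/
noncomputable def coendExtension : (ℋ ⥤ C) ⥤ 𝒢 ⥤ C :=
  coendIntegrand C ⋙
    (Functor.whiskeringRight 𝒢 (ℋᵒᵖ ⥤ ℋ ⥤ C) C).obj (coendFunctor ℋ C)

theorem coendExtension_obj (P : ℋ ⥤ C) (B : 𝒢) :
    ((coendExtension C).obj P).obj B = coend (((coendIntegrand C).obj P).obj B) := rfl

/-- The map `P(A) ⟶ ∫^{A ∈ ℋ} 𝒢(A, A₀) × P(A)` including the summand at the identity of `A`. -/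
noncomputable def coendUnit (P : ℋ ⥤ C) (A : ℋ) :
    P.obj A ⟶ ((coendExtension C).obj P).obj (τ.obj A) :=
  Sigma.ι (fun _ : (τ.obj A ⟶ τ.obj A) => P.obj A) (𝟙 (τ.obj A)) ≫
    coend.ι (((coendIntegrand C).obj P).obj (τ.obj A)) A

end

-- The heart of (i) is that morphisms of `𝒢` split over disjoint unions. For `f : X ⟶ B₁ ⊗ B₂` the
-- map `Hom.vert f` is constant along edges, so no edge joins the part of `X` over `B₁` to the part
-- over `B₂`. Hence `f` is, up to an isomorphism of its source, a disjoint union `f₁ ⊗ₘ f₂`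
-- (`𝒢.exists_decomposition`), and two such splittings differ by a pair of isomorphisms
-- (`𝒢.exists_eq_tensorHom_of_iso`). The coend at `B` is the colimit of `P` over the objects of `ℋ`
-- over `B`, a pointwise left Kan extension along `τ` (`isColimitCoendExtensionCocone`). As `⊗`
-- preserves colimits in each variable and `P` is strong monoidal, the tensor product of the coends
-- at `B₁` and `B₂` is a colimit over pairs of such objects, and splitting identifies it with the
-- coend at `B₁ ⊗ B₂` (`isColimitCoendTensorCocone`). Over the empty graph every morphism is
-- invertible, which settles the unit. So the Kan extension is again symmetric monoidal, and its
-- usual unit and counit are monoidal transformations.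
--
-- For (ii), the shape of reflexive pairs is sifted, and for a sifted shape the tensor product of
-- two colimits is the colimit of the diagonal tensor products. Pointwise sifted colimits of
-- symmetric monoidal functors are therefore symmetric monoidal and are colimits in the category of
-- such functors (`isColimitLiftCocone`). Hence modular operads have reflexive coequalizers and
-- `τ^*` preserves them; it is conservative because `τ` is surjective on objects. The reflexive form
-- of Beck's theorem applies.
--
-- For (iii), a preoperad amounts to its values on graphs with one vertex: `Corolla.equivalence`
-- identifies preoperads with functors `Corolla ⥤ C`, the inverse sending `M` to the tensor product
-- of its values over the vertices. A set of vertices has no preferred order or bracketing, so this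
-- rests on coherence: two bracketings of the same distinct labels are related by exactly one
-- coherence morphism (`TensorTree.exists_coh`, `TensorTree.Coh.unique`), which is proved by moving
-- one label at a time to the front. Identities are checked up to coherence, in the sense of
-- `TensorTree.Rel`, and become equalities by `Rel.eq`. The inclusion of a vertex into a graph is
-- not a morphism of `𝒢`; the maps `Loc` supply such inclusions, and invertible morphisms are the
-- maps `Loc` that are bijective on vertices.
--
-- Modular operads then have a faithful, conservative right adjoint `U` to `Corolla ⥤ C` preserving
-- sifted colimits. Cocompleteness follows by lifting adjoints along monadic functors, and the left
-- adjoints of the evaluations of `U` carry a strong generator of presentable objects of `C` to one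
-- of modular operads.

universe w w'

/-! ### Splitting morphisms over disjoint unions and over the empty graph -/

namespace 𝒢

open scoped Classical in
/-- The restriction of a morphism to a union of components of its graph. -/
theorem Hom.exists_restrict {X Y X' Y' : 𝒢} (f : Hom X Y) (iV : X'.V → X.V) (iL : X'.L → X.L)
    (jV : Y'.V → Y.V) (jL : Y'.L → Y.L) (iV_inj : Function.Injective iV)
    (iL_inj : Function.Injective iL) (jV_inj : Function.Injective jV)
    (jL_inj : Function.Injective jL) (hXp : ∀ l, X.p (iL l) = iV (X'.p l))
    (hYp : ∀ l, Y.p (jL l) = jV (Y'.p l)) (hXg : ∀ v, X.g (iV v) = X'.g v)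
    (hYg : ∀ v, Y.g (jV v) = Y'.g v) (hXL : ∀ l v, X.p l = iV v → ∃ l', iL l' = l)
    (hYL : ∀ l v, Y.p l = jV v → ∃ l', jL l' = l)
    (hV : ∀ v, (∃ y, f.vert v = jV y) ↔ ∃ v', iV v' = v) :
    ∃ f' : Hom X' Y', (∀ l, f.σ (iL l) = iL (f'.σ l)) ∧ (∀ m, f.leg (jL m) = iL (f'.leg m)) ∧
      ∀ v, f.vert (iV v) = jV (f'.vert v) := by
  have h1 : ∀ v, ∃ y, f.vert (iV v) = jV y := fun v => (hV _).2 ⟨v, rfl⟩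
  choose vert hvert using h1
  have h2 : ∀ l, ∃ l', iL l' = f.σ (iL l) := fun l => by
    obtain ⟨v, hv⟩ := (hV (X.p (f.σ (iL l)))).1 ⟨vert (X'.p l), by
      rw [f.vert_p_σ, hXp, hvert]⟩
    exact hXL _ v hv.symm
  choose σ hσ using h2
  have h3 : ∀ m, ∃ l', iL l' = f.leg (jL m) := fun m => by
    obtain ⟨v, hv⟩ := (hV (X.p (f.leg (jL m)))).1 ⟨Y'.p m, by rw [f.vert_p_leg, hYp]⟩
    exact hXL _ v hv.symm
  choose leg hleg using h3
  have σ_invol : Function.Involutive σ := fun l => iL_inj (by rw [hσ, hσ, f.σ_invol])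
  have vert_p_σ : ∀ l, vert (X'.p (σ l)) = vert (X'.p l) := fun l => jV_inj (by
    rw [← hvert, ← hvert, ← hXp, ← hXp, hσ, f.vert_p_σ])
  refine ⟨Hom.mk' σ σ_invol leg ?_ ?_ vert ?_ vert_p_σ ?_ ?_ ?_, fun l => (hσ l).symm,
    fun m => (hleg m).symm, hvert⟩
  · intro a b h
    exact jL_inj (f.leg_injective (by rw [← hleg, ← hleg, h]))
  · intro l
    constructor
    · intro h
      obtain ⟨m, hm⟩ := f.exists_leg (iL l) (by rw [← hσ, h])
      obtain ⟨m', rfl⟩ := hYL m (vert (X'.p l)) (by rw [← f.vert_p_leg, hm, hXp, hvert])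
      exact ⟨m', iL_inj (by rw [hleg, hm])⟩
    · rintro ⟨m, rfl⟩
      exact iL_inj (by rw [hσ, hleg, f.σ_leg])
  · intro y
    obtain ⟨v, hv⟩ := f.vert_surjective (jV y)
    obtain ⟨v', rfl⟩ := (hV v).1 ⟨y, hv⟩
    exact ⟨v', jV_inj (by rw [← hvert, hv])⟩
  -- Components of `f` outside the image of `iV` are sent to `none`, which makes the map total. It
  -- is well defined because, by `hXL`, no edge of `f` joins the image of `iV` to its complement.
  · let A : f.Γ.Component → Option (X'.graph σ σ_invol).Component :=
      Quot.lift (fun v => if h : ∃ v', iV v' = v then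
        some ((X'.graph σ σ_invol).component h.choose) else none) (by
        rintro _ _ ⟨l, -, rfl, rfl⟩
        have key : ∀ l', iL l' = l → (∃ v', iV v' = X.p l) ∧ (∃ v', iV v' = X.p (f.σ l)) :=
          fun l' h => ⟨⟨X'.p l', by rw [← h, hXp]⟩, ⟨X'.p (σ l'), by rw [← h, ← hσ, hXp]⟩⟩
        by_cases h : ∃ v', iV v' = X.p l
        · obtain ⟨v', hv'⟩ := h
          obtain ⟨l', rfl⟩ := hXL l v' hv'.symm
          have k := key l' rfl
          have e1 : k.1.choose = X'.p l' := iV_inj (by rw [k.1.choose_spec, hXp])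
          have e2 : k.2.choose = X'.p (σ l') := iV_inj (by rw [k.2.choose_spec, ← hσ, hXp])
          have e3 := (X'.graph σ σ_invol).component_p_σ l'
          change (if h : ∃ v', iV v' = X.p (iL l') then
            some ((X'.graph σ σ_invol).component h.choose) else none) =
            (if h : ∃ v', iV v' = X.p (f.σ (iL l')) then
            some ((X'.graph σ σ_invol).component h.choose) else none)
          rw [dif_pos k.1, dif_pos k.2, e1, e2]
          exact congrArg some e3.symm
        · have h' : ¬ ∃ v', iV v' = X.p (f.σ l) := by
            rintro ⟨v', hv'⟩
            obtain ⟨l', hl'⟩ := hXL _ v' hv'.symm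
            have : iL (σ l') = l := by rw [hσ, hl', f.σ_invol]
            exact h (key _ this).1
          change (if h : ∃ v', iV v' = X.p l then
            some ((X'.graph σ σ_invol).component h.choose) else none) =
            (if h : ∃ v', iV v' = X.p (f.σ l) then
            some ((X'.graph σ σ_invol).component h.choose) else none)
          rw [dif_neg h, dif_neg h'])
    have hA : ∀ v, A (f.Γ.component (iV v)) = some ((X'.graph σ σ_invol).component v) := by
      intro v
      have h : ∃ v', iV v' = iV v := ⟨v, rfl⟩
      refine (dif_pos h).trans ?_
      rw [iV_inj h.choose_spec]
    intro v w h
    have h' := (f.component_eq_iff (iV v) (iV w)).2 (by rw [hvert, hvert, h])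
    have := congrArg A h'
    rw [hA, hA] at this
    exact Option.some_injective _ this
  · intro m
    exact jV_inj (by rw [← hvert, ← hXp, hleg, f.vert_p_leg, hYp])
  -- The genus condition is inherited from `f` at `jV y`: by `hV` and `hXL`, vertices and flags
  -- outside the images contribute nothing to that count.
  · intro y
    rw [← hYg, ← f.count_vert (jV y)]
    unfold Hom.count
    refine congrArg₂ (· + ·) (Fintype.sum_of_injective iV iV_inj _ _ ?_ ?_)
      (Fintype.sum_of_injective iL iL_inj _ _ ?_ ?_)
    · intro v hv
      exact if_neg fun h => hv ((hV v).1 ⟨y, h⟩)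
    · intro v
      rw [hvert, hXg]
      exact ite_eq_of_iff jV_inj.eq_iff.symm
    · intro l hl
      refine if_neg fun h => hl ?_
      obtain ⟨v, hv⟩ := (hV _).1 ⟨y, h.2⟩
      exact hXL l v hv.symm
    · intro l
      rw [hXp, hvert, ← hσ]
      exact ite_eq_of_iff (and_congr (not_congr iL_inj.eq_iff.symm) jV_inj.eq_iff.symm)

section

variable {X₁ X₂ Y₁ Y₂ : 𝒢}

/-- Vertices decide everything: a flag follows the vertex it meets, and an edge stays within one
component. The restrictions of `f` to the two parts therefore reassemble to `f`. -/
theorem exists_eq_tensorHom (f : X₁ ⊗ X₂ ⟶ Y₁ ⊗ Y₂)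
    (h₁ : ∀ v : X₁.V, ∃ y : Y₁.V, Hom.vert f (Sum.inl v) = Sum.inl y)
    (h₂ : ∀ v : X₂.V, ∃ y : Y₂.V, Hom.vert f (Sum.inr v) = Sum.inr y) :
    ∃ (f₁ : X₁ ⟶ Y₁) (f₂ : X₂ ⟶ Y₂), f = f₁ ⊗ₘ f₂ := by
  obtain ⟨f₁, hσ₁, hl₁, hv₁⟩ := Hom.exists_restrict (X' := X₁) (Y' := Y₁) f
    Sum.inl Sum.inl Sum.inl Sum.inl
    Sum.inl_injective Sum.inl_injective Sum.inl_injective Sum.inl_injective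
    (fun _ => rfl) (fun _ => rfl) (fun _ => rfl) (fun _ => rfl)
    (by rintro (l | l) v h; exacts [⟨l, rfl⟩, (by cases h)])
    (by rintro (l | l) v h; exacts [⟨l, rfl⟩, (by cases h)])
    (by
      rintro (v | v)
      · exact ⟨fun _ => ⟨v, rfl⟩, fun _ => h₁ v⟩
      · constructor
        · rintro ⟨y, hy⟩
          obtain ⟨y', hy'⟩ := h₂ v
          cases hy.symm.trans hy'
        · rintro ⟨v', hv'⟩
          cases hv')
  obtain ⟨f₂, hσ₂, hl₂, hv₂⟩ := Hom.exists_restrict (X' := X₂) (Y' := Y₂) f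
    Sum.inr Sum.inr Sum.inr Sum.inr
    Sum.inr_injective Sum.inr_injective Sum.inr_injective Sum.inr_injective
    (fun _ => rfl) (fun _ => rfl) (fun _ => rfl) (fun _ => rfl)
    (by rintro (l | l) v h; exacts [(by cases h), ⟨l, rfl⟩])
    (by rintro (l | l) v h; exacts [(by cases h), ⟨l, rfl⟩])
    (by
      rintro (v | v)
      · constructor
        · rintro ⟨y, hy⟩
          obtain ⟨y', hy'⟩ := h₁ v
          cases hy.symm.trans hy'
        · rintro ⟨v', hv'⟩
          cases hv'
      · exact ⟨fun _ => ⟨v, rfl⟩, fun _ => h₂ v⟩)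
  refine ⟨f₁, f₂, hom_ext ?_ ?_ ?_⟩
  · rintro (l | l); exacts [hσ₁ l, hσ₂ l]
  · rintro (l | l); exacts [hl₁ l, hl₂ l]
  · rintro (v | v); exacts [hv₁ v, hv₂ v]

theorem tensorHom_inj {f₁ g₁ : X₁ ⟶ Y₁} {f₂ g₂ : X₂ ⟶ Y₂} (h : f₁ ⊗ₘ f₂ = g₁ ⊗ₘ g₂) :
    f₁ = g₁ ∧ f₂ = g₂ := by
  constructor
  · refine hom_ext (fun l => ?_) (fun l => ?_) (fun v => ?_)
    · exact Sum.inl_injective (congrArg (fun f : X₁ ⊗ X₂ ⟶ Y₁ ⊗ Y₂ => Hom.σ f (Sum.inl l)) h)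
    · exact Sum.inl_injective (congrArg (fun f : X₁ ⊗ X₂ ⟶ Y₁ ⊗ Y₂ => Hom.leg f (Sum.inl l)) h)
    · exact Sum.inl_injective (congrArg (fun f : X₁ ⊗ X₂ ⟶ Y₁ ⊗ Y₂ => Hom.vert f (Sum.inl v)) h)
  · refine hom_ext (fun l => ?_) (fun l => ?_) (fun v => ?_)
    · exact Sum.inr_injective (congrArg (fun f : X₁ ⊗ X₂ ⟶ Y₁ ⊗ Y₂ => Hom.σ f (Sum.inr l)) h)
    · exact Sum.inr_injective (congrArg (fun f : X₁ ⊗ X₂ ⟶ Y₁ ⊗ Y₂ => Hom.leg f (Sum.inr l)) h)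
    · exact Sum.inr_injective (congrArg (fun f : X₁ ⊗ X₂ ⟶ Y₁ ⊗ Y₂ => Hom.vert f (Sum.inr v)) h)

/-- A morphism between disjoint unions over a disjoint union is a disjoint union. -/
theorem exists_eq_tensorHom_of_comp {Z₁ Z₂ : 𝒢} (h : X₁ ⊗ X₂ ⟶ Z₁ ⊗ Z₂) (f₁ : X₁ ⟶ Y₁)
    (f₂ : X₂ ⟶ Y₂) (g₁ : Z₁ ⟶ Y₁) (g₂ : Z₂ ⟶ Y₂) (w : h ≫ (g₁ ⊗ₘ g₂) = f₁ ⊗ₘ f₂) :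
    ∃ (h₁ : X₁ ⟶ Z₁) (h₂ : X₂ ⟶ Z₂), h = h₁ ⊗ₘ h₂ ∧ h₁ ≫ g₁ = f₁ ∧ h₂ ≫ g₂ = f₂ := by
  have hw : ∀ v : (X₁ ⊗ X₂ : 𝒢).V, Hom.vert (g₁ ⊗ₘ g₂) (Hom.vert h v) = Hom.vert (f₁ ⊗ₘ f₂) v :=
    fun v => congrArg (fun f : X₁ ⊗ X₂ ⟶ Y₁ ⊗ Y₂ => Hom.vert f v) w
  -- On vertices `g₁ ⊗ₘ g₂` and `f₁ ⊗ₘ f₂` both preserve the two summands, so `h` cannot mix them.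
  obtain ⟨h₁, h₂, rfl⟩ := exists_eq_tensorHom h
    (fun v => by
      have h' := hw (Sum.inl v)
      rcases hx : Hom.vert h (Sum.inl v) with x | x
      · exact ⟨x, rfl⟩
      · rw [hx] at h'
        cases h')
    (fun v => by
      have h' := hw (Sum.inr v)
      rcases hx : Hom.vert h (Sum.inr v) with x | x
      · rw [hx] at h'
        cases h'
      · exact ⟨x, rfl⟩)
  rw [tensorHom_comp_tensorHom] at w
  exact ⟨h₁, h₂, rfl, tensorHom_inj w⟩

/-- The inverse of `h` is also a morphism over the disjoint union, so it splits too, and injectivity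
of `⊗ₘ` shows that the pieces are mutually inverse. -/
theorem exists_eq_tensorHom_of_iso (h : X₁ ⊗ X₂ ⟶ Y₁ ⊗ Y₂) [IsIso h] {Z₁ Z₂ : 𝒢}
    (f₁ : X₁ ⟶ Z₁) (f₂ : X₂ ⟶ Z₂) (g₁ : Y₁ ⟶ Z₁) (g₂ : Y₂ ⟶ Z₂)
    (w : h ≫ (g₁ ⊗ₘ g₂) = f₁ ⊗ₘ f₂) :
    ∃ (h₁ : X₁ ⟶ Y₁) (h₂ : X₂ ⟶ Y₂), IsIso h₁ ∧ IsIso h₂ ∧ h = h₁ ⊗ₘ h₂ ∧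
      h₁ ≫ g₁ = f₁ ∧ h₂ ≫ g₂ = f₂ := by
  obtain ⟨h₁, h₂, rfl, w₁, w₂⟩ := exists_eq_tensorHom_of_comp h f₁ f₂ g₁ g₂ w
  obtain ⟨k₁, k₂, hk, -, -⟩ := exists_eq_tensorHom_of_comp (inv (h₁ ⊗ₘ h₂)) g₁ g₂ f₁ f₂
    (by rw [IsIso.inv_comp_eq, w])
  have e₁ := IsIso.hom_inv_id (h₁ ⊗ₘ h₂)
  have e₂ := IsIso.inv_hom_id (h₁ ⊗ₘ h₂)
  rw [hk, tensorHom_comp_tensorHom, ← id_tensorHom_id] at e₁ e₂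
  obtain ⟨a, b⟩ := tensorHom_inj e₁
  obtain ⟨c, d⟩ := tensorHom_inj e₂
  exact ⟨h₁, h₂, ⟨k₁, a, c⟩, ⟨k₂, b, d⟩, rfl, w₁, w₂⟩

end

/-- The part of an object consisting of the vertices with a given property. -/
noncomputable def sub (X : 𝒢) (P : X.V → Prop) : 𝒢 where
  L := .fin (Nat.card {l // P (X.p l)})
  V := .fin (Nat.card {v // P v})
  p := fun l => Finite.equivFin {v // P v}
    ⟨X.p ((Finite.equivFin {l // P (X.p l)}).symm l).1,
      ((Finite.equivFin {l // P (X.p l)}).symm l).2⟩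
  g := fun v => X.g ((Finite.equivFin {v // P v}).symm v).1

open scoped Classical in
/-- An object is the disjoint union of two complementary parts. -/
noncomputable def subIso (X : 𝒢) (P : X.V → Prop) : X.sub P ⊗ X.sub (fun v => ¬ P v) ≅ X :=
  isoOfEquiv (X := tensor (X.sub P) (X.sub (fun v => ¬ P v)))
    ((Equiv.sumCongr (Finite.equivFin {l // P (X.p l)}).symm
      (Finite.equivFin {l // ¬ P (X.p l)}).symm).trans (Equiv.sumCompl fun l => P (X.p l)))
    ((Equiv.sumCongr (Finite.equivFin {v // P v}).symm
      (Finite.equivFin {v // ¬ P v}).symm).trans (Equiv.sumCompl P))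
    (by
      rintro (l | l)
      · exact congrArg Subtype.val ((Finite.equivFin {v // P v}).symm_apply_apply _)
      · exact congrArg Subtype.val ((Finite.equivFin {v // ¬ P v}).symm_apply_apply _))
    (by rintro (v | v) <;> rfl)

theorem subIso_hom_vert_inl (X : 𝒢) (P : X.V → Prop) (v : (X.sub P).V) :
    P (Hom.vert (X.subIso P).hom (Sum.inl v)) :=
  ((Finite.equivFin {v // P v}).symm v).2

theorem subIso_hom_vert_inr (X : 𝒢) (P : X.V → Prop) (v : (X.sub fun v => ¬ P v).V) :
    ¬ P (Hom.vert (X.subIso P).hom (Sum.inr v)) :=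
  ((Finite.equivFin {v // ¬ P v}).symm v).2

/-- A morphism to a disjoint union is, up to isomorphism, a disjoint union. -/
theorem exists_decomposition {X Y₁ Y₂ : 𝒢} (f : X ⟶ Y₁ ⊗ Y₂) :
    ∃ (X₁ X₂ : 𝒢) (e : X₁ ⊗ X₂ ≅ X) (f₁ : X₁ ⟶ Y₁) (f₂ : X₂ ⟶ Y₂), e.hom ≫ f = f₁ ⊗ₘ f₂ := by
  let P : X.V → Prop := fun v => ∃ y : Y₁.V, Hom.vert f v = Sum.inl y
  obtain ⟨f₁, f₂, h⟩ := exists_eq_tensorHom ((X.subIso P).hom ≫ f)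
    (fun v => by
      obtain ⟨y, hy⟩ := subIso_hom_vert_inl X P v
      exact ⟨y, hy⟩)
    (fun v => by
      have h := subIso_hom_vert_inr X P v
      rcases hx : Hom.vert f (Hom.vert (X.subIso P).hom (Sum.inr v)) with x | x
      · exact absurd ⟨x, hx⟩ h
      · exact ⟨x, hx⟩)
  exact ⟨_, _, X.subIso P, f₁, f₂, h⟩

/-- An edge of `f` remains an edge of every composite `f ≫ g`, and identities have none. -/
theorem noEdge_of_isIso {X Y : 𝒢} (f : X ⟶ Y) [IsIso f] : NoEdge f := fun l => by
  by_contra h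
  have := comp_σ_of_ne f (inv f) l h
  rw [IsIso.hom_inv_id] at this
  exact h this.symm

theorem isEmpty_of_hom {X : 𝒢} (f : X ⟶ 𝟙_ 𝒢) : IsEmpty X.V :=
  ⟨fun v => isEmptyElim (α := empty.V) (Hom.vert f v)⟩

theorem isEmpty_L {X : 𝒢} [IsEmpty X.V] : IsEmpty X.L := ⟨fun l => isEmptyElim (X.p l)⟩

theorem hom_unit_ext {X : 𝒢} (f g : X ⟶ 𝟙_ 𝒢) : f = g := by
  have := isEmpty_of_hom f
  have := isEmpty_L (X := X)
  exact hom_ext (fun l => isEmptyElim l) (fun l => isEmptyElim (α := empty.L) l)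
    (fun v => isEmptyElim v)

/-- A graph mapping to the empty graph has no vertices, hence no flags, so it is isomorphic to the
empty graph, and morphisms to the latter are unique. -/
theorem isIso_of_hom_unit {X : 𝒢} (f : X ⟶ 𝟙_ 𝒢) : IsIso f := by
  have := isEmpty_of_hom f
  have := isEmpty_L (X := X)
  let e : empty ≅ X := isoOfEquiv (Equiv.equivOfIsEmpty _ _) (Equiv.equivOfIsEmpty _ _)
    (fun l => isEmptyElim l) (fun l => isEmptyElim l)
  refine ⟨e.hom, ?_, hom_unit_ext _ _⟩
  -- Endomorphisms of `X` are compared after mapping to the empty graph.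
  rw [← cancel_mono e.inv]
  exact hom_unit_ext _ _

end 𝒢

/-! ### Constructing monoidal functors; tensor products of colimits -/

section

variable {A : Type u₁} [Category.{v₁} A] [MonoidalCategory A] [SymmetricCategory A]
  {B : Type u₂} [Category.{v₂} B] [MonoidalCategory B] [SymmetricCategory B]

/-- A constructor for strong monoidal functors between symmetric monoidal categories, in which
right unitality is a consequence of left unitality and of the compatibility with the braiding. -/
abbrev CategoryTheory.Functor.Braided.ofIsos (F : A ⥤ B) (ε : 𝟙_ B ≅ F.obj (𝟙_ A))
    (μ : ∀ X Y, F.obj X ⊗ F.obj Y ≅ F.obj (X ⊗ Y))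
    (natural : ∀ {X Y X' Y' : A} (f : X ⟶ Y) (g : X' ⟶ Y'),
      (F.map f ⊗ₘ F.map g) ≫ (μ Y Y').hom = (μ X X').hom ≫ F.map (f ⊗ₘ g))
    (assoc : ∀ X Y Z, ((μ X Y).hom ⊗ₘ 𝟙 (F.obj Z)) ≫ (μ (X ⊗ Y) Z).hom ≫ F.map (α_ X Y Z).hom =
      (α_ (F.obj X) (F.obj Y) (F.obj Z)).hom ≫ (𝟙 (F.obj X) ⊗ₘ (μ Y Z).hom) ≫ (μ X (Y ⊗ Z)).hom)
    (left_unit : ∀ X, (λ_ (F.obj X)).hom =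
      (ε.hom ⊗ₘ 𝟙 (F.obj X)) ≫ (μ (𝟙_ A) X).hom ≫ F.map (λ_ X).hom)
    (braided : ∀ X Y, (μ X Y).hom ≫ F.map (β_ X Y).hom =
      (β_ (F.obj X) (F.obj Y)).hom ≫ (μ Y X).hom) : F.Braided where
  toMonoidal := Functor.CoreMonoidal.toMonoidal
    { εIso := ε
      μIso := μ
      μIso_hom_natural_left := fun f X' => by
        have := natural f (𝟙 X')
        rwa [F.map_id, tensorHom_id, tensorHom_id] at this
      μIso_hom_natural_right := fun X' f => by
        have := natural (𝟙 X') f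
        rwa [F.map_id, id_tensorHom, id_tensorHom] at this
      associativity := fun X Y Z => by
        have := assoc X Y Z
        rwa [tensorHom_id, id_tensorHom] at this
      left_unitality := fun X => by
        rw [left_unit, tensorHom_id]
      right_unitality := fun X => by
        rw [← braiding_leftUnitor (F.obj X), left_unit, ← braiding_leftUnitor X, F.map_comp,
          reassoc_of% braided, tensorHom_id, BraidedCategory.braiding_naturality_right_assoc] }
  braided := braided

end

section

variable {C : Type u} [Category.{v} C] [MonoidalCategory C]
  {J₁ : Type u₁} [Category.{v₁} J₁] {J₂ : Type u₂} [Category.{v₂} J₂]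

instance preservesColimit₂_curriedTensor [∀ X : C, PreservesColimitsOfShape J₂ (tensorLeft X)]
    [∀ X : C, PreservesColimitsOfShape J₁ (tensorRight X)] (F₁ : J₁ ⥤ C) (F₂ : J₂ ⥤ C)
    [HasColimitsOfShape J₁ C] [HasColimitsOfShape J₂ C] :
    PreservesColimit₂ F₁ F₂ (curriedTensor C) := by
  have (X : C) : PreservesColimit F₁ ((curriedTensor C).flip.obj X) :=
    inferInstanceAs (PreservesColimit F₁ (tensorRight X))
  have (X : C) : PreservesColimit F₂ ((curriedTensor C).obj X) :=
    inferInstanceAs (PreservesColimit F₂ (tensorLeft X))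
  exact PreservesColimit₂.of_preservesColimits_in_each_variable _

variable {F₁ : J₁ ⥤ C} {F₂ : J₂ ⥤ C} {c₁ : Cocone F₁} {c₂ : Cocone F₂}

/-- The cocone `tensor₂` is written with two whiskerings; later computations need its legs in the
form `⊗ₘ`. -/
theorem CategoryTheory.Limits.IsColimit.tensor₂_hom_ext
    [PreservesColimit₂ F₁ F₂ (curriedTensor C)] (h₁ : IsColimit c₁) (h₂ : IsColimit c₂)
    {Z : C} {f g : c₁.pt ⊗ c₂.pt ⟶ Z}
    (h : ∀ j₁ j₂, (c₁.ι.app j₁ ⊗ₘ c₂.ι.app j₂) ≫ f = (c₁.ι.app j₁ ⊗ₘ c₂.ι.app j₂) ≫ g) :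
    f = g := by
  refine (h₁.tensor₂ h₂).hom_ext fun ⟨j₁, j₂⟩ => ?_
  have e := MonoidalCategory.tensorHom_def (C := C) (X₁ := F₁.obj j₁) (Y₁ := c₁.pt)
    (X₂ := F₂.obj j₂) (Y₂ := c₂.pt) (c₁.ι.app j₁) (c₂.ι.app j₂)
  exact (congrArg (· ≫ f) e.symm).trans ((h j₁ j₂).trans (congrArg (· ≫ g) e))

end

/-! ### Maps out of the coend -/

section

variable {C : Type u} [Category.{v} C] [HasColimits C]

/-- The inclusion of the summand at `f` in the coend `∫^{A ∈ ℋ} 𝒢(A, B) × P(A)`. -/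
noncomputable def coendι (P : ℋ ⥤ C) {a : ℋ} {B : 𝒢} (f : τ.obj a ⟶ B) :
    P.obj a ⟶ ((coendExtension C).obj P).obj B :=
  Sigma.ι (fun _ : (τ.obj a ⟶ B) => P.obj a) f ≫ coend.ι (((coendIntegrand C).obj P).obj B) a

/-- This and the next three hold by definition. They present the action of the integrand in each of
its four arguments as a map of coproducts, through which `Sigma.ι` can be moved. -/
theorem coendIntegrand_map_app (P : ℋ ⥤ C) (B : 𝒢) {a a' : ℋ} (h : a ⟶ a') (b : ℋ) :
    ((((coendIntegrand C).obj P).obj B).map h.op).app b =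
      Sigma.map' (f := fun _ : τ.obj a' ⟶ B => P.obj b) (g := fun _ : τ.obj a ⟶ B => P.obj b)
        (fun k => τ.map h ≫ k) (fun _ => 𝟙 _) := rfl

theorem coendIntegrand_obj_map (P : ℋ ⥤ C) (B : 𝒢) {a a' : ℋ} (h : a ⟶ a') (b : ℋ) :
    ((((coendIntegrand C).obj P).obj B).obj (op b)).map h =
      Limits.Sigma.map (f := fun _ : τ.obj b ⟶ B => P.obj a) (g := fun _ : τ.obj b ⟶ B => P.obj a')
        (fun _ => P.map h) := rfl

theorem coendIntegrand_map_app_app (P : ℋ ⥤ C) {B B' : 𝒢} (f : B ⟶ B') (a b : ℋ) :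
    ((((coendIntegrand C).obj P).map f).app (op a)).app b =
      Sigma.map' (f := fun _ : τ.obj a ⟶ B => P.obj b) (g := fun _ : τ.obj a ⟶ B' => P.obj b)
        (fun k => k ≫ f) (fun _ => 𝟙 _) := rfl

theorem coendIntegrand_map_app_app_app {P P' : ℋ ⥤ C} (φ : P ⟶ P') (B : 𝒢) (a b : ℋ) :
    ((((coendIntegrand C).map φ).app B).app (op a)).app b =
      Limits.Sigma.map (f := fun _ : τ.obj a ⟶ B => P.obj b) (g := fun _ : τ.obj a ⟶ B => P'.obj b)
        (fun _ => φ.app b) := rfl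

/-- The defining relation of the coend, moving a morphism of `ℋ` from the coefficient `P` to the
label in `𝒢(-, B)`. -/
theorem coendι_w (P : ℋ ⥤ C) {a a' : ℋ} {B : 𝒢} (h : a ⟶ a') (f : τ.obj a' ⟶ B) :
    P.map h ≫ coendι P f = coendι P (τ.map h ≫ f) := by
  have := Sigma.ι (fun _ : (τ.obj a' ⟶ B) => P.obj a) f ≫=
    coend.condition (((coendIntegrand C).obj P).obj B) h
  rw [coendIntegrand_map_app, coendIntegrand_obj_map] at this
  have e₁ := Sigma.ι_comp_map' (f := fun _ : τ.obj a' ⟶ B => P.obj a)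
    (g := fun _ : τ.obj a ⟶ B => P.obj a) (fun k => τ.map h ≫ k) (fun _ => 𝟙 _) f
  have e₂ := Sigma.ι_map (f := fun _ : τ.obj a' ⟶ B => P.obj a)
    (g := fun _ : τ.obj a' ⟶ B => P.obj a') (fun _ => P.map h) f
  rw [Category.id_comp] at e₁
  exact ((Category.assoc _ _ _).symm.trans (e₂.symm =≫ _)).trans
    (((Category.assoc _ _ _).trans this.symm).trans
      ((Category.assoc _ _ _).symm.trans (e₁ =≫ _)))

theorem coendι_map (P : ℋ ⥤ C) {a : ℋ} {B B' : 𝒢} (f : τ.obj a ⟶ B) (b : B ⟶ B') :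
    coendι P f ≫ ((coendExtension C).obj P).map b = coendι P (f ≫ b) := by
  have := Sigma.ι (fun _ : (τ.obj a ⟶ B) => P.obj a) f ≫=
    coend.ι_map (((coendIntegrand C).obj P).map b) a
  rw [coendIntegrand_map_app_app] at this
  have e₁ := Sigma.ι_comp_map' (f := fun _ : τ.obj a ⟶ B => P.obj a)
    (g := fun _ : τ.obj a ⟶ B' => P.obj a) (fun k => k ≫ b) (fun _ => 𝟙 _) f
  rw [Category.id_comp] at e₁
  exact (Category.assoc _ _ _).trans (this.trans ((Category.assoc _ _ _).symm.trans (e₁ =≫ _)))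

theorem coendι_map_assoc (P : ℋ ⥤ C) {a : ℋ} {B B' : 𝒢} (f : τ.obj a ⟶ B) (b : B ⟶ B') {Z : C}
    (k : ((coendExtension C).obj P).obj B' ⟶ Z) :
    coendι P f ≫ ((coendExtension C).obj P).map b ≫ k = coendι P (f ≫ b) ≫ k := by
  rw [← Category.assoc, coendι_map]

theorem coendι_naturality {P P' : ℋ ⥤ C} (φ : P ⟶ P') {a : ℋ} {B : 𝒢} (f : τ.obj a ⟶ B) :
    coendι P f ≫ ((coendExtension C).map φ).app B = φ.app a ≫ coendι P' f := by
  have := Sigma.ι (fun _ : (τ.obj a ⟶ B) => P.obj a) f ≫=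
    coend.ι_map (((coendIntegrand C).map φ).app B) a
  rw [coendIntegrand_map_app_app_app] at this
  have e₂ := Sigma.ι_map (f := fun _ : τ.obj a ⟶ B => P.obj a)
    (g := fun _ : τ.obj a ⟶ B => P'.obj a) (fun _ => φ.app a) f
  exact (Category.assoc _ _ _).trans (this.trans ((Category.assoc _ _ _).symm.trans
    ((e₂ =≫ _).trans (Category.assoc _ _ _))))

theorem coendι_naturality_assoc {P P' : ℋ ⥤ C} (φ : P ⟶ P') {a : ℋ} {B : 𝒢} (f : τ.obj a ⟶ B)
    {Z : C} (k : ((coendExtension C).obj P').obj B ⟶ Z) :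
    coendι P f ≫ ((coendExtension C).map φ).app B ≫ k = φ.app a ≫ coendι P' f ≫ k := by
  rw [← Category.assoc, coendι_naturality, Category.assoc]

theorem coendExtension_hom_ext (P : ℋ ⥤ C) {B : 𝒢} {Z : C}
    {f g : ((coendExtension C).obj P).obj B ⟶ Z}
    (h : ∀ (a : ℋ) (k : τ.obj a ⟶ B), coendι P k ≫ f = coendι P k ≫ g) : f = g :=
  coend.hom_ext fun a => Sigma.hom_ext _ _ fun k =>
    (Category.assoc _ _ _).symm.trans ((h a k).trans (Category.assoc _ _ _))

/-- The universal property of the coend. -/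
noncomputable def coendExtensionDesc (P : ℋ ⥤ C) {B : 𝒢} {Z : C}
    (f : ∀ (a : ℋ), (τ.obj a ⟶ B) → (P.obj a ⟶ Z))
    (hf : ∀ {a a' : ℋ} (h : a ⟶ a') (k : τ.obj a' ⟶ B), P.map h ≫ f a' k = f a (τ.map h ≫ k)) :
    ((coendExtension C).obj P).obj B ⟶ Z :=
  coend.desc (F := ((coendIntegrand C).obj P).obj B)
    (fun a => (Sigma.desc (f a) : (∐ fun _ : (τ.obj a ⟶ B) => P.obj a) ⟶ Z)) (by
    intro a a' h
    rw [coendIntegrand_map_app, coendIntegrand_obj_map]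
    refine Sigma.hom_ext _ _ fun k => ?_
    have e₁ := Sigma.ι_comp_map' (f := fun _ : τ.obj a' ⟶ B => P.obj a)
      (g := fun _ : τ.obj a ⟶ B => P.obj a) (fun k => τ.map h ≫ k) (fun _ => 𝟙 _) k
    have e₂ := Sigma.ι_map (f := fun _ : τ.obj a' ⟶ B => P.obj a)
      (g := fun _ : τ.obj a' ⟶ B => P.obj a') (fun _ => P.map h) k
    rw [Category.id_comp] at e₁
    refine (Category.assoc _ _ _).symm.trans (((e₁ =≫ _).trans ?_).trans
      (((e₂ =≫ _).symm).trans (Category.assoc _ _ _)))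
    refine (Sigma.ι_desc _ _).trans (((hf h k).symm.trans ?_).trans (Category.assoc _ _ _).symm)
    exact congrArg (P.map h ≫ ·) (Sigma.ι_desc (f a') k).symm)

@[simp]
theorem coendι_desc (P : ℋ ⥤ C) {B : 𝒢} {Z : C}
    (f : ∀ (a : ℋ), (τ.obj a ⟶ B) → (P.obj a ⟶ Z))
    (hf : ∀ {a a' : ℋ} (h : a ⟶ a') (k : τ.obj a' ⟶ B), P.map h ≫ f a' k = f a (τ.map h ≫ k))
    {a : ℋ} (k : τ.obj a ⟶ B) :
    coendι P k ≫ coendExtensionDesc P f hf = f a k :=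
  (Category.assoc _ _ _).trans ((congrArg (Sigma.ι (fun _ : (τ.obj a ⟶ B) => P.obj a) k ≫ ·)
    (coend.ι_desc (F := ((coendIntegrand C).obj P).obj B) _ _ a)).trans (Sigma.ι_desc (f a) k))

theorem coendι_desc_assoc (P : ℋ ⥤ C) {B : 𝒢} {Z : C}
    (f : ∀ (a : ℋ), (τ.obj a ⟶ B) → (P.obj a ⟶ Z))
    (hf : ∀ {a a' : ℋ} (h : a ⟶ a') (k : τ.obj a' ⟶ B), P.map h ≫ f a' k = f a (τ.map h ≫ k))
    {a : ℋ} (k : τ.obj a ⟶ B) {Z' : C} (h : Z ⟶ Z') :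
    coendι P k ≫ coendExtensionDesc P f hf ≫ h = f a k ≫ h := by
  rw [← Category.assoc, coendι_desc]

/-- The value of the coend at `B`, as a cocone on the category of objects of `ℋ` over `B`. -/
noncomputable def coendExtensionCocone (P : ℋ ⥤ C) (B : 𝒢) :
    Cocone (CostructuredArrow.proj τ B ⋙ P) where
  pt := ((coendExtension C).obj P).obj B
  ι :=
    { app := fun f => coendι P f.hom
      naturality := fun f f' h => by
        refine (coendι_w P h.left f'.hom).trans ?_
        rw [CostructuredArrow.w h]
        exact (Category.comp_id _).symm }

/-- The coend is a pointwise left Kan extension. -/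
noncomputable def isColimitCoendExtensionCocone (P : ℋ ⥤ C) (B : 𝒢) :
    IsColimit (coendExtensionCocone P B) where
  desc s := coendExtensionDesc P (fun _ k => s.ι.app (CostructuredArrow.mk k)) (fun h k =>
    s.w (CostructuredArrow.homMk h : CostructuredArrow.mk (τ.map h ≫ k) ⟶ CostructuredArrow.mk k))
  fac s j := coendι_desc P _ _ j.hom
  uniq s m hm := coendExtension_hom_ext P fun a k =>
    (hm (CostructuredArrow.mk k)).trans (coendι_desc P (fun _ k => s.ι.app (CostructuredArrow.mk k)) _ k).symm

end

/-! ### Splittings of objects of `ℋ` over a disjoint union -/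

namespace ℋ

/-- An invertible morphism of `𝒢`, as a morphism of `ℋ`. -/
abbrev homMk {X Y : ℋ} (f : X.obj ⟶ Y.obj) (hf : IsIso f) : X ⟶ Y := ⟨f, hf⟩

instance isIso_hom {X Y : ℋ} (f : X ⟶ Y) : IsIso f :=
  have := f.property
  have : IsIso f.hom := this
  ⟨homMk (inv f.hom) (inferInstanceAs (IsIso (inv f.hom))),
    WideSubcategory.hom_ext _ (IsIso.hom_inv_id f.hom),
    WideSubcategory.hom_ext _ (IsIso.inv_hom_id f.hom)⟩

/-- The tensor product of two morphisms of `𝒢` with sources in `ℋ`. -/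
noncomputable def tensorOver {a₁ a₂ : ℋ} {B₁ B₂ : 𝒢} (f₁ : τ.obj a₁ ⟶ B₁) (f₂ : τ.obj a₂ ⟶ B₂) :
    τ.obj (a₁ ⊗ a₂) ⟶ B₁ ⊗ B₂ :=
  𝒢.tensorHom f₁ f₂

section

variable {a₁ a₂ a₃ b₁ b₂ : ℋ} {B₁ B₂ B₃ B₁' B₂' : 𝒢}

/-- This and the following lemmas restate functoriality and structure isomorphisms of `⊗` in `𝒢`
with sources of the form `τ.obj (a₁ ⊗ a₂)`, the form in which they label summands of the coend. -/
theorem map_comp_tensorOver (u₁ : a₁ ⟶ b₁) (u₂ : a₂ ⟶ b₂) (f₁ : τ.obj b₁ ⟶ B₁)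
    (f₂ : τ.obj b₂ ⟶ B₂) :
    τ.map (u₁ ⊗ₘ u₂) ≫ tensorOver f₁ f₂ = tensorOver (τ.map u₁ ≫ f₁) (τ.map u₂ ≫ f₂) :=
  tensorHom_comp_tensorHom (C := 𝒢) u₁.hom u₂.hom f₁ f₂

theorem tensorOver_comp (f₁ : τ.obj a₁ ⟶ B₁) (f₂ : τ.obj a₂ ⟶ B₂) (g₁ : B₁ ⟶ B₁')
    (g₂ : B₂ ⟶ B₂') :
    tensorOver f₁ f₂ ≫ (g₁ ⊗ₘ g₂) = tensorOver (f₁ ≫ g₁) (f₂ ≫ g₂) :=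
  tensorHom_comp_tensorHom (C := 𝒢) f₁ f₂ g₁ g₂

theorem tensorOver_assoc (f₁ : τ.obj a₁ ⟶ B₁) (f₂ : τ.obj a₂ ⟶ B₂) (f₃ : τ.obj a₃ ⟶ B₃) :
    tensorOver (tensorOver f₁ f₂) f₃ ≫ (α_ B₁ B₂ B₃).hom =
      τ.map (α_ a₁ a₂ a₃).hom ≫ tensorOver f₁ (tensorOver f₂ f₃) :=
  associator_naturality (C := 𝒢) f₁ f₂ f₃

/-- The identity of the unit object. -/
noncomputable def unitOver : τ.obj (𝟙_ ℋ) ⟶ 𝟙_ 𝒢 := 𝟙 (𝟙_ 𝒢)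

theorem tensorOver_leftUnitor (f : τ.obj a₁ ⟶ B₁) :
    tensorOver unitOver f ≫ (λ_ B₁).hom =
      τ.map (λ_ a₁).hom ≫ f :=
  𝒢.leftUnitIso_naturality f

theorem tensorOver_braiding (f₁ : τ.obj a₁ ⟶ B₁) (f₂ : τ.obj a₂ ⟶ B₂) :
    tensorOver f₁ f₂ ≫ (β_ B₁ B₂).hom = τ.map (β_ a₁ a₂).hom ≫ tensorOver f₂ f₁ :=
  𝒢.swapIso_naturality f₁ f₂

theorem tensorOver_id (a₁ a₂ : ℋ) :
    tensorOver (𝟙 (τ.obj a₁)) (𝟙 (τ.obj a₂)) = 𝟙 (τ.obj (a₁ ⊗ a₂)) :=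
  id_tensorHom_id (C := 𝒢) a₁.obj a₂.obj

theorem exists_decomposition {a : ℋ} (k : τ.obj a ⟶ B₁ ⊗ B₂) :
    ∃ (a₁ a₂ : ℋ) (h : a ⟶ a₁ ⊗ a₂) (f₁ : τ.obj a₁ ⟶ B₁) (f₂ : τ.obj a₂ ⟶ B₂),
      k = τ.map h ≫ tensorOver f₁ f₂ := by
  obtain ⟨X₁, X₂, e, f₁, f₂, h⟩ := 𝒢.exists_decomposition (X := a.obj) k
  exact ⟨⟨X₁⟩, ⟨X₂⟩, ⟨e.inv, e.isIso_inv⟩, f₁, f₂, (Iso.eq_inv_comp e).2 h⟩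

/-- Two splittings of one morphism are compared by the isomorphism `inv h ≫ h'`, which lies over `B₁
⊗ B₂` and hence is itself a disjoint union. -/
theorem exists_eq_tensorHom {a : ℋ} (h : a ⟶ a₁ ⊗ a₂)
    (h' : a ⟶ b₁ ⊗ b₂) (f₁ : τ.obj a₁ ⟶ B₁) (f₂ : τ.obj a₂ ⟶ B₂)
    (g₁ : τ.obj b₁ ⟶ B₁) (g₂ : τ.obj b₂ ⟶ B₂)
    (w : τ.map h ≫ tensorOver f₁ f₂ = τ.map h' ≫ tensorOver g₁ g₂) :
    ∃ (u₁ : a₁ ⟶ b₁) (u₂ : a₂ ⟶ b₂), h' = h ≫ (u₁ ⊗ₘ u₂) ∧ τ.map u₁ ≫ g₁ = f₁ ∧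
      τ.map u₂ ≫ g₂ = f₂ := by
  have e₀ : τ.map (inv h ≫ h') ≫ tensorOver g₁ g₂ = tensorOver f₁ f₂ := by
    rw [τ.map_comp, Category.assoc, ← w, ← Category.assoc, ← τ.map_comp, IsIso.inv_hom_id,
      τ.map_id, Category.id_comp]
  have : IsIso (inv h ≫ h').hom := (inv h ≫ h').property
  obtain ⟨u₁, u₂, i₁, i₂, e, w₁, w₂⟩ := 𝒢.exists_eq_tensorHom_of_iso
    (X₁ := a₁.obj) (X₂ := a₂.obj) (Y₁ := b₁.obj) (Y₂ := b₂.obj)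
    (inv h ≫ h').hom f₁ f₂ g₁ g₂ e₀
  refine ⟨homMk u₁ i₁, homMk u₂ i₂, ?_, w₁, w₂⟩
  exact (IsIso.inv_comp_eq h).1 (WideSubcategory.hom_ext _ e)

end

end ℋ

open ℋ Functor.LaxMonoidal Functor.OplaxMonoidal Functor.Monoidal

/-! ### The coend takes disjoint unions to tensor products -/

section

variable {C : Type u} [Category.{v} C] [MonoidalCategory C] [SymmetricCategory C]

/-- Independence of the splitting: two splittings differ by isomorphisms `u₁`, `u₂`, which are
absorbed by naturality of `δ` and by the cocone relations of `s`. -/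
theorem coendTensorCocone_desc_aux (P : ModularPreoperad C) {B₁ B₂ : 𝒢}
    (s : Cocone (externalProduct (CostructuredArrow.proj τ B₁ ⋙ P.toFunctor)
      (CostructuredArrow.proj τ B₂ ⋙ P.toFunctor)))
    {a a₁ a₂ b₁ b₂ : ℋ} (h : a ⟶ a₁ ⊗ a₂)
    (h' : a ⟶ b₁ ⊗ b₂) (f₁ : τ.obj a₁ ⟶ B₁) (f₂ : τ.obj a₂ ⟶ B₂)
    (g₁ : τ.obj b₁ ⟶ B₁) (g₂ : τ.obj b₂ ⟶ B₂)
    (w : τ.map h ≫ tensorOver f₁ f₂ = τ.map h' ≫ tensorOver g₁ g₂) :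
    P.map h ≫ δ P.toFunctor a₁ a₂ ≫ s.ι.app (CostructuredArrow.mk f₁, CostructuredArrow.mk f₂) =
      P.map h' ≫ δ P.toFunctor b₁ b₂ ≫
        s.ι.app (CostructuredArrow.mk g₁, CostructuredArrow.mk g₂) := by
  obtain ⟨u₁, u₂, rfl, rfl, rfl⟩ := ℋ.exists_eq_tensorHom h h' f₁ f₂ g₁ g₂ w
  have e := s.w ((CostructuredArrow.homMk u₁, CostructuredArrow.homMk u₂) :
    (CostructuredArrow.mk (τ.map u₁ ≫ g₁), CostructuredArrow.mk (τ.map u₂ ≫ g₂)) ⟶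
      (CostructuredArrow.mk g₁, CostructuredArrow.mk g₂))
  have n := δ_natural P.toFunctor u₁ u₂
  rw [MonoidalCategory.tensorHom_def] at n
  rw [P.map_comp, Category.assoc, ← e]
  refine congrArg (P.map h ≫ ·) ?_
  exact (Category.assoc _ _ _).symm.trans ((n =≫ _).trans (Category.assoc _ _ _))

variable [HasColimits C]

/-- The maps `P(A₁) ⊗ P(A₂) ⟶ P(A₁ ⊗ A₂) ⟶ ∫^{A ∈ ℋ} 𝒢(A, B₁ ⊗ B₂) × P(A)`. -/
noncomputable def coendTensorCocone (P : ModularPreoperad C) (B₁ B₂ : 𝒢) :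
    Cocone (externalProduct (CostructuredArrow.proj τ B₁ ⋙ P.toFunctor)
      (CostructuredArrow.proj τ B₂ ⋙ P.toFunctor)) where
  pt := ((coendExtension C).obj P.toFunctor).obj (B₁ ⊗ B₂)
  ι :=
    { app := fun j => μ P.toFunctor j.1.left j.2.left ≫
        coendι P.toFunctor (tensorOver j.1.hom j.2.hom)
      naturality := fun j j' h => by
        have e₁ := CostructuredArrow.w h.1
        have e₂ := CostructuredArrow.w h.2
        have e : τ.map (h.1.left ⊗ₘ h.2.left) ≫ tensorOver j'.1.hom j'.2.hom =
            tensorOver j.1.hom j.2.hom := by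
          rw [map_comp_tensorOver, e₁, e₂]
        refine Eq.trans ?_ (Category.comp_id _).symm
        have n := μ_natural P.toFunctor h.1.left h.2.left
        rw [MonoidalCategory.tensorHom_def] at n
        refine (Category.assoc _ _ _).symm.trans ((n =≫ _).trans ?_)
        refine (Category.assoc _ _ _).trans (congrArg (μ P.toFunctor _ _ ≫ ·) ?_)
        exact (coendι_w _ _ _).trans (congrArg _ e) }

/-- The tensor product of two coends is the coend at the tensor product. -/
noncomputable def isColimitCoendTensorCocone (P : ModularPreoperad C) (B₁ B₂ : 𝒢) :
    IsColimit (coendTensorCocone P B₁ B₂) := by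
  -- An arbitrary splitting is fixed for each label; the descended map transports along it,
  -- separates the factors by `δ` and applies `s`.
  choose a₁ a₂ h f₁ f₂ hk using
    fun (a : ℋ) (k : τ.obj a ⟶ B₁ ⊗ B₂) => ℋ.exists_decomposition k
  exact
    { desc := fun s => coendExtensionDesc P.toFunctor
        (fun a k => P.map (h a k) ≫ δ P.toFunctor (a₁ a k) (a₂ a k) ≫
          s.ι.app (CostructuredArrow.mk (f₁ a k), CostructuredArrow.mk (f₂ a k)))
        (fun {a a'} g k => by
          rw [← Category.assoc, ← P.map_comp]
          refine coendTensorCocone_desc_aux P s _ _ _ _ _ _ ?_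
          rw [← hk, τ.map_comp, Category.assoc, ← hk])
      fac := fun s j => by
        refine (Category.assoc _ _ _).trans ?_
        refine (congrArg (μ P.toFunctor _ _ ≫ ·) (coendι_desc _ _ _ _)).trans ?_
        -- The splitting chosen for a label that is already a disjoint union need not be the evident
        -- one, so the two are compared.
        have := coendTensorCocone_desc_aux P s (𝟙 (j.1.left ⊗ j.2.left))
          (h (j.1.left ⊗ j.2.left) (tensorOver j.1.hom j.2.hom)) j.1.hom j.2.hom _ _
          (by rw [← hk, τ.map_id]; exact Category.id_comp _)
        refine (congrArg (μ P.toFunctor _ _ ≫ ·) this.symm).trans ?_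
        rw [P.map_id, Category.id_comp]
        exact μ_δ_assoc P.toFunctor _ _ (s.ι.app j)
      uniq := fun s m hm => coendExtension_hom_ext _ fun a k => by
        refine Eq.trans ?_ (coendι_desc _ _ _ _).symm
        have e := (congrArg (δ P.toFunctor _ _ ≫ ·) ((Category.assoc _ _ _).symm.trans
          (hm (CostructuredArrow.mk (f₁ a k), CostructuredArrow.mk (f₂ a k))))).symm.trans
          (δ_μ_assoc P.toFunctor _ _ _)
        refine Eq.trans ?_ (congrArg (P.map (h a k) ≫ ·) e).symm
        refine Eq.trans ?_ (Category.assoc _ _ _)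
        exact congrArg (· ≫ m) ((congrArg _ (hk a k)).trans (coendι_w _ _ _).symm) }

end

section

variable {C : Type u} [Category.{v} C] [MonoidalCategory C] [SymmetricCategory C]
  [HasColimits C] [∀ X : C, PreservesColimits (tensorLeft X)]
  [∀ X : C, PreservesColimits (tensorRight X)]

/-- Objects over `B` form a category in universe `0`, whereas colimits in `C` are given at level
`v`; this and the next two instances change the size. -/
instance hasColimitsOfShape_costructuredArrow (B : 𝒢) :
    HasColimitsOfShape (CostructuredArrow τ B) C :=
  have : HasColimitsOfSize.{0, 0} C := hasColimitsOfSizeShrink.{0, 0, v, v} C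
  inferInstance

instance preservesColimitsOfShape_tensorLeft (B : 𝒢) (X : C) :
    PreservesColimitsOfShape (CostructuredArrow τ B) (tensorLeft X) :=
  have := preservesColimitsOfSize_shrink.{0, v, 0, v} (tensorLeft X)
  inferInstance

instance preservesColimitsOfShape_tensorRight (B : 𝒢) (X : C) :
    PreservesColimitsOfShape (CostructuredArrow τ B) (tensorRight X) :=
  have := preservesColimitsOfSize_shrink.{0, v, 0, v} (tensorRight X)
  inferInstance

/-- The universal property of the tensor product of two coends. -/
noncomputable def isColimitTensorCoend (P Q : ℋ ⥤ C) (B₁ B₂ : 𝒢) :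
    IsColimit ((coendExtensionCocone P B₁).tensor₂ (coendExtensionCocone Q B₂)) :=
  (isColimitCoendExtensionCocone P B₁).tensor₂ (isColimitCoendExtensionCocone Q B₂)

omit [SymmetricCategory C] in
theorem coendExtension_tensor_hom_ext (P Q : ℋ ⥤ C) {B₁ B₂ : 𝒢} {Z : C}
    {f g : ((coendExtension C).obj P).obj B₁ ⊗ ((coendExtension C).obj Q).obj B₂ ⟶ Z}
    (h : ∀ (a₁ a₂ : ℋ) (k₁ : τ.obj a₁ ⟶ B₁) (k₂ : τ.obj a₂ ⟶ B₂),
      (coendι P k₁ ⊗ₘ coendι Q k₂) ≫ f = (coendι P k₁ ⊗ₘ coendι Q k₂) ≫ g) : f = g :=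
  (isColimitCoendExtensionCocone P B₁).tensor₂_hom_ext (isColimitCoendExtensionCocone Q B₂)
    fun j₁ j₂ => h j₁.left j₂.left j₁.hom j₂.hom

omit [SymmetricCategory C] in
theorem coendExtension_tensor₃_hom_ext (P Q R : ℋ ⥤ C) {B₁ B₂ B₃ : 𝒢} {Z : C}
    {f g : (((coendExtension C).obj P).obj B₁ ⊗ ((coendExtension C).obj Q).obj B₂) ⊗
      ((coendExtension C).obj R).obj B₃ ⟶ Z}
    (h : ∀ (a₁ a₂ a₃ : ℋ) (k₁ : τ.obj a₁ ⟶ B₁) (k₂ : τ.obj a₂ ⟶ B₂) (k₃ : τ.obj a₃ ⟶ B₃),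
      ((coendι P k₁ ⊗ₘ coendι Q k₂) ⊗ₘ coendι R k₃) ≫ f =
        ((coendι P k₁ ⊗ₘ coendι Q k₂) ⊗ₘ coendι R k₃) ≫ g) : f = g := by
  have : HasColimitsOfSize.{0, 0} C := hasColimitsOfSizeShrink.{0, 0, v, v} C
  have (X : C) := preservesColimitsOfSize_shrink.{0, v, 0, v} (tensorRight X)
  refine (isColimitTensorCoend P Q B₁ B₂).tensor₂_hom_ext (isColimitCoendExtensionCocone R B₃)
    fun j₁ j₂ => ?_
  have e := MonoidalCategory.tensorHom_def (C := C) (coendι P j₁.1.hom) (coendι Q j₁.2.hom)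
  have := h _ _ _ j₁.1.hom j₁.2.hom j₂.hom
  rw [e] at this
  exact this

/-- The isomorphism between the tensor product of two coends and the coend at the tensor
product. -/
noncomputable def coendExtensionμ (P : ModularPreoperad C) (B₁ B₂ : 𝒢) :
    ((coendExtension C).obj P.toFunctor).obj B₁ ⊗ ((coendExtension C).obj P.toFunctor).obj B₂ ≅
      ((coendExtension C).obj P.toFunctor).obj (B₁ ⊗ B₂) :=
  (isColimitTensorCoend P.toFunctor P.toFunctor B₁ B₂).coconePointUniqueUpToIso
    (isColimitCoendTensorCocone P B₁ B₂)

theorem coendι_tensor_μ (P : ModularPreoperad C) {a₁ a₂ : ℋ} {B₁ B₂ : 𝒢} (f₁ : τ.obj a₁ ⟶ B₁)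
    (f₂ : τ.obj a₂ ⟶ B₂) :
    (coendι P.toFunctor f₁ ⊗ₘ coendι P.toFunctor f₂) ≫ (coendExtensionμ P B₁ B₂).hom =
      μ P.toFunctor a₁ a₂ ≫ coendι P.toFunctor (tensorOver f₁ f₂) := by
  have e := MonoidalCategory.tensorHom_def (C := C) (coendι P.toFunctor f₁)
    (coendι P.toFunctor f₂)
  rw [e]
  exact (isColimitTensorCoend P.toFunctor P.toFunctor B₁ B₂).comp_coconePointUniqueUpToIso_hom
    (isColimitCoendTensorCocone P B₁ B₂) (CostructuredArrow.mk f₁, CostructuredArrow.mk f₂)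

theorem coendι_tensor_μ_assoc (P : ModularPreoperad C) {a₁ a₂ : ℋ} {B₁ B₂ : 𝒢}
    (f₁ : τ.obj a₁ ⟶ B₁) (f₂ : τ.obj a₂ ⟶ B₂) {Z : C}
    (k : ((coendExtension C).obj P.toFunctor).obj (B₁ ⊗ B₂) ⟶ Z) :
    (coendι P.toFunctor f₁ ⊗ₘ coendι P.toFunctor f₂) ≫ (coendExtensionμ P B₁ B₂).hom ≫ k =
      μ P.toFunctor a₁ a₂ ≫ coendι P.toFunctor (tensorOver f₁ f₂) ≫ k := by
  rw [← Category.assoc, coendι_tensor_μ, Category.assoc]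

end

section

variable {C : Type u} [Category.{v} C] [HasColimits C]

/-- The coend at the unit object. -/
noncomputable def coendExtensionUnitIso (P : ℋ ⥤ C) :
    P.obj (𝟙_ ℋ) ≅ ((coendExtension C).obj P).obj (𝟙_ 𝒢) where
  hom := coendι P unitOver
  -- A label `k` over the empty graph is invertible, so it is a morphism of `ℋ` to which `P`
  -- applies.
  inv := coendExtensionDesc P (fun a k => P.map (homMk k (𝒢.isIso_of_hom_unit k))) (fun h k => by
    rw [← P.map_comp]
    rfl)
  hom_inv_id := (coendι_desc P _ _ _).trans (P.map_id _)
  inv_hom_id := coendExtension_hom_ext P fun a k => by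
    refine (coendι_desc_assoc P _ _ _ _).trans ?_
    refine (coendι_w P _ _).trans ?_
    refine Eq.trans ?_ (Category.comp_id _).symm
    exact congrArg _ (𝒢.hom_unit_ext _ _)

end

/-! ### The functor `τ_*` and the adjunction -/

section

variable {C : Type u} [Category.{v} C] [MonoidalCategory C] [SymmetricCategory C]
  [HasColimits C] [∀ X : C, PreservesColimits (tensorLeft X)]
  [∀ X : C, PreservesColimits (tensorRight X)]

/-- Each axiom is tested on tensor products of inclusions `coendι`, where it becomes the axiom for
`P` together with the corresponding identity for the labels `tensorOver`. -/
noncomputable abbrev coendExtensionBraided (P : ModularPreoperad C) :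
    ((coendExtension C).obj P.toFunctor).Braided :=
  Functor.Braided.ofIsos _ (εIso P.toFunctor ≪≫ coendExtensionUnitIso P.toFunctor)
    (coendExtensionμ P)
    (natural := fun f g => coendExtension_tensor_hom_ext _ _ fun a₁ a₂ k₁ k₂ => by
      rw [tensorHom_comp_tensorHom_assoc, coendι_map, coendι_map, coendι_tensor_μ,
        coendι_tensor_μ_assoc, coendι_map, tensorOver_comp])
    (assoc := fun X Y Z => coendExtension_tensor₃_hom_ext _ _ _ fun a₁ a₂ a₃ k₁ k₂ k₃ => by
      rw [tensorHom_comp_tensorHom_assoc, coendι_tensor_μ, Category.comp_id,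
        associator_naturality_assoc, tensorHom_comp_tensorHom_assoc, coendι_tensor_μ,
        Category.comp_id]
      rw [← Category.id_comp (coendι P.toFunctor k₃), ← tensorHom_comp_tensorHom_assoc,
        coendι_tensor_μ_assoc, coendι_map, tensorOver_assoc,
        ← Category.id_comp (coendι P.toFunctor k₁), ← tensorHom_comp_tensorHom,
        Category.assoc, coendι_tensor_μ, tensorHom_id, id_tensorHom, ← coendι_w,
        Functor.LaxMonoidal.associativity_assoc])
    (left_unit := fun X => by
      -- Removing the unit factor leaves maps out of a single coend, which can be tested on
      -- summands.
      rw [← cancel_epi (λ_ _).inv]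
      refine coendExtension_hom_ext _ fun a k => ?_
      rw [leftUnitor_inv_naturality_assoc, leftUnitor_inv_naturality_assoc]
      refine congrArg ((λ_ (P.obj a)).inv ≫ ·) ?_
      rw [leftUnitor_naturality]
      have e : (𝟙_ C ◁ coendι P.toFunctor k) ≫
          ((εIso P.toFunctor ≪≫ coendExtensionUnitIso P.toFunctor).hom ⊗ₘ 𝟙 _) =
          (ε P.toFunctor ▷ P.obj a) ≫
            (coendι P.toFunctor unitOver ⊗ₘ coendι P.toFunctor k) := by
        rw [← id_tensorHom, ← tensorHom_id, tensorHom_comp_tensorHom, tensorHom_comp_tensorHom,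
          Category.id_comp, Category.id_comp, Category.comp_id]
        rfl
      have e' : (coendι P.toFunctor unitOver ⊗ₘ coendι P.toFunctor k) ≫
          (coendExtensionμ P (𝟙_ 𝒢) X).hom ≫
          ((coendExtension C).obj P.toFunctor).map (λ_ X).hom =
          μ P.toFunctor (𝟙_ ℋ) a ≫ P.map (λ_ a).hom ≫ coendι P.toFunctor k := by
        have e₃ := coendι_tensor_μ_assoc P unitOver k
          (((coendExtension C).obj P.toFunctor).map (λ_ X).hom)
        refine e₃.trans ?_
        rw [coendι_map, tensorOver_leftUnitor, coendι_w]
      refine Eq.trans ?_ ((congrArg (· ≫ _) e).symm.trans (Category.assoc _ _ _))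
      refine Eq.trans ?_ (Category.assoc _ _ _).symm
      refine Eq.trans ?_ (congrArg (ε P.toFunctor ▷ P.obj a ≫ ·) e').symm
      rw [Functor.LaxMonoidal.left_unitality, Category.assoc, Category.assoc])
    (braided := fun X Y => coendExtension_tensor_hom_ext _ _ fun a₁ a₂ k₁ k₂ => by
      rw [coendι_tensor_μ_assoc, coendι_map, tensorOver_braiding, ← coendι_w,
        BraidedCategory.braiding_naturality_assoc, coendι_tensor_μ,
        Functor.map_braiding_assoc, μ_δ_assoc])

theorem coendExtensionBraided_μ (P : ModularPreoperad C) (B₁ B₂ : 𝒢) :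
    letI := coendExtensionBraided P
    μ ((coendExtension C).obj P.toFunctor) B₁ B₂ = (coendExtensionμ P B₁ B₂).hom := rfl

theorem coendExtensionBraided_ε (P : ModularPreoperad C) :
    letI := coendExtensionBraided P
    ε ((coendExtension C).obj P.toFunctor) =
      ε P.toFunctor ≫ coendι P.toFunctor unitOver := rfl

variable (C) in
/-- The functor `τ_*`. -/
noncomputable def τLowerStar : ModularPreoperad C ⥤ ModularOperad C where
  obj P := { toFunctor := (coendExtension C).obj P.toFunctor
             braided := coendExtensionBraided P }
  map {P Q} φ :=
    { hom := (coendExtension C).map φ.hom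
      isMonoidal :=
        letI := coendExtensionBraided P
        letI := coendExtensionBraided Q
        { unit := by
            rw [coendExtensionBraided_ε, coendExtensionBraided_ε, Category.assoc]
            refine (congrArg (_ ≫ ·) (coendι_naturality φ.hom unitOver)).trans ?_
            exact (Category.assoc _ _ _).symm.trans (NatTrans.IsMonoidal.unit =≫ _)
          tensor := fun X Y => coendExtension_tensor_hom_ext _ _ fun a₁ a₂ k₁ k₂ => by
            rw [coendExtensionBraided_μ, coendExtensionBraided_μ, coendι_tensor_μ_assoc,
              coendι_naturality, tensorHom_comp_tensorHom_assoc, coendι_naturality,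
              coendι_naturality, ← tensorHom_comp_tensorHom_assoc, coendι_tensor_μ,
              NatTrans.IsMonoidal.tensor_assoc] } }
  map_id P := SymmMonFunctor.Hom.ext ((coendExtension C).map_id _)
  map_comp f g := SymmMonFunctor.Hom.ext ((coendExtension C).map_comp _ _)

theorem τLowerStar_obj_ε (P : ModularPreoperad C) :
    ε ((τLowerStar C).obj P).toFunctor = ε P.toFunctor ≫ coendι P.toFunctor unitOver := rfl

theorem coendι_tensor_τLowerStar_obj_μ (P : ModularPreoperad C) {a₁ a₂ : ℋ} {B₁ B₂ : 𝒢}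
    (f₁ : τ.obj a₁ ⟶ B₁) (f₂ : τ.obj a₂ ⟶ B₂) :
    (coendι P.toFunctor f₁ ⊗ₘ coendι P.toFunctor f₂) ≫ μ ((τLowerStar C).obj P).toFunctor B₁ B₂ =
      μ P.toFunctor a₁ a₂ ≫ coendι P.toFunctor (tensorOver f₁ f₂) :=
  coendι_tensor_μ P f₁ f₂

-- The structure of a composite functor involves that of `τ`, whose unit and tensor maps are
-- identities; this lemma and the next make them explicit.
omit [HasColimits C] [∀ X : C, PreservesColimits (tensorLeft X)]
  [∀ X : C, PreservesColimits (tensorRight X)] in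
theorem τUpperStar_obj_ε (Q : ModularOperad C) :
    ε ((τUpperStar C).obj Q).toFunctor = ε Q.toFunctor ≫ Q.map unitOver :=
  rfl

omit [HasColimits C] [∀ X : C, PreservesColimits (tensorLeft X)]
  [∀ X : C, PreservesColimits (tensorRight X)] in
theorem τUpperStar_obj_μ (Q : ModularOperad C) (a b : ℋ) :
    μ ((τUpperStar C).obj Q).toFunctor a b = μ Q.toFunctor (τ.obj a) (τ.obj b) :=
  (congrArg (μ Q.toFunctor (τ.obj a) (τ.obj b) ≫ ·) (Q.map_id _)).trans (Category.comp_id _)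

/-- The unit of the adjunction `τ_* ⊣ τ^*`. -/
noncomputable def τUnit (P : ModularPreoperad C) :
    P ⟶ (τUpperStar C).obj ((τLowerStar C).obj P) where
  hom :=
    { app := fun a => coendι P.toFunctor (𝟙 (τ.obj a))
      naturality := fun a b f => by
        refine (coendι_w _ _ _).trans (Eq.trans ?_ (coendι_map _ _ _).symm)
        rw [Category.comp_id, Category.id_comp] }
  isMonoidal :=
    { unit := by
        rw [τUpperStar_obj_ε, τLowerStar_obj_ε]
        refine Eq.trans ?_ (Category.assoc _ _ _).symm
        refine congrArg (ε P.toFunctor ≫ ·) ((coendι_map _ _ _).trans ?_).symm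
        exact congrArg _ (Category.comp_id _)
      tensor := fun X Y => by
        rw [τUpperStar_obj_μ]
        refine Eq.trans ?_ (coendι_tensor_τLowerStar_obj_μ P _ _).symm
        exact congrArg (fun k => μ P.toFunctor X Y ≫ coendι P.toFunctor k)
          (tensorOver_id X Y).symm }

/-- The action of a modular operad `Q` on the coend of its restriction. -/
noncomputable def τCounitApp (Q : ModularOperad C) (B : 𝒢) :
    ((coendExtension C).obj ((τUpperStar C).obj Q).toFunctor).obj B ⟶ Q.obj B :=
  coendExtensionDesc _ (fun _ k => Q.map k) (fun h k => (Q.map_comp (τ.map h) k).symm)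

omit [∀ X : C, PreservesColimits (tensorLeft X)]
  [∀ X : C, PreservesColimits (tensorRight X)] in
theorem coendι_τCounitApp (Q : ModularOperad C) {B : 𝒢} {a : ℋ} (k : τ.obj a ⟶ B) :
    coendι ((τUpperStar C).obj Q).toFunctor k ≫ τCounitApp Q B = Q.map k :=
  coendι_desc ((τUpperStar C).obj Q).toFunctor (B := B) (Z := Q.obj B) (fun _ k => Q.map k)
    (fun h k => (Q.map_comp (τ.map h) k).symm) k

omit [∀ X : C, PreservesColimits (tensorLeft X)]
  [∀ X : C, PreservesColimits (tensorRight X)] in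
theorem coendι_τCounitApp_assoc (Q : ModularOperad C) {B : 𝒢} {a : ℋ} (k : τ.obj a ⟶ B) {Z : C}
    (z : Q.obj B ⟶ Z) :
    coendι ((τUpperStar C).obj Q).toFunctor k ≫ τCounitApp Q B ≫ z = Q.map k ≫ z :=
  (Category.assoc _ _ _).symm.trans (coendι_τCounitApp Q k =≫ z)

/-- The counit of the adjunction `τ_* ⊣ τ^*`. -/
noncomputable def τCounit (Q : ModularOperad C) :
    (τLowerStar C).obj ((τUpperStar C).obj Q) ⟶ Q where
  hom :=
    { app := τCounitApp Q
      naturality := fun A B f => coendExtension_hom_ext _ fun a k => by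
        refine (coendι_map_assoc _ _ _ _).trans ?_
        refine Eq.trans ?_ (coendι_τCounitApp_assoc _ _ _).symm
        exact (coendι_τCounitApp _ _).trans (Q.map_comp _ _) }
  isMonoidal :=
    { unit := by
        rw [τLowerStar_obj_ε]
        refine (Category.assoc _ _ _).trans ?_
        refine (congrArg (_ ≫ ·) (coendι_τCounitApp _ _)).trans ?_
        rw [τUpperStar_obj_ε]
        refine (Category.assoc _ _ _).trans ?_
        refine Eq.trans ?_ (Category.comp_id _)
        refine congrArg (_ ≫ ·) ((Q.map_comp _ _).symm.trans (Eq.trans ?_ (Q.map_id _)))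
        exact congrArg _ (Category.comp_id _)
      tensor := fun X Y => coendExtension_tensor_hom_ext _ _ fun a₁ a₂ k₁ k₂ => by
        refine (Category.assoc _ _ _).symm.trans
          ((coendι_tensor_τLowerStar_obj_μ _ k₁ k₂ =≫ _).trans ?_)
        refine (Category.assoc _ _ _).trans
          ((congrArg (_ ≫ ·) (coendι_τCounitApp _ _)).trans ?_)
        refine Eq.trans ?_ (tensorHom_comp_tensorHom_assoc _ _ _ _ _).symm
        refine Eq.trans ?_ (congrArg (· ≫ _) (congrArg₂ (· ⊗ₘ ·)
          (coendι_τCounitApp Q k₁) (coendι_τCounitApp Q k₂))).symm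
        refine (congrArg (· ≫ _) (τUpperStar_obj_μ Q a₁ a₂)).trans ?_
        exact (μ_natural Q.toFunctor k₁ k₂).symm }

variable (C) in
/-- The adjunction `τ_* ⊣ τ^*`. -/
noncomputable def τAdjunction : τLowerStar C ⊣ τUpperStar C where
  unit :=
    { app := τUnit
      naturality := fun P Q φ => SymmMonFunctor.Hom.ext (NatTrans.ext (funext fun a =>
        (coendι_naturality φ.hom (𝟙 (τ.obj a))).symm)) }
  counit :=
    { app := τCounit
      naturality := fun P Q φ => SymmMonFunctor.Hom.ext (NatTrans.ext (funext fun B =>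
        coendExtension_hom_ext _ fun a k => by
          refine (coendι_naturality_assoc _ _ _).trans ?_
          refine Eq.trans ?_ (coendι_τCounitApp_assoc P k (φ.hom.app B)).symm
          refine (congrArg (_ ≫ ·) (coendι_τCounitApp _ _)).trans ?_
          exact (φ.hom.naturality k).symm)) }
  left_triangle_components P :=
    SymmMonFunctor.Hom.ext (NatTrans.ext (funext fun B => coendExtension_hom_ext _ fun a k => by
      refine (coendι_naturality_assoc (τUnit P).hom k _).trans ?_
      refine (congrArg (_ ≫ ·) (coendι_τCounitApp _ _)).trans ?_
      refine (coendι_map _ _ _).trans ?_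
      refine Eq.trans ?_ (Category.comp_id _).symm
      rw [Category.id_comp]))
  right_triangle_components Q :=
    SymmMonFunctor.Hom.ext (NatTrans.ext (funext fun a =>
      (coendι_τCounitApp Q (𝟙 (τ.obj a))).trans (Q.map_id _)))

variable (C) in
/-- The functor underlying `τ_* P` is the coend. -/
noncomputable def τLowerStarIso : τLowerStar C ⋙ SymmMonFunctor.forget 𝒢 C ≅
    SymmMonFunctor.forget ℋ C ⋙ coendExtension C :=
  Iso.refl _

theorem τLowerStarIso_hom_app_app (P : ModularPreoperad C) (A : ℋ) :
    ((τAdjunction C).unit.app P).hom.app A ≫ ((τLowerStarIso C).hom.app P).app (τ.obj A) =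
      coendUnit P.toFunctor A :=
  Category.comp_id _

end

/-! ### The shape of reflexive pairs is sifted -/

namespace CategoryTheory.Limits.WalkingReflexivePair

open Hom

theorem hom_zero_ext : ∀ {c : WalkingReflexivePair} (f g : zero ⟶ c), f = g
  | _, .id _, .id _ => rfl
  | _, .reflexion, .reflexion => rfl

theorem eq_left_or_eq_right : ∀ f : one ⟶ zero, f = left ∨ f = right
  | .left => Or.inl rfl
  | .right => Or.inr rfl

/-- Since `zero` is initial, a pair containing it has an initial cospan, whose tip is the other
object. For `(one, one)` every cospan can be pushed to one with tip `zero`, and these four are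
linked by changing one coordinate at a time. -/
theorem isConnected_structuredArrow_diag :
    ∀ a b : WalkingReflexivePair, IsConnected (StructuredArrow (a, b) (Functor.diag _))
  | zero, b => by
    let t : StructuredArrow (zero, b) (Functor.diag WalkingReflexivePair) :=
      StructuredArrow.mk (Y := b) (show (zero, b) ⟶ (b, b) from
        (match b with | zero => 𝟙 _ | one => reflexion, 𝟙 b))
    have : Nonempty (StructuredArrow (zero, b) (Functor.diag WalkingReflexivePair)) := ⟨t⟩
    refine zigzag_isConnected fun x y => ?_
    have key (x : StructuredArrow (zero, b) (Functor.diag WalkingReflexivePair)) :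
        Zigzag t x := by
      obtain ⟨⟨⟨⟩⟩, c, f, g⟩ := x
      refine Zigzag.of_hom (StructuredArrow.homMk g (Prod.ext (hom_zero_ext _ _)
        (Category.id_comp _)))
    exact (key x).symm.trans (key y)
  | one, zero => by
    let t : StructuredArrow (one, zero) (Functor.diag WalkingReflexivePair) :=
      StructuredArrow.mk (Y := one) (show (one, zero) ⟶ (one, one) from (𝟙 _, reflexion))
    have : Nonempty (StructuredArrow (one, zero) (Functor.diag WalkingReflexivePair)) := ⟨t⟩
    refine zigzag_isConnected fun x y => ?_
    have key (x : StructuredArrow (one, zero) (Functor.diag WalkingReflexivePair)) :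
        Zigzag t x := by
      obtain ⟨⟨⟨⟩⟩, c, f, g⟩ := x
      refine Zigzag.of_hom (StructuredArrow.homMk f (Prod.ext (Category.id_comp _)
        (hom_zero_ext _ _)))
    exact (key x).symm.trans (key y)
  | one, one => by
    let t {c : WalkingReflexivePair} (f g : one ⟶ c) :
        StructuredArrow (one, one) (Functor.diag WalkingReflexivePair) :=
      StructuredArrow.mk (Y := c) (show (one, one) ⟶ (c, c) from (f, g))
    have h {c : WalkingReflexivePair} (f g : one ⟶ c) {d : WalkingReflexivePair} (k : c ⟶ d)
        (f' g' : one ⟶ d) (e₁ : f ≫ k = f') (e₂ : g ≫ k = g') : Zigzag (t f g) (t f' g') :=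
      Zigzag.of_hom (StructuredArrow.homMk k (Prod.ext e₁ e₂))
    have : Nonempty (StructuredArrow (one, one) (Functor.diag WalkingReflexivePair)) :=
      ⟨t left left⟩
    -- As `reflexion` is a section of both `left` and `right`, the cospan `(𝟙, left ≫ reflexion)`
    -- with tip `one` maps to `(left, left)` and to `(right, left)`.
    have h₁ : Zigzag (t left left) (t right left) :=
      (h (𝟙 one) (left ≫ reflexion) left left left rfl rfl).symm.trans
        (h (𝟙 one) (left ≫ reflexion) right right left rfl rfl)
    have h₂ : Zigzag (t left right) (t right right) :=
      (h (𝟙 one) (right ≫ reflexion) left left right rfl rfl).symm.trans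
        (h (𝟙 one) (right ≫ reflexion) right right right rfl rfl)
    have h₃ : Zigzag (t left left) (t left right) :=
      (h (left ≫ reflexion) (𝟙 one) left left left rfl rfl).symm.trans
        (h (left ≫ reflexion) (𝟙 one) right left right rfl rfl)
    have key₀ (f g : one ⟶ zero) : Zigzag (t left left) (t f g) := by
      obtain rfl | rfl := eq_left_or_eq_right f <;> obtain rfl | rfl := eq_left_or_eq_right g
      · exact Relation.ReflTransGen.refl
      · exact h₃
      · exact h₁
      · exact h₃.trans h₂
    have key (x : StructuredArrow (one, one) (Functor.diag WalkingReflexivePair)) :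
        Zigzag (t left left) x := by
      obtain ⟨⟨⟨⟩⟩, c, f, g⟩ := x
      cases c with
      | zero => exact key₀ f g
      | one => exact (key₀ _ _).trans (h f g left _ _ rfl rfl).symm
    exact zigzag_isConnected fun x y => (key x).symm.trans (key y)

instance isSifted : IsSifted WalkingReflexivePair where
  out := fun ⟨a, b⟩ => isConnected_structuredArrow_diag a b

end CategoryTheory.Limits.WalkingReflexivePair

/-! ### Sifted colimits of symmetric monoidal functors -/

namespace SymmMonFunctor

variable {A : Type u₁} [Category.{v₁} A] [MonoidalCategory A] [SymmetricCategory A]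
  {C : Type u₂} [Category.{v₂} C] [MonoidalCategory C] [SymmetricCategory C]

theorem hom_ext {F G : SymmMonFunctor A C} {f g : F ⟶ G}
    (h : ∀ X, (Hom.hom f).app X = (Hom.hom g).app X) : f = g :=
  Hom.ext (NatTrans.ext (funext h))

/-- A constructor for isomorphisms of symmetric monoidal functors. -/
noncomputable def isoMk {F G : SymmMonFunctor A C} (e : F.toFunctor ≅ G.toFunctor)
    [NatTrans.IsMonoidal e.hom] : F ≅ G where
  hom := ⟨e.hom, inferInstance⟩
  inv := ⟨e.inv, inferInstance⟩
  hom_inv_id := Hom.ext e.hom_inv_id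
  inv_hom_id := Hom.ext e.inv_hom_id

/-- The inverse of an invertible monoidal transformation is again monoidal. -/
instance : (forget A C).ReflectsIsomorphisms where
  reflects {F G} f hf := by
    have : IsIso f.hom := hf
    have : NatTrans.IsMonoidal (asIso f.hom).hom := f.isMonoidal
    exact (isoMk (asIso f.hom)).isIso_hom

section colimits

variable {J : Type u₃} [Category.{v₃} J] [IsSifted J] [HasColimitsOfShape J C]
  [∀ X : C, PreservesColimitsOfShape J (tensorLeft X)]
  [∀ X : C, PreservesColimitsOfShape J (tensorRight X)]
  {F : J ⥤ SymmMonFunctor A C} {c : Cocone (F ⋙ forget A C)} (hc : IsColimit c)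

variable (c) in
/-- The evaluation of a cocone. -/
abbrev evalCocone (X : A) : Cocone ((F ⋙ forget A C) ⋙ (evaluation A C).obj X) :=
  ((evaluation A C).obj X).mapCocone c

/-- Colimits of functors are computed pointwise. -/
noncomputable def isColimitEval (X : A) : IsColimit (evalCocone c X) :=
  isColimitOfPreserves _ hc

variable (c) in
/-- The maps into the point of a cocone. -/
abbrev coconeι (j : J) (X : A) : (F.obj j).obj X ⟶ c.pt.obj X := (c.ι.app j).app X

omit [IsSifted J] [∀ X : C, PreservesColimitsOfShape J (tensorLeft X)]
  [∀ X : C, PreservesColimitsOfShape J (tensorRight X)] in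
include hc in
theorem coconeι_hom_ext {X : A} {Z : C} {f g : c.pt.obj X ⟶ Z}
    (h : ∀ j, coconeι c j X ≫ f = coconeι c j X ≫ g) : f = g :=
  (isColimitEval hc X).hom_ext h

-- The diagonal of a sifted category is final, so the tensor product of two colimits, a colimit over
-- `J × J`, is already computed by the maps with equal indices.
include hc in
theorem coconeι_tensor_hom_ext {X Y : A} {Z : C} {f g : c.pt.obj X ⊗ c.pt.obj Y ⟶ Z}
    (h : ∀ j, (coconeι c j X ⊗ₘ coconeι c j Y) ≫ f = (coconeι c j X ⊗ₘ coconeι c j Y) ≫ g) :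
    f = g :=
  ((isColimitEval hc X).tensor (isColimitEval hc Y)).hom_ext h

include hc in
theorem coconeι_tensor₃_hom_ext {X Y Z : A} {W : C}
    {f g : (c.pt.obj X ⊗ c.pt.obj Y) ⊗ c.pt.obj Z ⟶ W}
    (h : ∀ j, ((coconeι c j X ⊗ₘ coconeι c j Y) ⊗ₘ coconeι c j Z) ≫ f =
      ((coconeι c j X ⊗ₘ coconeι c j Y) ⊗ₘ coconeι c j Z) ≫ g) :
    f = g :=
  (((isColimitEval hc X).tensor (isColimitEval hc Y)).tensor (isColimitEval hc Z)).hom_ext h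

/-- The tensor comparison isomorphism of a pointwise sifted colimit. -/
noncomputable def colimitμ (X Y : A) : c.pt.obj X ⊗ c.pt.obj Y ≅ c.pt.obj (X ⊗ Y) :=
  ((isColimitEval hc X).tensor (isColimitEval hc Y)).coconePointsIsoOfNatIso
    (isColimitEval hc (X ⊗ Y))
    (NatIso.ofComponents (fun j => μIso (F.obj j).toFunctor X Y)
      (fun f => (NatTrans.IsMonoidal.tensor (τ := (F.map f).hom) X Y).symm))

theorem coconeι_colimitμ (j : J) (X Y : A) :
    (coconeι c j X ⊗ₘ coconeι c j Y) ≫ (colimitμ hc X Y).hom =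
      μ (F.obj j).toFunctor X Y ≫ coconeι c j (X ⊗ Y) :=
  IsColimit.comp_coconePointsIsoOfNatIso_hom
    ((isColimitEval hc X).tensor (isColimitEval hc Y)) (isColimitEval hc (X ⊗ Y)) _ j

theorem coconeι_colimitμ_assoc (j : J) (X Y : A) {Z : C} (k : c.pt.obj (X ⊗ Y) ⟶ Z) :
    (coconeι c j X ⊗ₘ coconeι c j Y) ≫ (colimitμ hc X Y).hom ≫ k =
      μ (F.obj j).toFunctor X Y ≫ coconeι c j (X ⊗ Y) ≫ k := by
  rw [← Category.assoc, coconeι_colimitμ, Category.assoc]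

/-- The unit comparison isomorphism of a pointwise sifted colimit. -/
noncomputable def colimitε : 𝟙_ C ≅ c.pt.obj (𝟙_ A) :=
  -- A sifted category is connected, so the constant diagram at the unit has the unit as colimit.
  (isColimitConstCocone J (𝟙_ C)).coconePointsIsoOfNatIso (isColimitEval hc (𝟙_ A))
    (NatIso.ofComponents (fun j => εIso (F.obj j).toFunctor)
      (fun f => (Category.id_comp _).trans
        (NatTrans.IsMonoidal.unit (τ := (F.map f).hom)).symm))

omit [∀ X : C, PreservesColimitsOfShape J (tensorLeft X)]
  [∀ X : C, PreservesColimitsOfShape J (tensorRight X)] in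
theorem colimitε_hom (j : J) :
    (colimitε hc).hom = ε (F.obj j).toFunctor ≫ coconeι c j (𝟙_ A) :=
  (Category.id_comp _).symm.trans (IsColimit.comp_coconePointsIsoOfNatIso_hom
    (isColimitConstCocone J (𝟙_ C)) (isColimitEval hc (𝟙_ A)) _ j)

omit [IsSifted J] [HasColimitsOfShape J C] [∀ X : C, PreservesColimitsOfShape J (tensorLeft X)]
  [∀ X : C, PreservesColimitsOfShape J (tensorRight X)] in
theorem coconeι_naturality (j : J) {X Y : A} (f : X ⟶ Y) :
    coconeι c j X ≫ c.pt.map f = (F.obj j).map f ≫ coconeι c j Y :=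
  ((c.ι.app j).naturality f).symm

/-- A pointwise sifted colimit of symmetric monoidal functors is symmetric monoidal. -/
noncomputable abbrev colimitBraided : c.pt.Braided :=
  Functor.Braided.ofIsos _ (colimitε hc) (colimitμ hc)
    (natural := fun f g => coconeι_tensor_hom_ext hc fun j => by
      rw [tensorHom_comp_tensorHom_assoc, coconeι_colimitμ_assoc, coconeι_naturality,
        coconeι_naturality, coconeι_naturality, ← tensorHom_comp_tensorHom_assoc,
        coconeι_colimitμ, μ_natural_assoc])
    (assoc := fun X Y Z => coconeι_tensor₃_hom_ext hc fun j => by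
      rw [tensorHom_comp_tensorHom_assoc, coconeι_colimitμ, Category.comp_id,
        associator_naturality_assoc, tensorHom_comp_tensorHom_assoc, coconeι_colimitμ,
        Category.comp_id]
      rw [← Category.id_comp (coconeι c j Z), ← tensorHom_comp_tensorHom_assoc,
        coconeι_colimitμ_assoc, coconeι_naturality,
        ← Category.id_comp (coconeι c j X), ← tensorHom_comp_tensorHom,
        Category.assoc, coconeι_colimitμ, tensorHom_id, id_tensorHom,
        Functor.LaxMonoidal.associativity_assoc])
    (left_unit := fun X => by
      rw [← cancel_epi (λ_ _).inv]
      refine coconeι_hom_ext hc fun j => ?_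
      rw [leftUnitor_inv_naturality_assoc, leftUnitor_inv_naturality_assoc]
      refine congrArg ((λ_ ((F.obj j).obj X)).inv ≫ ·) ?_
      rw [leftUnitor_naturality, colimitε_hom hc j, ← id_tensorHom,
        tensorHom_comp_tensorHom_assoc, Category.comp_id,
        Category.id_comp]
      nth_rw 2 [← Category.id_comp (coconeι c j X)]
      rw [← tensorHom_comp_tensorHom_assoc,
        coconeι_colimitμ_assoc, coconeι_naturality, tensorHom_id,
        Functor.LaxMonoidal.left_unitality, Category.assoc, Category.assoc])
    (braided := fun X Y => coconeι_tensor_hom_ext hc fun j => by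
      rw [coconeι_colimitμ_assoc, coconeι_naturality,
        BraidedCategory.braiding_naturality_assoc, coconeι_colimitμ,
        Functor.map_braiding_assoc, μ_δ_assoc])

/-- The pointwise colimit, as a cocone of symmetric monoidal functors. -/
noncomputable def liftCocone : Cocone F where
  pt := ⟨c.pt, colimitBraided hc⟩
  ι :=
    { app := fun j =>
        { hom := c.ι.app j
          isMonoidal :=
            letI := colimitBraided hc
            { unit := (colimitε_hom hc j).symm
              tensor := fun X Y => (coconeι_colimitμ hc j X Y).symm } }
      naturality := fun _ _ f => Hom.ext (c.ι.naturality f) }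

/-- The pointwise colimit is a colimit of symmetric monoidal functors. -/
noncomputable def isColimitLiftCocone : IsColimit (liftCocone hc) where
  desc s :=
    have fac (j : J) (X : A) :
        coconeι c j X ≫ (hc.desc ((forget A C).mapCocone s)).app X = (s.ι.app j).hom.app X :=
      congrArg (fun k => NatTrans.app k X) (hc.fac ((forget A C).mapCocone s) j)
    letI := colimitBraided hc
    { hom := hc.desc ((forget A C).mapCocone s)
      isMonoidal :=
        { unit := by
            obtain ⟨j⟩ := (inferInstance : Nonempty J)
            refine (congrArg (· ≫ _) (colimitε_hom hc j)).trans ((Category.assoc _ _ _).trans ?_)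
            exact (congrArg (_ ≫ ·) (fac j _)).trans
              (NatTrans.IsMonoidal.unit (τ := (s.ι.app j).hom))
          tensor := fun X Y => coconeι_tensor_hom_ext hc fun j => by
            refine (coconeι_colimitμ_assoc hc j X Y _).trans ?_
            refine (congrArg (_ ≫ ·) (fac j _)).trans ?_
            refine (NatTrans.IsMonoidal.tensor (τ := (s.ι.app j).hom) X Y).trans ?_
            refine Eq.trans ?_ (tensorHom_comp_tensorHom_assoc _ _ _ _ _).symm
            exact (congrArg (· ≫ _) (congrArg₂ (· ⊗ₘ ·) (fac j X) (fac j Y))).symm } }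
  fac s j := Hom.ext (hc.fac ((forget A C).mapCocone s) j)
  uniq s m hm := Hom.ext (hc.uniq ((forget A C).mapCocone s) m.hom
    fun j => congrArg Hom.hom (hm j))

variable (A C J)

omit hc in
theorem hasColimitsOfShape : HasColimitsOfShape J (SymmMonFunctor A C) where
  has_colimit F := ⟨⟨_, isColimitLiftCocone (colimit.isColimit (F ⋙ forget A C))⟩⟩

omit hc in
theorem preservesColimitsOfShape_forget : PreservesColimitsOfShape J (forget A C) where
  preservesColimit {F} := preservesColimit_of_preserves_colimit_cocone
    (isColimitLiftCocone (colimit.isColimit (F ⋙ forget A C)))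
    (colimit.isColimit (F ⋙ forget A C))

variable {B : Type w} [Category.{w'} B] [MonoidalCategory B] [SymmetricCategory B]

/-- On underlying functors restriction is precomposition, which preserves pointwise colimits; the
conservative functor `forget` then reflects the colimit. -/
theorem preservesColimitsOfShape_restrict (T : B ⥤ A) [T.Braided] :
    PreservesColimitsOfShape J (restrict T C) := by
  have := preservesColimitsOfShape_forget A C J
  have := preservesColimitsOfShape_forget B C J
  have := hasColimitsOfShape A C J
  have := hasColimitsOfShape B C J
  have : PreservesColimitsOfShape J (restrict T C ⋙ forget B C) :=
    inferInstanceAs (PreservesColimitsOfShape J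
      (forget A C ⋙ (Functor.whiskeringLeft B A C).obj T))
  have : ReflectsColimitsOfShape J (forget B C) :=
    reflectsColimitsOfShape_of_reflectsIsomorphisms
  exact preservesColimitsOfShape_of_reflects_of_preserves (restrict T C) (forget B C)

end colimits

/-- Invertibility is tested at each object, and up to isomorphism every object lies in the image of
`T`. -/
theorem reflectsIsomorphisms_restrict {B : Type w} [Category.{w'} B] [MonoidalCategory B]
    [SymmetricCategory B] (T : B ⥤ A) [T.Braided] [T.EssSurj] :
    (restrict T C).ReflectsIsomorphisms where
  reflects {F G} f hf := by
    have h : IsIso ((forget B C).map ((restrict T C).map f)) := inferInstance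
    have h' (X : B) : IsIso (f.hom.app (T.obj X)) := by
      rw [NatTrans.isIso_iff_isIso_app] at h
      exact h X
    have : IsIso ((forget A C).map f) := by
      rw [NatTrans.isIso_iff_isIso_app]
      intro Y
      exact (NatTrans.isIso_app_iff_of_iso f.hom (T.objObjPreimageIso Y)).1 (h' _)
    exact isIso_of_reflects_iso f (forget A C)

end SymmMonFunctor

/-! ### Monadicity -/

namespace CategoryTheory

variable {C : Type u₁} [Category.{v} C] {D : Type u₂} [Category.{v} D]

theorem hasReflexiveCoequalizers_of_hasColimitsOfShape
    [HasColimitsOfShape WalkingReflexivePair C] : HasReflexiveCoequalizers C :=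
  hasReflexiveCoequalizers_iff.1 inferInstance

/-- A reflexive pair extends to a diagram on `WalkingReflexivePair`, and the inclusion of the
parallel pair in that shape is final. -/
theorem preservesColimitOfIsReflexivePair (G : C ⥤ D)
    [PreservesColimitsOfShape WalkingReflexivePair G] :
    Monad.PreservesColimitOfIsReflexivePair G where
  out A B f g _ := by
    have : PreservesColimit (WalkingParallelPair.inclusionWalkingReflexivePair ⋙
        ofIsReflexivePair f g) G :=
      inferInstance
    exact preservesColimit_of_iso_diagram G (inclusionWalkingReflexivePairOfIsReflexivePairIso f g)

end CategoryTheory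

section

variable (C : Type u) [Category.{v} C] [MonoidalCategory C] [SymmetricCategory C]
    [HasColimits C] [∀ X : C, PreservesColimits (tensorLeft X)]
    [∀ X : C, PreservesColimits (tensorRight X)]

instance : τ.EssSurj where
  mem_essImage X := ⟨⟨X⟩, ⟨Iso.refl X⟩⟩

instance : (τUpperStar C).ReflectsIsomorphisms := SymmMonFunctor.reflectsIsomorphisms_restrict τ

/-- Monadicity of `τ^*`. -/
theorem isEquivalence_comparison_τAdjunction :
    (Monad.comparison (τAdjunction C)).IsEquivalence := by
  have : HasColimitsOfSize.{0, 0} C := hasColimitsOfSizeShrink.{0, 0, v, v} C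
  have (X : C) := preservesColimitsOfSize_shrink.{0, v, 0, v} (tensorLeft X)
  have (X : C) := preservesColimitsOfSize_shrink.{0, v, 0, v} (tensorRight X)
  have := SymmMonFunctor.hasColimitsOfShape 𝒢 C WalkingReflexivePair
  have := hasReflexiveCoequalizers_of_hasColimitsOfShape (C := ModularOperad C)
  have := SymmMonFunctor.preservesColimitsOfShape_restrict 𝒢 C WalkingReflexivePair τ
  have := preservesColimitOfIsReflexivePair (τUpperStar C)
  -- Beck's theorem in its reflexive form: only coequalizers of reflexive pairs have to exist and be
  -- preserved.
  exact (Monad.monadicOfHasPreservesReflexiveCoequalizersOfReflectsIsomorphisms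
    (τAdjunction C)).eqv

end

/-! ### Coherence in symmetric monoidal categories -/

/-- Bracketings of tensor products of objects indexed by `W`. -/
inductive TensorTree (W : Type w) : Type w
  | unit
  | leaf (x : W)
  | node (a b : TensorTree W)

section

variable {C : Type u} [Category.{v} C] [MonoidalCategory C]

/-- Here and in the next lemmas `e` plays the role of the morphism bringing a factor `X` to the
front; each lemma moves it past one kind of building block of a coherence morphism. -/
theorem tensor_extract_left {X P P' Q Q' D D' : C} {e : P ⟶ X ⊗ D} {e' : P' ⟶ X ⊗ D'}
    {f : P ⟶ P'} {f' : D ⟶ D'} (h : f ≫ e' = e ≫ X ◁ f') (g : Q ⟶ Q') :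
    (f ⊗ₘ g) ≫ (e' ▷ Q') ≫ (α_ X D' Q').hom =
      ((e ▷ Q) ≫ (α_ X D Q).hom) ≫ X ◁ (f' ⊗ₘ g) := by
  rw [tensorHom_def', MonoidalCategory.tensorHom_def f' g, Category.assoc,
    ← comp_whiskerRight_assoc, h, whisker_exchange_assoc]
  monoidal

theorem inv_extract {X P P' D D' : C} {e : P ⟶ X ⊗ D} {e' : P' ⟶ X ⊗ D'}
    {f : P ≅ P'} {f' : D ≅ D'} (h : f.hom ≫ e' = e ≫ X ◁ f'.hom) :
    f.inv ≫ e = e' ≫ X ◁ f'.inv := by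
  rw [Iso.inv_comp_eq, reassoc_of% h, ← whiskerLeft_comp, Iso.hom_inv_id, whiskerLeft_id,
    Category.comp_id]

variable [BraidedCategory C]

theorem tensor_extract_right {X P P' Q Q' D D' : C} {e : Q ⟶ X ⊗ D} {e' : Q' ⟶ X ⊗ D'}
    {g : Q ⟶ Q'} {g' : D ⟶ D'} (h : g ≫ e' = e ≫ X ◁ g') (f : P ⟶ P') :
    (f ⊗ₘ g) ≫ (P' ◁ e') ≫ (α_ P' X D').inv ≫ ((β_ P' X).hom ▷ D') ≫ (α_ X P' D').hom =
      ((P ◁ e) ≫ (α_ P X D).inv ≫ ((β_ P X).hom ▷ D) ≫ (α_ X P D).hom) ≫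
        X ◁ (f ⊗ₘ g') := by
  have e₁ := BraidedCategory.braiding_naturality_left f X
  have e₂ : (P ⊗ X) ◁ g' ≫ ((β_ P X).hom ≫ X ◁ f) ▷ D' =
      ((β_ P X).hom ≫ X ◁ f) ▷ D ≫ (X ⊗ P') ◁ g' := whisker_exchange _ _
  calc _ = P ◁ (g ≫ e') ≫ (α_ P X D').inv ≫ (f ▷ X ≫ (β_ P' X).hom) ▷ D' ≫
        (α_ X P' D').hom := by
        rw [tensorHom_def', Category.assoc, ← whisker_exchange_assoc]
        monoidal
    _ = P ◁ e ≫ (α_ P X D).inv ≫ ((P ⊗ X) ◁ g' ≫ ((β_ P X).hom ≫ X ◁ f) ▷ D') ≫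
        (α_ X P' D').hom := by
        rw [h, e₁]
        monoidal
    _ = _ := by
        rw [e₂, MonoidalCategory.tensorHom_def f g']
        monoidal

/-- `X` is braided past `Q` and back again, so among these identities this one needs symmetry and
not just a braiding. -/
theorem braiding_extract_left {C : Type u} [Category.{v} C] [MonoidalCategory C]
    [SymmetricCategory C] {X P Q D : C} (e : P ⟶ X ⊗ D) :
    (β_ P Q).hom ≫ (Q ◁ e) ≫ (α_ Q X D).inv ≫ ((β_ Q X).hom ▷ D) ≫ (α_ X Q D).hom =
      ((e ▷ Q) ≫ (α_ X D Q).hom) ≫ X ◁ (β_ D Q).hom := by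
  rw [← BraidedCategory.braiding_naturality_left_assoc, BraidedCategory.braiding_tensor_left_hom]
  simp only [Category.assoc, Iso.hom_inv_id_assoc, ← comp_whiskerRight_assoc,
    SymmetricCategory.symmetry, id_whiskerRight, Category.id_comp, Iso.inv_hom_id,
    Category.comp_id]

theorem braiding_extract_right {X P Q D : C} (e : Q ⟶ X ⊗ D) :
    (β_ P Q).hom ≫ (e ▷ P) ≫ (α_ X D P).hom =
      ((P ◁ e) ≫ (α_ P X D).inv ≫ ((β_ P X).hom ▷ D) ≫ (α_ X P D).hom) ≫ X ◁ (β_ P D).hom := by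
  rw [← BraidedCategory.braiding_naturality_right_assoc, BraidedCategory.braiding_tensor_right_hom]
  monoidal

-- This and the next two lemmas serve tensor products of units only, where the induction for
-- coherence starts.
omit [BraidedCategory C] in
theorem assoc_toUnit {P Q R : C} (p : P ⟶ 𝟙_ C) (q : Q ⟶ 𝟙_ C) (r : R ⟶ 𝟙_ C) :
    (α_ P Q R).hom ≫ (p ⊗ₘ ((q ⊗ₘ r) ≫ (λ_ (𝟙_ C)).hom)) ≫ (λ_ (𝟙_ C)).hom =
      (((p ⊗ₘ q) ≫ (λ_ (𝟙_ C)).hom) ⊗ₘ r) ≫ (λ_ (𝟙_ C)).hom := by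
  monoidal

omit [BraidedCategory C] in
theorem leftUnitor_toUnit {P : C} (p : P ⟶ 𝟙_ C) :
    (λ_ P).hom ≫ p = (𝟙 (𝟙_ C) ⊗ₘ p) ≫ (λ_ (𝟙_ C)).hom := by
  monoidal

theorem braiding_toUnit {P Q : C} (p : P ⟶ 𝟙_ C) (q : Q ⟶ 𝟙_ C) :
    (β_ P Q).hom ≫ (q ⊗ₘ p) ≫ (λ_ (𝟙_ C)).hom = (p ⊗ₘ q) ≫ (λ_ (𝟙_ C)).hom := by
  rw [← BraidedCategory.braiding_naturality_assoc, braiding_tensorUnit_left]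
  monoidal

end

namespace TensorTree

variable {W : Type w}

/-- The list of the leaves. -/
def leaves : TensorTree W → List W
  | unit => []
  | leaf x => [x]
  | node a b => a.leaves ++ b.leaves

/-- The positions of the leaves labelled `x`. -/
inductive Pos (x : W) : TensorTree W → Type w
  | leaf : Pos x (leaf x)
  | left {a : TensorTree W} (m : Pos x a) (b : TensorTree W) : Pos x (node a b)
  | right (a : TensorTree W) {b : TensorTree W} (m : Pos x b) : Pos x (node a b)

/-- Remove a leaf. -/
def del {x : W} : ∀ {t : TensorTree W}, Pos x t → TensorTree W
  | _, .leaf => unit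
  | _, .left m b => node (del m) b
  | _, .right a m => node a (del m)

theorem leaves_perm {x : W} {t : TensorTree W} (m : Pos x t) :
    t.leaves.Perm (x :: (del m).leaves) := by
  induction m with
  | leaf => rfl
  | left m b ih => exact ih.append_right _
  | right a m ih => exact (ih.append_left _).trans List.perm_middle

theorem mem_leaves {x : W} {t : TensorTree W} (m : Pos x t) : x ∈ t.leaves :=
  (leaves_perm m).mem_iff.2 List.mem_cons_self

theorem exists_pos {x : W} {t : TensorTree W} (h : x ∈ t.leaves) : Nonempty (Pos x t) := by
  induction t with
  | unit => cases h
  | leaf y =>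
    obtain rfl := List.mem_singleton.1 h
    exact ⟨.leaf⟩
  | node a b iha ihb =>
    rcases List.mem_append.1 h with h | h
    · exact ⟨.left (iha h).some _⟩
    · exact ⟨.right _ (ihb h).some⟩

/-- The role of distinct leaves: a label determines its position, so a coherence morphism has no
choice where to send it. -/
theorem subsingleton_pos {x : W} {t : TensorTree W} (h : t.leaves.Nodup) (m m' : Pos x t) :
    m = m' := by
  induction t with
  | unit => cases m
  | leaf y => cases m; cases m'; rfl
  | node a b iha ihb =>
    obtain ⟨ha, hb, hab⟩ := List.nodup_append.1 h
    cases m with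
    | left m =>
      cases m' with
      | left m' => rw [iha ha m m']
      | right _ m' => exact absurd rfl (hab _ (mem_leaves m) _ (mem_leaves m'))
    | right _ m =>
      cases m' with
      | left m' => exact absurd rfl (hab _ (mem_leaves m') _ (mem_leaves m))
      | right _ m' => rw [ihb hb m m']

section

variable {C : Type u} [Category.{v} C] [MonoidalCategory C] (X : W → C)

/-- The tensor product with a given bracketing. -/
def obj : TensorTree W → C
  | unit => 𝟙_ C
  | leaf x => X x
  | node a b => a.obj ⊗ b.obj

variable [SymmetricCategory C]

/-- The coherence morphisms between bracketed tensor products. -/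
inductive Coh : ∀ {t t' : TensorTree W}, (t.obj X ⟶ t'.obj X) → Prop
  | id (t : TensorTree W) : Coh (𝟙 (t.obj X))
  | comp {t t' t'' : TensorTree W} {f : t.obj X ⟶ t'.obj X} {g : t'.obj X ⟶ t''.obj X}
      (hf : Coh f) (hg : Coh g) : Coh (f ≫ g)
  | tensor {a a' b b' : TensorTree W} {f : a.obj X ⟶ a'.obj X} {g : b.obj X ⟶ b'.obj X}
      (hf : Coh f) (hg : Coh g) : Coh (t := node a b) (t' := node a' b') (f ⊗ₘ g)
  | assoc (a b c : TensorTree W) :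
      Coh (t := node (node a b) c) (t' := node a (node b c)) (α_ (a.obj X) (b.obj X) (c.obj X)).hom
  | assocInv (a b c : TensorTree W) :
      Coh (t := node a (node b c)) (t' := node (node a b) c) (α_ (a.obj X) (b.obj X) (c.obj X)).inv
  | leftUnitor (a : TensorTree W) : Coh (t := node unit a) (t' := a) (λ_ (a.obj X)).hom
  | leftUnitorInv (a : TensorTree W) : Coh (t := a) (t' := node unit a) (λ_ (a.obj X)).inv
  | braiding (a b : TensorTree W) :
      Coh (t := node a b) (t' := node b a) (β_ (a.obj X) (b.obj X)).hom

variable {X}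

namespace Coh

theorem exists_inv {t t' : TensorTree W} {f : t.obj X ⟶ t'.obj X} (hf : Coh X f) :
    ∃ g : t'.obj X ⟶ t.obj X, Coh X g ∧ f ≫ g = 𝟙 _ ∧ g ≫ f = 𝟙 _ := by
  induction hf with
  | id t => exact ⟨_, .id t, Category.comp_id _, Category.comp_id _⟩
  | comp _ _ ihf ihg =>
    obtain ⟨f', hf', e₁, e₂⟩ := ihf
    obtain ⟨g', hg', e₃, e₄⟩ := ihg
    refine ⟨g' ≫ f', hg'.comp hf', ?_, ?_⟩
    · rw [Category.assoc, reassoc_of% e₃, e₁]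
    · rw [Category.assoc, reassoc_of% e₂, e₄]
  | tensor _ _ ihf ihg =>
    obtain ⟨f', hf', e₁, e₂⟩ := ihf
    obtain ⟨g', hg', e₃, e₄⟩ := ihg
    refine ⟨f' ⊗ₘ g', hf'.tensor hg', ?_, ?_⟩
    · exact (tensorHom_comp_tensorHom _ _ _ _).trans
        ((congrArg₂ (· ⊗ₘ ·) e₁ e₃).trans (id_tensorHom_id _ _))
    · exact (tensorHom_comp_tensorHom _ _ _ _).trans
        ((congrArg₂ (· ⊗ₘ ·) e₂ e₄).trans (id_tensorHom_id _ _))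
  | assoc a b c => exact ⟨_, .assocInv a b c, Iso.hom_inv_id _, Iso.inv_hom_id _⟩
  | assocInv a b c => exact ⟨_, .assoc a b c, Iso.inv_hom_id _, Iso.hom_inv_id _⟩
  | leftUnitor a => exact ⟨_, .leftUnitorInv a, Iso.hom_inv_id _, Iso.inv_hom_id _⟩
  | leftUnitorInv a => exact ⟨_, .leftUnitor a, Iso.inv_hom_id _, Iso.hom_inv_id _⟩
  | braiding a b =>
    exact ⟨_, .braiding b a, SymmetricCategory.symmetry _ _, SymmetricCategory.symmetry _ _⟩

theorem isIso {t t' : TensorTree W} {f : t.obj X ⟶ t'.obj X} (hf : Coh X f) : IsIso f :=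
  let ⟨g, _, e₁, e₂⟩ := hf.exists_inv
  ⟨g, e₁, e₂⟩

/-- Derived from the braiding and the left unitor, which spares a constructor and hence a case in
every induction. -/
theorem rightUnitor (a : TensorTree W) :
    Coh X (t := node a unit) (t' := a) (ρ_ (a.obj X)).hom :=
  (braiding_leftUnitor (a.obj X)) ▸ (braiding (X := X) a unit).comp (leftUnitor a)

theorem rightUnitorInv (a : TensorTree W) :
    Coh X (t := a) (t' := node a unit) (ρ_ (a.obj X)).inv := by
  obtain ⟨g, hg, -, e⟩ := (rightUnitor (X := X) a).exists_inv
  have : g = (ρ_ (a.obj X)).inv :=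
    ((Iso.eq_comp_inv (ρ_ (a.obj X))).2 e).trans (Category.id_comp _)
  exact this ▸ hg

theorem whiskerRight {a a' : TensorTree W} {f : a.obj X ⟶ a'.obj X} (hf : Coh X f)
    (b : TensorTree W) : Coh X (t := node a b) (t' := node a' b) (f ▷ b.obj X) := by
  rw [← tensorHom_id]
  exact hf.tensor (.id b)

theorem whiskerLeft (b : TensorTree W) {a a' : TensorTree W} {f : a.obj X ⟶ a'.obj X}
    (hf : Coh X f) : Coh X (t := node b a) (t' := node b a') (b.obj X ◁ f) := by
  rw [← id_tensorHom]
  exact (Coh.id b).tensor hf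

theorem leaves_perm {t t' : TensorTree W} {f : t.obj X ⟶ t'.obj X} (hf : Coh X f) :
    t.leaves.Perm t'.leaves := by
  induction hf with
  | id t => rfl
  | comp _ _ ihf ihg => exact ihf.trans ihg
  | tensor _ _ ihf ihg => exact ihf.append ihg
  | assoc a b c => exact List.Perm.of_eq (List.append_assoc _ _ _)
  | assocInv a b c => exact List.Perm.of_eq (List.append_assoc _ _ _).symm
  | leftUnitor a => rfl
  | leftUnitorInv a => rfl
  | braiding a b => exact List.perm_append_comm

end Coh

variable (X)

/-- Move a leaf to the front. -/
def extract {x : W} : ∀ {t : TensorTree W} (m : Pos x t), t.obj X ⟶ X x ⊗ (del m).obj X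
  | _, .leaf => (ρ_ (X x)).inv
  | _, .left m b => (extract m ▷ b.obj X) ≫ (α_ _ _ _).hom
  | _, .right a m => (a.obj X ◁ extract m) ≫ (α_ _ _ _).inv ≫
      ((β_ (a.obj X) (X x)).hom ▷ _) ≫ (α_ _ _ _).hom

theorem coh_extract {x : W} {t : TensorTree W} (m : Pos x t) :
    Coh X (t' := node (leaf x) (del m)) (extract X m) := by
  induction m with
  | leaf => exact Coh.rightUnitorInv (leaf x)
  | left m b ih => exact (ih.whiskerRight b).comp (.assoc (leaf x) _ _)
  | right a m ih =>
    exact (Coh.whiskerLeft a ih).comp ((Coh.assocInv a (leaf x) (del m)).comp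
      (((Coh.braiding a (leaf x)).whiskerRight (del m)).comp (Coh.assoc (leaf x) a (del m))))

variable {X}

theorem extract_left {x : W} {a : TensorTree W} (m : Pos x a) (b : TensorTree W) :
    extract X (.left m b) = (extract X m ▷ b.obj X) ≫ (α_ _ _ _).hom := rfl

theorem extract_right {x : W} (a : TensorTree W) {b : TensorTree W} (m : Pos x b) :
    extract X (.right a m) = (a.obj X ◁ extract X m) ≫ (α_ _ _ _).inv ≫
      ((β_ (a.obj X) (X x)).hom ▷ _) ≫ (α_ _ _ _).hom := rfl

section

variable {x : W} {a a' b b' c : TensorTree W}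

theorem extract_tensor_left {m : Pos x a} {m' : Pos x a'} {f : a.obj X ⟶ a'.obj X}
    {f' : (del m).obj X ⟶ (del m').obj X} (h : f ≫ extract X m' = extract X m ≫ X x ◁ f')
    (g : b.obj X ⟶ b'.obj X) :
    (f ⊗ₘ g) ≫ extract X (.left m' b') = extract X (.left m b) ≫ X x ◁ (f' ⊗ₘ g) :=
  tensor_extract_left h g

theorem extract_tensor_right {m : Pos x b} {m' : Pos x b'} {g : b.obj X ⟶ b'.obj X}
    {g' : (del m).obj X ⟶ (del m').obj X} (h : g ≫ extract X m' = extract X m ≫ X x ◁ g')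
    (f : a.obj X ⟶ a'.obj X) :
    (f ⊗ₘ g) ≫ extract X (.right a' m') = extract X (.right a m) ≫ X x ◁ (f ⊗ₘ g') :=
  tensor_extract_right h f

theorem extract_assoc_left (m : Pos x a) (b c : TensorTree W) :
    (α_ (a.obj X) (b.obj X) (c.obj X)).hom ≫ extract X (.left m (node b c)) =
      extract X (.left (.left m b) c) ≫ X x ◁ (α_ _ _ _).hom := by
  simp only [extract_left, obj, del]
  monoidal

theorem extract_assoc_middle (a : TensorTree W) (m : Pos x b) (c : TensorTree W) :
    (α_ (a.obj X) (b.obj X) (c.obj X)).hom ≫ extract X (.right a (.left m c)) =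
      extract X (.left (.right a m) c) ≫ X x ◁ (α_ _ _ _).hom := by
  simp only [extract_left, extract_right, obj, del]
  monoidal

theorem extract_assoc_right (a b : TensorTree W) (m : Pos x c) :
    (α_ (a.obj X) (b.obj X) (c.obj X)).hom ≫ extract X (.right a (.right b m)) =
      extract X (.right (node a b) m) ≫ X x ◁ (α_ _ _ _).hom := by
  simp only [extract_right, obj, del, BraidedCategory.braiding_tensor_left_hom]
  monoidal

theorem extract_leftUnitor (m : Pos x a) :
    (λ_ (a.obj X)).hom ≫ extract X m = extract X (.right unit m) ≫ X x ◁ (λ_ _).hom := by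
  simp only [extract_right, obj, del, braiding_tensorUnit_left]
  monoidal

theorem extract_braiding_left (m : Pos x a) (b : TensorTree W) :
    (β_ (a.obj X) (b.obj X)).hom ≫ extract X (.right b m) =
      extract X (.left m b) ≫ X x ◁ (β_ _ _).hom :=
  braiding_extract_left (extract X m)

theorem extract_braiding_right (a : TensorTree W) (m : Pos x b) :
    (β_ (a.obj X) (b.obj X)).hom ≫ extract X (.left m a) =
      extract X (.right a m) ≫ X x ◁ (β_ _ _).hom :=
  braiding_extract_right (extract X m)

end

/-- The inductive step of coherence: `m'` is the place to which the leaf at `m` is carried, and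
deleting the leaf at both ends leaves a coherence morphism between shorter products. There is one
identity for each constructor. -/
theorem Coh.exists_extract {t t' : TensorTree W} {f : t.obj X ⟶ t'.obj X} (hf : Coh X f) {x : W}
    (m : Pos x t) : ∃ (m' : Pos x t') (f' : (del m).obj X ⟶ (del m').obj X), Coh X f' ∧
      f ≫ extract X m' = extract X m ≫ X x ◁ f' := by
  induction hf with
  | id t => exact ⟨m, _, .id _, by rw [Category.id_comp, whiskerLeft_id, Category.comp_id]⟩
  | comp _ _ ihf ihg =>
    obtain ⟨m', f', hf', e⟩ := ihf m
    obtain ⟨m'', g', hg', e'⟩ := ihg m'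
    exact ⟨m'', _, hf'.comp hg', by
      rw [Category.assoc, e', reassoc_of% e, ← whiskerLeft_comp]⟩
  | tensor hf hg ihf ihg =>
    cases m with
    | left m =>
      obtain ⟨m', f', hf', e⟩ := ihf m
      exact ⟨.left m' _, _, hf'.tensor hg, extract_tensor_left e _⟩
    | right _ m =>
      obtain ⟨m', g', hg', e⟩ := ihg m
      exact ⟨.right _ m', _, hf.tensor hg', extract_tensor_right e _⟩
  | assoc a b c =>
    rcases m with _ | ⟨(_ | ⟨m⟩ | ⟨_, m⟩)⟩ | ⟨_, m⟩
    · exact ⟨_, _, .assoc _ _ _, extract_assoc_left m b c⟩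
    · exact ⟨_, _, .assoc _ _ _, extract_assoc_middle a m c⟩
    · exact ⟨_, _, .assoc _ _ _, extract_assoc_right a b m⟩
  | assocInv a b c =>
    rcases m with _ | ⟨m⟩ | ⟨_, (_ | ⟨m⟩ | ⟨_, m⟩)⟩
    · exact ⟨_, _, .assocInv _ _ _, inv_extract (extract_assoc_left m b c)⟩
    · exact ⟨_, _, .assocInv _ _ _, inv_extract (extract_assoc_middle a m c)⟩
    · exact ⟨_, _, .assocInv _ _ _, inv_extract (extract_assoc_right a b m)⟩
  | leftUnitor a =>
    rcases m with _ | ⟨⟨⟩⟩ | ⟨_, m⟩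
    exact ⟨_, _, .leftUnitor _, extract_leftUnitor m⟩
  | leftUnitorInv a => exact ⟨_, _, .leftUnitorInv _, inv_extract (extract_leftUnitor m)⟩
  | braiding a b =>
    rcases m with _ | ⟨m⟩ | ⟨_, m⟩
    · exact ⟨_, _, .braiding _ _, extract_braiding_left m b⟩
    · exact ⟨_, _, .braiding _ _, extract_braiding_right a m⟩

variable (X) in
/-- The coherence morphism from a tensor product of unit objects. -/
def toUnit : ∀ (t : TensorTree W), t.leaves = [] → (t.obj X ⟶ unit.obj X)
  | unit, _ => 𝟙 _
  | node a b, h => (toUnit a (List.append_eq_nil_iff.1 h).1 ⊗ₘ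
      toUnit b (List.append_eq_nil_iff.1 h).2) ≫ (λ_ (𝟙_ C)).hom

theorem coh_toUnit (t : TensorTree W) (h : t.leaves = []) : Coh X (toUnit X t h) := by
  induction t with
  | unit => exact .id _
  | leaf x => cases h
  | node a b iha ihb => exact ((iha _).tensor (ihb _)).comp (.leftUnitor unit)

/-- The base of the uniqueness argument: a coherence morphism between tensor products of units is
determined by comparing both ends with a single unit. -/
theorem Coh.comp_toUnit {t t' : TensorTree W} {f : t.obj X ⟶ t'.obj X} (hf : Coh X f)
    (h : t.leaves = []) (h' : t'.leaves = []) : f ≫ toUnit X t' h' = toUnit X t h := by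
  induction hf with
  | id t => exact Category.id_comp _
  | comp hf hg ihf ihg =>
    have h'' := List.perm_nil.1 (h ▸ hf.leaves_perm).symm
    rw [Category.assoc, ihg h'', ihf h h'']
  | tensor hf hg ihf ihg =>
    exact (tensorHom_comp_tensorHom_assoc _ _ _ _ _).trans
      (congrArg (· ≫ _) (congrArg₂ (· ⊗ₘ ·) (ihf _ _) (ihg _ _)))
  | assoc a b c => exact assoc_toUnit _ _ _
  | assocInv a b c => exact (Iso.inv_comp_eq _).2 (assoc_toUnit _ _ _).symm
  | leftUnitor a => exact leftUnitor_toUnit _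
  | leftUnitorInv a => exact (Iso.inv_comp_eq _).2 (leftUnitor_toUnit _).symm
  | braiding a b => exact braiding_toUnit _ _

theorem length_del {x : W} {t : TensorTree W} (m : Pos x t) :
    t.leaves.length = (del m).leaves.length + 1 :=
  (leaves_perm m).length_eq

theorem nodup_del {x : W} {t : TensorTree W} (m : Pos x t) (h : t.leaves.Nodup) :
    (del m).leaves.Nodup :=
  (List.nodup_cons.1 ((leaves_perm m).nodup_iff.1 h)).2

/-- Coherence for symmetric monoidal categories: uniqueness of coherence morphisms. -/
theorem Coh.unique {t t' : TensorTree W} {f g : t.obj X ⟶ t'.obj X} (hf : Coh X f) (hg : Coh X g)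
    (h : t'.leaves.Nodup) : f = g := by
  induction hn : t.leaves.length generalizing t t' with
  | zero =>
    have h₁ := List.length_eq_zero_iff.1 hn
    have h₂ := List.perm_nil.1 (h₁ ▸ hf.leaves_perm).symm
    have := (coh_toUnit (X := X) t' h₂).isIso
    rw [← cancel_mono (toUnit X t' h₂), hf.comp_toUnit h₁, hg.comp_toUnit h₁]
  | succ n ih =>
    obtain ⟨x, l, hl⟩ := List.exists_cons_of_length_eq_add_one hn
    obtain ⟨m⟩ := exists_pos (x := x) (t := t) (hl ▸ List.mem_cons_self)
    obtain ⟨m', f', hf', e⟩ := hf.exists_extract m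
    obtain ⟨m'', g', hg', e'⟩ := hg.exists_extract m
    -- Both morphisms carry `x` to the same position, because the leaves of the target are distinct.
    obtain rfl := subsingleton_pos h m' m''
    have : IsIso (extract X m') := (coh_extract X m').isIso
    rw [← cancel_mono (extract X m'), e, e',
      ih hf' hg' (nodup_del m' h) (by have := length_del m; omega)]

variable (X) in
/-- Coherence for symmetric monoidal categories: existence of coherence morphisms. -/
theorem exists_coh {t t' : TensorTree W} (h : t.leaves.Perm t'.leaves) :
    ∃ f : t.obj X ⟶ t'.obj X, Coh X f := by
  induction hn : t.leaves.length generalizing t t' with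
  | zero =>
    have h₁ := List.length_eq_zero_iff.1 hn
    have h₂ := List.perm_nil.1 (h₁ ▸ h).symm
    obtain ⟨g, hg, -⟩ := (coh_toUnit (X := X) t' h₂).exists_inv
    exact ⟨_, (coh_toUnit t h₁).comp hg⟩
  | succ n ih =>
    obtain ⟨x, l, hl⟩ := List.exists_cons_of_length_eq_add_one hn
    have hx : x ∈ t.leaves := hl ▸ List.mem_cons_self
    obtain ⟨m⟩ := exists_pos hx
    obtain ⟨m'⟩ := exists_pos (h.mem_iff.1 hx)
    obtain ⟨f, hf⟩ := ih (t := del m) (t' := del m')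
      (((leaves_perm m).symm.trans (h.trans (leaves_perm m'))).cons_inv)
      (by have := length_del m; omega)
    obtain ⟨g, hg, -⟩ := (coh_extract X m').exists_inv
    exact ⟨_, (coh_extract X m).comp (((Coh.whiskerLeft (leaf x) hf)).comp hg)⟩

end

end TensorTree

/-! ### Relabelling, and identities up to coherence -/

namespace TensorTree

section

variable {W : Type w} {W' : Type w'}

/-- Relabel the leaves. -/
def map (j : W → W') : TensorTree W → TensorTree W'
  | unit => unit
  | leaf x => leaf (j x)
  | node a b => node (a.map j) (b.map j)

theorem leaves_map (j : W → W') (t : TensorTree W) : (t.map j).leaves = t.leaves.map j := by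
  induction t with
  | unit => rfl
  | leaf x => rfl
  | node a b iha ihb =>
    exact (congrArg₂ (· ++ ·) iha ihb).trans List.map_append.symm

/-- The right bracketing of a list. -/
def ofList : List W → TensorTree W
  | [] => unit
  | x :: l => node (leaf x) (ofList l)

theorem leaves_ofList (l : List W) : (ofList l).leaves = l := by
  induction l with
  | nil => rfl
  | cons x l ih => exact congrArg (x :: ·) ih

end

theorem nodup_leaves_sum {W : Type w} {W' : Type w'} {a : TensorTree W} {b : TensorTree W'}
    (ha : a.leaves.Nodup) (hb : b.leaves.Nodup) :
    (node (a.map (Sum.inl : W → W ⊕ W')) (b.map Sum.inr)).leaves.Nodup := by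
  refine List.Nodup.append ?_ ?_ ?_
  · rw [leaves_map]
    exact ha.map Sum.inl_injective
  · rw [leaves_map]
    exact hb.map Sum.inr_injective
  · rw [leaves_map, leaves_map]
    intro x hx hx'
    obtain ⟨a, -, rfl⟩ := List.mem_map.1 hx
    obtain ⟨b, -, h⟩ := List.mem_map.1 hx'
    cases h

/-- A bracketing with every element of a finite set as a leaf. -/
def ofCode : (A : FinSetCode) → TensorTree A.El
  | .fin n => ofList (List.finRange n)
  | .sum A B => node ((ofCode A).map Sum.inl) ((ofCode B).map Sum.inr)

theorem nodup_leaves_ofCode : ∀ A : FinSetCode, (ofCode A).leaves.Nodup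
  | .fin n => (leaves_ofList (List.finRange n)).symm ▸ List.nodup_finRange n
  | .sum A B => nodup_leaves_sum (nodup_leaves_ofCode A) (nodup_leaves_ofCode B)

theorem mem_leaves_ofCode : ∀ (A : FinSetCode) (x : A.El), x ∈ (ofCode A).leaves
  | .fin n, x => (leaves_ofList (List.finRange n)).symm ▸ List.mem_finRange x
  | .sum A _, .inl x => List.mem_append_left _
      (leaves_map _ _ ▸ List.mem_map_of_mem (mem_leaves_ofCode A x))
  | .sum _ B, .inr x => List.mem_append_right _
      (leaves_map _ _ ▸ List.mem_map_of_mem (mem_leaves_ofCode B x))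

/-- A bijection takes the leaves of `ofCode A` to those of `ofCode B`. -/
theorem perm_ofCode {A B : FinSetCode} {j : A.El → B.El} (hj : Function.Bijective j) :
    ((ofCode A).map j).leaves.Perm (ofCode B).leaves := by
  rw [leaves_map]
  refine (List.perm_ext_iff_of_nodup ((nodup_leaves_ofCode A).map hj.1)
    (nodup_leaves_ofCode B)).2 fun b => ⟨fun _ => mem_leaves_ofCode B b, fun _ => ?_⟩
  obtain ⟨a, rfl⟩ := hj.2 b
  exact List.mem_map_of_mem (mem_leaves_ofCode A a)

section

variable {C : Type u} [Category.{v} C] [MonoidalCategory C]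
  {W : Type w} {W' : Type w} {W'' : Type w} {X : W → C} {Y : W' → C} {Z : W'' → C}

/-- The tensor product of a family of morphisms over a map of labels. -/
def mapObj {j : W → W'} (φ : ∀ x, X x ⟶ Y (j x)) : ∀ t : TensorTree W, t.obj X ⟶ (t.map j).obj Y
  | unit => 𝟙 _
  | leaf x => φ x
  | node a b => mapObj φ a ⊗ₘ mapObj φ b

theorem isIso_mapObj {j : W → W'} (φ : ∀ x, X x ⟶ Y (j x)) [∀ x, IsIso (φ x)]
    (t : TensorTree W) : IsIso (mapObj φ t) := by
  induction t with
  | unit => exact inferInstanceAs (IsIso (𝟙 _))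
  | leaf x => exact inferInstanceAs (IsIso (φ x))
  | node a b iha ihb => exact inferInstanceAs (IsIso (mapObj φ a ⊗ₘ mapObj φ b))

variable [SymmetricCategory C]

/-- All structure isomorphisms are natural, so `g` is built from the same constructors as `f`,
between the relabelled bracketings. -/
theorem Coh.exists_mapObj {j : W → W'} (φ : ∀ x, X x ⟶ Y (j x)) {t t' : TensorTree W}
    {f : t.obj X ⟶ t'.obj X} (hf : Coh X f) :
    ∃ g : (t.map j).obj Y ⟶ (t'.map j).obj Y, Coh Y g ∧
      f ≫ mapObj φ t' = mapObj φ t ≫ g := by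
  induction hf with
  | id t => exact ⟨_, .id _, (Category.id_comp _).trans (Category.comp_id _).symm⟩
  | comp _ _ ihf ihg =>
    obtain ⟨f', hf', e⟩ := ihf
    obtain ⟨g', hg', e'⟩ := ihg
    exact ⟨_, hf'.comp hg', by rw [Category.assoc, e', reassoc_of% e]⟩
  | tensor _ _ ihf ihg =>
    obtain ⟨f', hf', e⟩ := ihf
    obtain ⟨g', hg', e'⟩ := ihg
    exact ⟨_, hf'.tensor hg', (tensorHom_comp_tensorHom _ _ _ _).trans
      ((congrArg₂ (· ⊗ₘ ·) e e').trans (tensorHom_comp_tensorHom _ _ _ _).symm)⟩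
  | assoc a b c => exact ⟨_, .assoc _ _ _, (associator_naturality _ _ _).symm⟩
  | assocInv a b c => exact ⟨_, .assocInv _ _ _, (associator_inv_naturality _ _ _).symm⟩
  | leftUnitor a =>
    exact ⟨_, .leftUnitor _, (leftUnitor_naturality _).symm.trans
      (congrArg (· ≫ _) (id_tensorHom _ _).symm)⟩
  | leftUnitorInv a =>
    exact ⟨_, .leftUnitorInv _, (congrArg (_ ≫ ·) (id_tensorHom _ _)).trans
      (leftUnitor_inv_naturality _).symm⟩
  | braiding a b =>
    exact ⟨_, .braiding _ _, (BraidedCategory.braiding_naturality _ _).symm⟩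

/-- Two morphisms to bracketed tensor products agree up to coherence. -/
def Rel {S : C} {t t' : TensorTree W} (s : S ⟶ t.obj X) (s' : S ⟶ t'.obj X) : Prop :=
  ∃ g : t.obj X ⟶ t'.obj X, Coh X g ∧ s ≫ g = s'

namespace Rel

variable {S S' : C} {t t' t'' r r' : TensorTree W} {s : S ⟶ t.obj X} {s' : S ⟶ t'.obj X}
  {s'' : S ⟶ t''.obj X}

theorem refl (s : S ⟶ t.obj X) : Rel s s := ⟨_, .id _, Category.comp_id _⟩

theorem of_eq {s₁ s₂ : S ⟶ t.obj X} (h : s₁ = s₂) : Rel s₁ s₂ := h ▸ refl _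

theorem symm (h : Rel s s') : Rel s' s := by
  obtain ⟨g, hg, rfl⟩ := h
  obtain ⟨g', hg', e, -⟩ := hg.exists_inv
  exact ⟨g', hg', by rw [Category.assoc, e, Category.comp_id]⟩

theorem trans (h : Rel s s') (h' : Rel s' s'') : Rel s s'' := by
  obtain ⟨g, hg, rfl⟩ := h
  obtain ⟨g', hg', rfl⟩ := h'
  exact ⟨_, hg.comp hg', (Category.assoc _ _ _).symm⟩

theorem comp (p : S' ⟶ S) (h : Rel s s') : Rel (p ≫ s) (p ≫ s') := by
  obtain ⟨g, hg, rfl⟩ := h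
  exact ⟨_, hg, Category.assoc _ _ _⟩

theorem of_coh {f : t.obj X ⟶ t'.obj X} (hf : Coh X f) (s : S ⟶ t.obj X) : Rel s (s ≫ f) :=
  ⟨f, hf, rfl⟩

theorem tensor {u : S' ⟶ r.obj X} {u' : S' ⟶ r'.obj X} (h : Rel s s') (h' : Rel u u') :
    Rel (t := node t r) (t' := node t' r') (s ⊗ₘ u) (s' ⊗ₘ u') := by
  obtain ⟨g, hg, rfl⟩ := h
  obtain ⟨g', hg', rfl⟩ := h'
  exact ⟨_, hg.tensor hg', tensorHom_comp_tensorHom _ _ _ _⟩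

theorem comp_mapObj (h : Rel s s') {j : W → W'} (φ : ∀ x, X x ⟶ Y (j x)) :
    Rel (s ≫ mapObj φ t) (s' ≫ mapObj φ t') := by
  obtain ⟨g, hg, rfl⟩ := h
  obtain ⟨g', hg', e⟩ := hg.exists_mapObj φ
  exact ⟨g', hg', by rw [Category.assoc, Category.assoc, e]⟩

/-- Identities up to coherence become equalities by uniqueness of coherence morphisms, provided no
label of the target repeats. -/
theorem eq {s₁ s₂ : S ⟶ t.obj X} (h : Rel s₁ s₂) (ht : t.leaves.Nodup) : s₁ = s₂ := by
  obtain ⟨g, hg, rfl⟩ := h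
  rw [hg.unique (.id t) ht, Category.comp_id]

end Rel

/-- `Rel` replaces equality because the targets `t.map id` and `t` are equal but not by definition;
coherence bridges the two. -/
theorem rel_mapObj_id (t : TensorTree W) : Rel (mapObj (j := id) (fun x => 𝟙 (X x)) t) (𝟙 _) := by
  induction t with
  | unit => exact .refl _
  | leaf x => exact .refl _
  | node a b iha ihb => exact (iha.tensor ihb).trans (.of_eq (id_tensorHom_id _ _))

theorem rel_mapObj_comp {j : W → W'} {j' : W' → W''} (φ : ∀ x, X x ⟶ Y (j x))
    (ψ : ∀ x, Y x ⟶ Z (j' x)) (t : TensorTree W) :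
    Rel (mapObj φ t ≫ mapObj ψ (t.map j))
      (mapObj (j := fun x => j' (j x)) (fun x => φ x ≫ ψ (j x)) t) := by
  induction t with
  | unit => exact .of_eq (Category.comp_id _)
  | leaf x => exact .refl _
  | node a b iha ihb =>
    exact (Rel.of_eq (tensorHom_comp_tensorHom _ _ _ _)).trans (iha.tensor ihb)

/-- The tensor product of a family of morphisms over a map of labels, composed with a coherence
morphism. -/
noncomputable def reindex {j : W → W'} (φ : ∀ x, X x ⟶ Y (j x)) {t : TensorTree W}
    {t' : TensorTree W'} (h : (t.map j).leaves.Perm t'.leaves) : t.obj X ⟶ t'.obj Y :=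
  mapObj φ t ≫ (exists_coh Y h).choose

theorem rel_reindex {j : W → W'} (φ : ∀ x, X x ⟶ Y (j x)) {t : TensorTree W}
    {t' : TensorTree W'} (h : (t.map j).leaves.Perm t'.leaves) :
    Rel (mapObj φ t) (reindex φ h) :=
  .of_coh (exists_coh Y h).choose_spec _

theorem Rel.comp_reindex {S : C} {t₁ t₂ : TensorTree W} {s₁ : S ⟶ t₁.obj X} {s₂ : S ⟶ t₂.obj X}
    (hs : Rel s₁ s₂) {j : W → W'} (φ : ∀ x, X x ⟶ Y (j x))
    {t' : TensorTree W'} (h : (t₁.map j).leaves.Perm t'.leaves) :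
    Rel (s₁ ≫ reindex φ h) (s₂ ≫ mapObj φ t₂) :=
  ((rel_reindex φ h).symm.comp s₁).trans (hs.comp_mapObj φ)

theorem reindex_comp {j : W → W'} {j' : W' → W''} (φ : ∀ x, X x ⟶ Y (j x))
    (ψ : ∀ x, Y x ⟶ Z (j' x)) {t : TensorTree W} {t' : TensorTree W'} {t'' : TensorTree W''}
    (h : (t.map j).leaves.Perm t'.leaves) (h' : (t'.map j').leaves.Perm t''.leaves)
    (h'' : (t.map fun x => j' (j x)).leaves.Perm t''.leaves) (ht : t''.leaves.Nodup) :
    reindex φ h ≫ reindex ψ h' = reindex (j := fun x => j' (j x)) (fun x => φ x ≫ ψ (j x)) h'' :=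
  (((rel_reindex φ h).symm.comp_reindex ψ h').trans
    ((rel_mapObj_comp φ ψ t).trans (rel_reindex _ h''))).eq ht

theorem reindex_id {t : TensorTree W} (h : (t.map id).leaves.Perm t.leaves)
    (ht : t.leaves.Nodup) : reindex (j := id) (fun x => 𝟙 (X x)) h = 𝟙 _ :=
  ((rel_reindex _ h).symm.trans (rel_mapObj_id t)).eq ht

end

/-! ### Symmetric monoidal functors and bracketed tensor products -/

section

variable {A : Type u₁} [Category.{v₁} A] [MonoidalCategory A] [SymmetricCategory A]
  {B : Type u₂} [Category.{v₂} B] [MonoidalCategory B] [SymmetricCategory B]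
  (F : A ⥤ B) [F.Braided] {W : Type w} {W' : Type w}

/-- The comparison morphism between bracketed tensor products. -/
noncomputable def comparison (X : W → A) :
    ∀ t : TensorTree W, t.obj (fun x => F.obj (X x)) ⟶ F.obj (t.obj X)
  | unit => ε F
  | leaf _ => 𝟙 _
  | node a b => (comparison X a ⊗ₘ comparison X b) ≫ μ F _ _

instance isIso_comparison (X : W → A) (t : TensorTree W) : IsIso (comparison F X t) := by
  induction t with
  | unit => exact inferInstanceAs (IsIso (ε F))
  | leaf x => exact inferInstanceAs (IsIso (𝟙 _))
  | node a b iha ihb =>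
    exact inferInstanceAs (IsIso ((comparison F X a ⊗ₘ comparison F X b) ≫ μ F _ _))

theorem mapObj_comparison {X : W → A} {Y : W' → A} {j : W → W'} (φ : ∀ x, X x ⟶ Y (j x))
    (t : TensorTree W) :
    mapObj (X := fun x => F.obj (X x)) (Y := fun x => F.obj (Y x)) (fun x => F.map (φ x)) t ≫
      comparison F Y (t.map j) = comparison F X t ≫ F.map (mapObj φ t) := by
  induction t with
  | unit =>
    exact (Category.id_comp _).trans
      ((Category.comp_id _).symm.trans (congrArg (_ ≫ ·) (F.map_id _).symm))
  | leaf x => exact (Category.comp_id _).trans (Category.id_comp _).symm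
  | node a b iha ihb =>
    refine (tensorHom_comp_tensorHom_assoc _ _ _ _ _).trans ?_
    refine (congrArg (· ≫ _) (congrArg₂ (· ⊗ₘ ·) iha ihb)).trans ?_
    refine (tensorHom_comp_tensorHom_assoc _ _ _ _ _).symm.trans ?_
    refine Eq.trans ?_ (Category.assoc _ _ _).symm
    exact congrArg (_ ≫ ·) (μ_natural F (mapObj φ a) (mapObj φ b))

/-- The morphism `f` stands for the tensor product of the components of `α`, corrected so as to end
in `t` rather than `t.map id`. -/
theorem naturality_comparison {G : A ⥤ B} [G.Braided] (α : F ⟶ G) [NatTrans.IsMonoidal α]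
    (X : W → A) (t : TensorTree W) :
    ∃ f, Rel (mapObj (X := fun x => F.obj (X x)) (Y := fun x => G.obj (X x)) (j := id)
      (fun x => α.app (X x)) t) f ∧ f ≫ comparison G X t = comparison F X t ≫ α.app (t.obj X) := by
  induction t with
  | unit =>
    exact ⟨𝟙 (𝟙_ B), .refl _, (Category.id_comp _).trans
      (NatTrans.IsMonoidal.unit (τ := α)).symm⟩
  | leaf x => exact ⟨α.app (X x), .refl _, (Category.comp_id _).trans (Category.id_comp _).symm⟩
  | node a b iha ihb =>
    obtain ⟨f, hf, e⟩ := iha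
    obtain ⟨g, hg, e'⟩ := ihb
    refine ⟨_, hf.tensor hg, ?_⟩
    refine (tensorHom_comp_tensorHom_assoc _ _ _ _ _).trans ?_
    refine (congrArg (· ≫ _) (congrArg₂ (· ⊗ₘ ·) e e')).trans ?_
    refine (tensorHom_comp_tensorHom_assoc _ _ _ _ _).symm.trans ?_
    refine Eq.trans ?_ (Category.assoc _ _ _).symm
    exact congrArg (_ ≫ ·) (NatTrans.IsMonoidal.tensor (τ := α) (a.obj X) (b.obj X)).symm

theorem assoc_comparison {P Q R : B} {P' Q' R' : A} (p : P ⟶ F.obj P') (q : Q ⟶ F.obj Q')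
    (r : R ⟶ F.obj R') :
    (α_ P Q R).hom ≫ (p ⊗ₘ ((q ⊗ₘ r) ≫ μ F Q' R')) ≫ μ F P' (Q' ⊗ R') =
      ((((p ⊗ₘ q) ≫ μ F P' Q') ⊗ₘ r) ≫ μ F (P' ⊗ Q') R') ≫ F.map (α_ P' Q' R').hom := by
  have e₁ : (p ⊗ₘ ((q ⊗ₘ r) ≫ μ F Q' R')) =
      (p ⊗ₘ (q ⊗ₘ r)) ≫ F.obj P' ◁ μ F Q' R' := by
    rw [← id_tensorHom, tensorHom_comp_tensorHom, Category.comp_id]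
  have e₂ : (((p ⊗ₘ q) ≫ μ F P' Q') ⊗ₘ r) =
      ((p ⊗ₘ q) ⊗ₘ r) ≫ μ F P' Q' ▷ F.obj R' := by
    rw [← tensorHom_id, tensorHom_comp_tensorHom, Category.comp_id]
  rw [e₁, e₂, Category.assoc, Category.assoc, Category.assoc,
    Functor.LaxMonoidal.associativity, associator_naturality_assoc]

theorem leftUnitor_comparison {P : B} {P' : A} (p : P ⟶ F.obj P') :
    (λ_ P).hom ≫ p = ((ε F ⊗ₘ p) ≫ μ F (𝟙_ A) P') ≫ F.map (λ_ P').hom := by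
  have e : (ε F ⊗ₘ p) = 𝟙_ B ◁ p ≫ ε F ▷ F.obj P' := tensorHom_def' _ _
  rw [e, Category.assoc, Category.assoc, ← Functor.LaxMonoidal.left_unitality,
    leftUnitor_naturality]

theorem braiding_comparison {P Q : B} {P' Q' : A} (p : P ⟶ F.obj P') (q : Q ⟶ F.obj Q') :
    (β_ P Q).hom ≫ (q ⊗ₘ p) ≫ μ F Q' P' = ((p ⊗ₘ q) ≫ μ F P' Q') ≫ F.map (β_ P' Q').hom := by
  rw [Category.assoc, Functor.LaxBraided.braided, BraidedCategory.braiding_naturality_assoc]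

-- Each structure isomorphism of `B` corresponds to the one of `A` under an axiom of braided
-- functors, so a coherence morphism between values of `F` comes from one in `A`.
variable {F} in
theorem Coh.exists_comparison {X : W → A} {t t' : TensorTree W}
    {f : t.obj (fun x => F.obj (X x)) ⟶ t'.obj (fun x => F.obj (X x))}
    (hf : Coh (fun x => F.obj (X x)) f) :
    ∃ g : t.obj X ⟶ t'.obj X, Coh X g ∧ f ≫ comparison F X t' = comparison F X t ≫ F.map g := by
  induction hf with
  | id t => exact ⟨_, .id t, by rw [Category.id_comp, F.map_id, Category.comp_id]⟩
  | comp _ _ ihf ihg =>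
    obtain ⟨f', hf', e⟩ := ihf
    obtain ⟨g', hg', e'⟩ := ihg
    exact ⟨_, hf'.comp hg', by rw [Category.assoc, e', reassoc_of% e, F.map_comp]⟩
  | tensor _ _ ihf ihg =>
    obtain ⟨f', hf', e⟩ := ihf
    obtain ⟨g', hg', e'⟩ := ihg
    refine ⟨_, hf'.tensor hg', ?_⟩
    refine (tensorHom_comp_tensorHom_assoc _ _ _ _ _).trans ?_
    refine (congrArg (· ≫ _) (congrArg₂ (· ⊗ₘ ·) e e')).trans ?_
    refine (tensorHom_comp_tensorHom_assoc _ _ _ _ _).symm.trans ?_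
    refine Eq.trans ?_ (Category.assoc _ _ _).symm
    exact congrArg (_ ≫ ·) (μ_natural F f' g')
  | assoc a b c => exact ⟨_, .assoc a b c, assoc_comparison F _ _ _⟩
  | assocInv a b c =>
    refine ⟨_, .assocInv a b c, ?_⟩
    have e := assoc_comparison F (comparison F X a) (comparison F X b) (comparison F X c)
    refine (Iso.inv_comp_eq _).2 ?_
    refine Eq.trans ?_ ((congrArg (· ≫ F.map (α_ _ _ _).inv) e).symm.trans (Category.assoc _ _ _))
    rw [Category.assoc, ← F.map_comp, Iso.hom_inv_id, F.map_id]
    exact (Category.comp_id _).symm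
  | leftUnitor a => exact ⟨_, .leftUnitor a, leftUnitor_comparison F _⟩
  | leftUnitorInv a =>
    refine ⟨_, .leftUnitorInv a, ?_⟩
    have e := leftUnitor_comparison F (comparison F X a)
    refine (Iso.inv_comp_eq _).2 ?_
    refine Eq.trans ?_ ((congrArg (· ≫ F.map (λ_ _).inv) e).symm.trans (Category.assoc _ _ _))
    rw [Category.assoc, ← F.map_comp, Iso.hom_inv_id, F.map_id]
    exact (Category.comp_id _).symm
  | braiding a b => exact ⟨_, .braiding a b, braiding_comparison F _ _⟩

end

end TensorTree

/-! ### Local isomorphisms of graphs without edges -/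

namespace 𝒢

theorem vert_comp {X Y Z : 𝒢} (f : X ⟶ Y) (g : Y ⟶ Z) (v : X.V) :
    Hom.vert (f ≫ g) v = Hom.vert g (Hom.vert f v) := rfl

theorem bijective_vert {X Y : 𝒢} (f : X ⟶ Y) [IsIso f] : Function.Bijective (Hom.vert f) :=
  ⟨Function.LeftInverse.injective (g := Hom.vert (inv f)) fun v => by
    rw [← vert_comp, IsIso.hom_inv_id]
    rfl, Hom.vert_surjective f⟩

/-- With no edges and `Hom.vert f` injective, the count at `Hom.vert f v` reduces to the single term
`2 g(v) - 2`. -/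
theorem g_vert {X Y : 𝒢} (f : X ⟶ Y) [IsIso f] (v : X.V) : Y.g (Hom.vert f v) = X.g v := by
  classical
  have h := Hom.count_vert f (Hom.vert f v)
  unfold Hom.count at h
  rw [Finset.sum_eq_single v (fun w _ hw => if_neg fun h => hw ((bijective_vert f).1 h))
    (fun h => absurd (Finset.mem_univ v) h), if_pos rfl,
    Finset.sum_eq_zero fun l _ => if_neg fun h => h.1 (noEdge_of_isIso f l)] at h
  omega

/-- A map of graphs without edges that is bijective on the legs at each vertex. -/
@[ext]
structure Loc (A B : 𝒢) where
  v : A.V → B.V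
  l : A.L → B.L
  p_l : ∀ x, B.p (l x) = v (A.p x)
  g_v : ∀ x, B.g (v x) = A.g x
  inj : ∀ x y, A.p x = A.p y → l x = l y → x = y
  surj : ∀ x m, B.p m = v x → ∃ y, A.p y = x ∧ l y = m

namespace Loc

variable {A B C D : 𝒢}

/-- The identity map. -/
def id (A : 𝒢) : Loc A A where
  v := _root_.id
  l := _root_.id
  p_l _ := rfl
  g_v _ := rfl
  inj _ _ _ h := h
  surj _ m h := ⟨m, h, rfl⟩

/-- Composition of maps. -/
def comp (f : Loc A B) (g : Loc B C) : Loc A C where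
  v x := g.v (f.v x)
  l x := g.l (f.l x)
  p_l x := by rw [g.p_l, f.p_l]
  g_v x := by rw [g.g_v, f.g_v]
  inj x y h e := f.inj x y h (g.inj _ _ (by rw [f.p_l, f.p_l, h]) e)
  surj x m h := by
    obtain ⟨y, hy, rfl⟩ := g.surj _ m h
    obtain ⟨z, hz, rfl⟩ := f.surj _ y hy
    exact ⟨z, hz, rfl⟩

/-- The first inclusion in a disjoint union. -/
def inl (A B : 𝒢) : Loc A (A ⊗ B) where
  v := Sum.inl
  l := Sum.inl
  p_l _ := rfl
  g_v _ := rfl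
  inj _ _ _ h := Sum.inl_injective h
  surj x m h := by
    rcases m with m | m
    · exact ⟨m, Sum.inl_injective h, rfl⟩
    · cases h

/-- The second inclusion in a disjoint union. -/
def inr (A B : 𝒢) : Loc B (A ⊗ B) where
  v := Sum.inr
  l := Sum.inr
  p_l _ := rfl
  g_v _ := rfl
  inj _ _ _ h := Sum.inr_injective h
  surj x m h := by
    rcases m with m | m
    · cases h
    · exact ⟨m, Sum.inr_injective h, rfl⟩

/-- The map from a disjoint union determined by two maps. -/
def copair (f : Loc A C) (g : Loc B C) : Loc (A ⊗ B) C where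
  v := Sum.elim f.v g.v
  l := Sum.elim f.l g.l
  p_l := by rintro (x | x); exacts [f.p_l x, g.p_l x]
  g_v := by rintro (x | x); exacts [f.g_v x, g.g_v x]
  inj := by
    rintro (x | x) (y | y) h e
    · exact congrArg Sum.inl (f.inj x y (Sum.inl_injective h) e)
    · cases h
    · cases h
    · exact congrArg Sum.inr (g.inj x y (Sum.inr_injective h) e)
  surj := by
    rintro (x | x) m h
    · obtain ⟨y, rfl, rfl⟩ := f.surj x m h
      exact ⟨Sum.inl y, rfl, rfl⟩
    · obtain ⟨y, rfl, rfl⟩ := g.surj x m h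
      exact ⟨Sum.inr y, rfl, rfl⟩

/-- For maps of this kind the disjoint union is a coproduct, which it is not in `𝒢`; this is what
permits arguing one summand at a time. -/
theorem copair_comp (f : Loc A C) (g : Loc B C) (h : Loc C D) :
    (copair f g).comp h = copair (f.comp h) (g.comp h) :=
  Loc.ext (by funext x; rcases x with x | x <;> rfl) (by funext x; rcases x with x | x <;> rfl)

/-- The map from the empty graph. -/
def ofEmpty (A : 𝒢) : Loc (𝟙_ 𝒢) A where
  v := Fin.elim0
  l := Fin.elim0
  p_l x := Fin.elim0 x
  g_v x := Fin.elim0 x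
  inj x := Fin.elim0 x
  surj x := Fin.elim0 x

theorem ofEmpty_comp (f : Loc A B) : (ofEmpty A).comp f = ofEmpty B :=
  Loc.ext (funext fun x => Fin.elim0 x) (funext fun x => Fin.elim0 x)

/-- The map underlying an isomorphism. -/
noncomputable def ofHom (f : A ⟶ B) (hf : IsIso f) : Loc A B where
  v := Hom.vert f
  l x := (Hom.exists_leg f x (noEdge_of_isIso f x)).choose
  p_l x := by
    have h := (Hom.exists_leg f x (noEdge_of_isIso f x)).choose_spec
    exact (Hom.vert_p_leg f _).symm.trans (congrArg (fun y => Hom.vert f (A.p y)) h)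
  g_v := g_vert f
  inj x y _ e := by
    rw [← (Hom.exists_leg f x (noEdge_of_isIso f x)).choose_spec,
      ← (Hom.exists_leg f y (noEdge_of_isIso f y)).choose_spec, e]
  surj x m h := by
    refine ⟨Hom.leg f m, (bijective_vert f).1 (by rw [Hom.vert_p_leg, h]),
      Hom.leg_injective f ?_⟩
    exact (Hom.exists_leg f (Hom.leg f m) (noEdge_of_isIso f _)).choose_spec

theorem leg_ofHom_l (f : A ⟶ B) (hf : IsIso f) (x : A.L) : Hom.leg f ((ofHom f hf).l x) = x :=
  (Hom.exists_leg f x (noEdge_of_isIso f x)).choose_spec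

theorem ofHom_ext (f : A ⟶ B) (hf : IsIso f) {g : Loc A B} (hv : ∀ x, Hom.vert f x = g.v x)
    (hl : ∀ x, Hom.leg f (g.l x) = x) : ofHom f hf = g :=
  Loc.ext (funext hv) (funext fun x => Hom.leg_injective f
    ((leg_ofHom_l f hf x).trans (hl x).symm))

/-- `Hom.leg` is inverse to the map on legs, so an invertible morphism is recovered from the
underlying map. -/
theorem ofHom_injective {f g : A ⟶ B} (hf : IsIso f) (hg : IsIso g)
    (h : ofHom f hf = ofHom g hg) : f = g := by
  refine NoEdge.ext (noEdge_of_isIso f) (noEdge_of_isIso g) (fun l => ?_)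
    (fun v => congrFun (congrArg Loc.v h) v)
  obtain ⟨m, rfl⟩ : ∃ m, (ofHom f hf).l m = l :=
    ⟨Hom.leg f l, Hom.leg_injective f (leg_ofHom_l f hf _)⟩
  rw [leg_ofHom_l, h, leg_ofHom_l]

/-- Bijectivity on vertices, together with bijectivity on the legs at each vertex, gives bijectivity
on all legs. -/
theorem exists_hom (f : Loc A B) (hf : Function.Bijective f.v) :
    ∃ (h : A ⟶ B) (hh : IsIso h), ofHom h hh = f := by
  have hl : Function.Bijective f.l := by
    refine ⟨fun x y e => f.inj x y (hf.1 ?_) e, fun m => ?_⟩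
    · rw [← f.p_l, ← f.p_l, e]
    · obtain ⟨x, hx⟩ := hf.2 (B.p m)
      obtain ⟨y, -, hy⟩ := f.surj x m hx.symm
      exact ⟨y, hy⟩
  let e : A ≅ B := isoOfEquiv (Equiv.ofBijective _ hl) (Equiv.ofBijective _ hf)
    (fun x => (f.p_l x).symm) f.g_v
  refine ⟨e.hom, e.isIso_hom, ofHom_ext _ _ (fun _ => rfl) fun x => ?_⟩
  exact (Equiv.ofBijective _ hl).symm_apply_apply x

/-- Factoring a map through an injective one. -/
theorem exists_factor (a : Loc A C) (b : Loc B C) (h : ∀ x, ∃ y, b.v y = a.v x) :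
    ∃ c : Loc A B, c.comp b = a := by
  choose v hv using h
  have hl (x : A.L) : ∃ y, B.p y = v (A.p x) ∧ b.l y = a.l x :=
    b.surj (v (A.p x)) (a.l x) (by rw [a.p_l, hv])
  choose l hp hl using hl
  exact ⟨{ v := v
           l := l
           p_l := hp
           g_v := fun x => by rw [← b.g_v, hv, a.g_v]
           inj := fun x y h e => a.inj x y h (by rw [← hl, ← hl, e])
           surj := fun x m h => by
             obtain ⟨y, rfl, hy⟩ := a.surj x (b.l m) (by rw [b.p_l, h, hv])
             exact ⟨y, rfl, b.inj _ _ (by rw [hp, h]) (by rw [hl, hy])⟩ },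
    Loc.ext (funext hv) (funext hl)⟩

theorem comp_right_cancel {c c' : Loc A B} {b : Loc B C} (hb : Function.Injective b.v)
    (h : c.comp b = c'.comp b) : c = c' := by
  have hv : c.v = c'.v := funext fun x => hb (congrFun (congrArg Loc.v h) x)
  refine Loc.ext hv (funext fun x => b.inj _ _ ?_ (congrFun (congrArg Loc.l h) x))
  rw [c.p_l, c'.p_l, hv]

end Loc

end 𝒢

open 𝒢

namespace ℋ

variable {A B C D : ℋ}

/-- The map underlying a morphism of `ℋ`. -/
noncomputable def loc (f : A ⟶ B) : Loc A.obj B.obj := Loc.ofHom f.hom f.property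

/-- Equations in `ℋ` can be checked in `Loc`, where the structure isomorphisms are copairings of
inclusions. -/
theorem loc_injective {f g : A ⟶ B} (h : loc f = loc g) : f = g :=
  WideSubcategory.hom_ext _ (Loc.ofHom_injective _ _ h)

theorem exists_loc_eq (f : Loc A.obj B.obj) (hf : Function.Bijective f.v) :
    ∃ h : A ⟶ B, loc h = f :=
  let ⟨h, hh, e⟩ := f.exists_hom hf
  ⟨⟨h, hh⟩, e⟩

theorem bijective_loc (f : A ⟶ B) : Function.Bijective (loc f).v :=
  have : IsIso f.hom := f.property
  bijective_vert f.hom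

theorem loc_id (A : ℋ) : loc (𝟙 A) = Loc.id A.obj :=
  Loc.ofHom_ext _ _ (fun _ => rfl) fun _ => rfl

theorem loc_comp (f : A ⟶ B) (g : B ⟶ C) : loc (f ≫ g) = (loc f).comp (loc g) :=
  Loc.ofHom_ext _ _ (fun _ => rfl) fun x =>
    (congrArg (Hom.leg f.hom) (Loc.leg_ofHom_l g.hom g.property _)).trans
      (Loc.leg_ofHom_l f.hom f.property x)

theorem loc_tensor {A' B' : ℋ} (f : A ⟶ B) (g : A' ⟶ B') :
    loc (f ⊗ₘ g) = Loc.copair ((loc f).comp (Loc.inl B.obj B'.obj))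
      ((loc g).comp (Loc.inr B.obj B'.obj)) :=
  Loc.ofHom_ext _ _ (by rintro (x | x) <;> rfl) (by
    rintro (x | x)
    · exact congrArg Sum.inl (Loc.leg_ofHom_l f.hom f.property x)
    · exact congrArg Sum.inr (Loc.leg_ofHom_l g.hom g.property x))

theorem loc_associator (A B C : ℋ) :
    loc (α_ A B C).hom = Loc.copair
      (Loc.copair (Loc.inl _ _) ((Loc.inl B.obj C.obj).comp (Loc.inr A.obj (B.obj ⊗ C.obj))))
      ((Loc.inr B.obj C.obj).comp (Loc.inr A.obj (B.obj ⊗ C.obj))) :=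
  Loc.ofHom_ext _ _ (by rintro ((x | x) | x) <;> rfl) (by rintro ((x | x) | x) <;> rfl)

theorem loc_leftUnitor (A : ℋ) :
    loc (λ_ A).hom = Loc.copair (Loc.ofEmpty _) (Loc.id A.obj) :=
  Loc.ofHom_ext _ _ (by rintro (x | x); exacts [Fin.elim0 x, rfl])
    (by rintro (x | x); exacts [Fin.elim0 x, rfl])

theorem loc_braiding (A B : ℋ) :
    loc (β_ A B).hom = Loc.copair (Loc.inr B.obj A.obj) (Loc.inl B.obj A.obj) :=
  Loc.ofHom_ext _ _ (by rintro (x | x) <;> rfl) (by rintro (x | x) <;> rfl)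

end ℋ

/-! ### Graphs with one vertex -/

namespace 𝒢

/-- The graph with one vertex of genus `k.2` and `k.1` legs. -/
def corolla (k : ℕ × ℕ) : 𝒢 where
  L := .fin k.1
  V := .fin 1
  p := fun _ => (0 : Fin 1)
  g := fun _ => k.2

theorem subsingleton_corolla {k : ℕ × ℕ} (x y : (corolla k).V) : x = y :=
  Subsingleton.elim (α := Fin 1) x y

/-- The type of a vertex. -/
noncomputable def star (A : 𝒢) (v : A.V) : ℕ × ℕ := (Nat.card {l // A.p l = v}, A.g v)

/-- The inclusion of a vertex. -/
noncomputable def starIncl (A : 𝒢) (v : A.V) : Loc (corolla (A.star v)) A where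
  v _ := v
  l i := ((Finite.equivFin {l // A.p l = v}).symm i).1
  p_l i := ((Finite.equivFin {l // A.p l = v}).symm i).2
  g_v _ := rfl
  inj _ _ _ h := (Finite.equivFin {l // A.p l = v}).symm.injective (Subtype.ext h)
  surj _ m h := ⟨Finite.equivFin {l // A.p l = v} ⟨m, h⟩, subsingleton_corolla _ _,
    congrArg Subtype.val ((Finite.equivFin {l // A.p l = v}).symm_apply_apply _)⟩

theorem injective_starIncl (A : 𝒢) (v : A.V) : Function.Injective (A.starIncl v).v :=
  fun _ _ _ => subsingleton_corolla _ _

end 𝒢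

/-- The groupoid of graphs with one vertex. -/
abbrev Corolla : Type := InducedCategory ℋ fun k : ℕ × ℕ => (⟨corolla k⟩ : ℋ)

namespace Corolla

/-- The inclusion of the graphs with one vertex. -/
noncomputable abbrev incl : Corolla ⥤ ℋ := inducedFunctor _

theorem bijective_loc_v {k k' : ℕ × ℕ} (f : Loc (corolla k) (corolla k')) :
    Function.Bijective f.v :=
  ⟨fun _ _ _ => subsingleton_corolla _ _, fun _ => ⟨(0 : Fin 1), subsingleton_corolla _ _⟩⟩

theorem exists_hom {k k' : Corolla} (f : Loc (corolla k) (corolla k')) :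
    ∃ h : k ⟶ k', loc h.hom = f :=
  let ⟨h, e⟩ := exists_loc_eq (A := ⟨corolla k⟩) (B := ⟨corolla k'⟩) f (bijective_loc_v f)
  ⟨⟨h⟩, e⟩

instance {k k' : Corolla} (f : k ⟶ k') : IsIso f :=
  ⟨⟨inv f.hom⟩, InducedCategory.hom_ext (IsIso.hom_inv_id f.hom),
    InducedCategory.hom_ext (IsIso.inv_hom_id f.hom)⟩

/-- The type of a vertex, as a graph with one vertex. -/
noncomputable def star (A : 𝒢) (v : A.V) : Corolla := A.star v

/-- The inclusion of a vertex can be cancelled, so a morphism to the one-vertex graph at `v` is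
known once it is known inside `A`. -/
theorem hom_star_ext {A : 𝒢} {v : A.V} {k : Corolla} {f g : k ⟶ star A v}
    (h : (loc f.hom).comp (A.starIncl v) = (loc g.hom).comp (A.starIncl v)) : f = g :=
  InducedCategory.hom_ext (loc_injective (Loc.comp_right_cancel (A.injective_starIncl v) h))

theorem exists_hom_star {A : 𝒢} {v : A.V} {k : Corolla} (f : Loc (corolla k) A)
    (hf : ∀ x, v = f.v x) : ∃ h : k ⟶ star A v, (loc h.hom).comp (A.starIncl v) = f := by
  obtain ⟨c, hc⟩ := Loc.exists_factor f (A.starIncl v) fun x => ⟨(0 : Fin 1), hf x⟩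
  obtain ⟨h, rfl⟩ := exists_hom (k := k) (k' := star A v) c
  exact ⟨h, hc⟩

/-- The map on the type of a vertex. -/
noncomputable def starMap {A B : 𝒢} (f : Loc A B) (v : A.V) : star A v ⟶ star B (f.v v) :=
  (exists_hom_star (k := star A v) ((A.starIncl v).comp f) fun _ => rfl).choose

/-- This equation characterizes `starMap`; its functoriality follows by cancelling the inclusion. -/
theorem starMap_incl {A B : 𝒢} (f : Loc A B) (v : A.V) :
    (loc (starMap f v).hom).comp (B.starIncl (f.v v)) = (A.starIncl v).comp f :=
  (exists_hom_star (k := star A v) ((A.starIncl v).comp f) fun _ => rfl).choose_spec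

theorem starMap_id {A : 𝒢} (v : A.V) : starMap (Loc.id A) v = 𝟙 (star A v) :=
  hom_star_ext ((starMap_incl (Loc.id A) v).trans
    (congrArg (fun k => Loc.comp k (A.starIncl v)) (loc_id ⟨corolla (star A v)⟩)).symm)

theorem starMap_comp {A B C : 𝒢} (f : Loc A B) (g : Loc B C) (v : A.V) :
    starMap (f.comp g) v = starMap f v ≫ starMap g (f.v v) := by
  refine hom_star_ext ((starMap_incl (f.comp g) v).trans ?_)
  have e : loc (starMap f v ≫ starMap g (f.v v)).hom =
      (loc (starMap f v).hom).comp (loc (starMap g (f.v v)).hom) := loc_comp _ _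
  refine Eq.trans ?_ (congrArg (fun k => Loc.comp k (C.starIncl _)) e).symm
  exact (congrArg (fun k => Loc.comp k g) (starMap_incl f v)).symm.trans
    (congrArg (Loc.comp (loc (starMap f v).hom)) (starMap_incl g (f.v v))).symm

end Corolla

/-! ### The free preoperad as a tensor product over vertices -/

namespace Corolla

open TensorTree

variable {C : Type u} [Category.{v} C] [MonoidalCategory C] [SymmetricCategory C]
  (M : Corolla ⥤ C) {A B D E : 𝒢}

/-- The objects attached to the vertices of a graph. -/
noncomputable abbrev fam (A : 𝒢) (v : A.V) : C := M.obj (star A v)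

/-- The maps attached to the vertices of a graph. -/
noncomputable abbrev famMap (f : Loc A B) (v : A.V) : fam M A v ⟶ fam M B (f.v v) :=
  M.map (starMap f v)

/-- The tensor product of the objects attached to the vertices. -/
noncomputable abbrev vertexTensor (A : 𝒢) : C := (ofCode A.V).obj (fam M A)

/-- The tensor product of the maps attached to the vertices. -/
noncomputable abbrev vertexMap (f : Loc A B) :
    vertexTensor M A ⟶ ((ofCode A.V).map f.v).obj (fam M B) :=
  mapObj (famMap M f) (ofCode A.V)

theorem rel_mapObj_famMap_comp (f : Loc A B) (g : Loc B D) (t : TensorTree A.V) :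
    Rel (mapObj (famMap M f) t ≫ mapObj (famMap M g) (t.map f.v))
      (mapObj (famMap M (f.comp g)) t) := by
  have e : famMap M (f.comp g) = fun v => famMap M f v ≫ famMap M g (f.v v) :=
    funext fun v => (congrArg M.map (starMap_comp f g v)).trans (M.map_comp _ _)
  exact (rel_mapObj_comp (famMap M f) (famMap M g) t).trans
    (.of_eq (congrArg (fun φ => mapObj (j := (f.comp g).v) φ t) e.symm))

theorem rel_vertexMap_id (A : 𝒢) : Rel (vertexMap M (Loc.id A)) (𝟙 (vertexTensor M A)) := by
  have e : famMap M (Loc.id A) = fun v => 𝟙 (fam M A v) :=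
    funext fun v => (congrArg M.map (starMap_id v)).trans (M.map_id _)
  exact (Rel.of_eq (congrArg (fun φ => mapObj (j := id) φ (ofCode A.V)) e)).trans
    (rel_mapObj_id _)

theorem rel_vertexMap_congr {f g : Loc A B} (h : f = g) :
    Rel (vertexMap M f) (vertexMap M g) := by
  subst h
  exact .refl _

/-- The map of tensor products over the vertices given by a bijection of the vertices. -/
noncomputable def mapLoc (f : Loc A B) (hf : Function.Bijective f.v) :
    vertexTensor M A ⟶ vertexTensor M B :=
  reindex (famMap M f) (perm_ofCode hf)

theorem rel_mapLoc (f : Loc A B) (hf : Function.Bijective f.v) :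
    Rel (vertexMap M f) (mapLoc M f hf) :=
  rel_reindex _ _

theorem comp_mapLoc {S : C} {t : TensorTree A.V} {s : S ⟶ vertexTensor M A}
    {s' : S ⟶ t.obj (fam M A)} (h : Rel s s') (f : Loc A B) (hf : Function.Bijective f.v) :
    Rel (s ≫ mapLoc M f hf) (s' ≫ mapObj (famMap M f) t) :=
  h.comp_reindex _ _

theorem mapLoc_vertexMap (f : Loc A B) (hf : Function.Bijective f.v) (g : Loc B D) :
    Rel (mapLoc M f hf ≫ vertexMap M g) (vertexMap M (f.comp g)) :=
  ((rel_mapLoc M f hf).symm.comp_mapObj _).trans (rel_mapObj_famMap_comp M f g _)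

/-- The structure map of the free preoperad. -/
noncomputable def vertexμ (A B : 𝒢) : vertexTensor M A ⊗ vertexTensor M B ⟶ vertexTensor M (A ⊗ B) :=
  vertexMap M (Loc.inl A B) ⊗ₘ vertexMap M (Loc.inr A B)

instance isIso_vertexμ (A B : 𝒢) : IsIso (vertexμ M A B) :=
  have := isIso_mapObj (famMap M (Loc.inl A B)) (ofCode A.V)
  have := isIso_mapObj (famMap M (Loc.inr A B)) (ofCode B.V)
  inferInstanceAs (IsIso (vertexMap M (Loc.inl A B) ⊗ₘ vertexMap M (Loc.inr A B)))

/-- The structure map consists of the two inclusions, so composing it with `f` amounts to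
restricting `f` to the two summands. The axioms thereby reduce to comparing maps of graphs on
summands. -/
theorem vertexμ_vertexMap (f : Loc (A ⊗ B) D) :
    Rel (t := node _ _) (t' := node _ _) (vertexμ M A B ≫ vertexMap M f)
      (vertexMap M ((Loc.inl A B).comp f) ⊗ₘ vertexMap M ((Loc.inr A B).comp f)) :=
  (Rel.of_eq (tensorHom_comp_tensorHom _ _ _ _)).trans
    ((rel_mapObj_famMap_comp M (Loc.inl A B) f _).tensor
      (rel_mapObj_famMap_comp M (Loc.inr A B) f _))

theorem vertexμ_mapLoc (f : Loc (A ⊗ B) D) (hf : Function.Bijective f.v) :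
    Rel (t' := node _ _) (vertexμ M A B ≫ mapLoc M f hf)
      (vertexMap M ((Loc.inl A B).comp f) ⊗ₘ vertexMap M ((Loc.inr A B).comp f)) :=
  ((rel_mapLoc M f hf).symm.comp _).trans (vertexμ_vertexMap M f)

theorem perm_leaves_unit :
    (unit : TensorTree (𝟙_ 𝒢).V).leaves.Perm (ofCode (𝟙_ 𝒢).V).leaves :=
  .of_eq (leaves_ofList (List.finRange 0)).symm

/-- The unit map of the free preoperad. -/
noncomputable def vertexε : 𝟙_ C ⟶ vertexTensor M (𝟙_ 𝒢) :=
  (exists_coh (fam M (𝟙_ 𝒢)) perm_leaves_unit).choose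

instance isIso_vertexε : IsIso (vertexε M) :=
  (exists_coh (fam M (𝟙_ 𝒢)) perm_leaves_unit).choose_spec.isIso

theorem rel_vertexε : Rel (t := unit) (X := fam M (𝟙_ 𝒢)) (𝟙 (𝟙_ C)) (vertexε M) :=
  ⟨_, (exists_coh (fam M (𝟙_ 𝒢)) perm_leaves_unit).choose_spec, Category.id_comp _⟩

theorem vertexε_vertexMap (f : Loc (𝟙_ 𝒢) D) :
    Rel (t' := unit) (vertexε M ≫ vertexMap M f) (𝟙 (𝟙_ C)) :=
  ((rel_vertexε M).symm.comp_mapObj (famMap M f)).trans (.of_eq (Category.comp_id _))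

/-- The functor underlying the free preoperad. -/
noncomputable def freeFunctor : ℋ ⥤ C where
  obj A := vertexTensor M A.obj
  map f := mapLoc M (loc f) (bijective_loc f)
  map_id A := ((rel_mapLoc M _ _).symm.trans ((rel_vertexMap_congr M (loc_id A)).trans
    (rel_vertexMap_id M A.obj))).eq (nodup_leaves_ofCode _)
  map_comp f g := ((rel_mapLoc M _ _).symm.trans ((rel_vertexMap_congr M (loc_comp f g)).trans
    ((comp_mapLoc M (rel_mapLoc M _ _).symm _ _).trans
      (rel_mapObj_famMap_comp M _ _ _)).symm)).eq (nodup_leaves_ofCode _)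

theorem vertexμ_map {A B D : ℋ} (f : A ⊗ B ⟶ D) {g : Loc (A ⊗ B).obj D.obj} (h : loc f = g) :
    Rel (t' := node _ _) (vertexμ M A.obj B.obj ≫ (freeFunctor M).map f)
      (vertexMap M ((Loc.inl A.obj B.obj).comp g) ⊗ₘ
        vertexMap M ((Loc.inr A.obj B.obj).comp g)) := by
  subst h
  exact vertexμ_mapLoc M _ (bijective_loc f)

/-- On each of the two factors, both sides come from the same map of graphs; hence they agree up to
coherence, and then exactly, since the vertices of the target are listed without repetition. The
other axioms follow the same scheme. -/
theorem vertexμ_natural {A B A' B' : ℋ} (f : A ⟶ B) (g : A' ⟶ B') :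
    ((freeFunctor M).map f ⊗ₘ (freeFunctor M).map g) ≫ vertexμ M B.obj B'.obj =
      vertexμ M A.obj A'.obj ≫ (freeFunctor M).map (f ⊗ₘ g) :=
  Rel.eq (t := ofCode (B ⊗ B').obj.V) ((Rel.of_eq (tensorHom_comp_tensorHom _ _ _ _)).trans
    (((mapLoc_vertexMap M (loc f) (bijective_loc f) (Loc.inl B.obj B'.obj)).tensor
      (mapLoc_vertexMap M (loc g) (bijective_loc g) (Loc.inr B.obj B'.obj))).trans
      (vertexμ_map M (f ⊗ₘ g) (loc_tensor f g)).symm)) (nodup_leaves_ofCode _)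

theorem vertexμ_assoc (A B D : ℋ) :
    (vertexμ M A.obj B.obj ⊗ₘ 𝟙 (vertexTensor M D.obj)) ≫ vertexμ M (A ⊗ B).obj D.obj ≫
      (freeFunctor M).map (α_ A B D).hom =
    (α_ (vertexTensor M A.obj) (vertexTensor M B.obj) (vertexTensor M D.obj)).hom ≫
      (𝟙 (vertexTensor M A.obj) ⊗ₘ vertexμ M B.obj D.obj) ≫ vertexμ M A.obj (B ⊗ D).obj := by
  have h₁ := (vertexμ_map M (α_ A B D).hom (loc_associator A B D)).comp
    (vertexμ M A.obj B.obj ⊗ₘ 𝟙 (vertexTensor M D.obj))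
  have h₂ := h₁.trans (.of_eq (tensorHom_comp_tensorHom _ _ _ _))
  have h₃ := h₂.trans ((vertexμ_vertexMap M _).tensor (.of_eq (Category.id_comp _)))
  have k₁ : Rel (t' := node _ _) ((𝟙 (vertexTensor M A.obj) ⊗ₘ vertexμ M B.obj D.obj) ≫
      vertexμ M A.obj (B ⊗ D).obj) _ := (Rel.of_eq (tensorHom_comp_tensorHom _ _ _ _)).trans
    ((Rel.of_eq (Category.id_comp _)).tensor (vertexμ_vertexMap M _))
  have k₂ := k₁.comp
    (α_ (vertexTensor M A.obj) (vertexTensor M B.obj) (vertexTensor M D.obj)).hom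
  have k₃ := k₂.trans (.of_eq (associator_naturality _ _ _).symm)
  -- The associator is itself a coherence morphism, so `Rel` absorbs it.
  have k₄ := (Rel.of_coh (.assoc _ _ _) _).trans k₃.symm
  exact Rel.eq (t := ofCode (A ⊗ (B ⊗ D)).obj.V) (h₃.trans k₄) (nodup_leaves_ofCode _)

theorem vertexε_leftUnitor (A : ℋ) : (λ_ (vertexTensor M A.obj)).hom =
    (vertexε M ⊗ₘ 𝟙 (vertexTensor M A.obj)) ≫ vertexμ M (𝟙_ ℋ).obj A.obj ≫
      (freeFunctor M).map (λ_ A).hom := by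
  have h₁ := (vertexμ_map M (λ_ A).hom (loc_leftUnitor A)).comp
    (vertexε M ⊗ₘ 𝟙 (vertexTensor M A.obj))
  have h₂ := h₁.trans (.of_eq (tensorHom_comp_tensorHom _ _ _ _))
  have h₃ := h₂.trans ((vertexε_vertexMap M _).tensor
    ((Rel.of_eq (Category.id_comp _)).trans (rel_vertexMap_id M A.obj)))
  have h₄ := h₃.trans (.of_eq (id_tensorHom_id _ _))
  exact Rel.eq (t := ofCode A.obj.V) (h₄.trans ((Rel.of_coh (.leftUnitor _) _).trans
    (.of_eq (Category.id_comp _)))).symm (nodup_leaves_ofCode _)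

theorem vertexμ_braiding (A B : ℋ) :
    vertexμ M A.obj B.obj ≫ (freeFunctor M).map (β_ A B).hom =
      (β_ (vertexTensor M A.obj) (vertexTensor M B.obj)).hom ≫ vertexμ M B.obj A.obj := by
  have h := vertexμ_map M (β_ A B).hom (loc_braiding A B)
  exact Rel.eq (t := ofCode (B ⊗ A).obj.V) (h.trans ((Rel.of_coh (.braiding _ _) _).trans
    (.of_eq (BraidedCategory.braiding_naturality _ _)))) (nodup_leaves_ofCode _)

noncomputable instance : (freeFunctor M).Braided :=
  .ofIsos _ (@asIso _ _ _ _ (vertexε M) (isIso_vertexε M))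
    (fun A B => @asIso _ _ _ _ (vertexμ M A.obj B.obj) (isIso_vertexμ M A.obj B.obj))
    (vertexμ_natural M) (vertexμ_assoc M) (vertexε_leftUnitor M) (vertexμ_braiding M)

/-- The free preoperad. -/
noncomputable def freePreoperad : ModularPreoperad C := ⟨freeFunctor M, inferInstance⟩

end Corolla

/-! ### Functoriality of the free preoperad, and its restriction to one vertex -/

namespace Corolla

open TensorTree

variable {C : Type u} [Category.{v} C] [MonoidalCategory C] [SymmetricCategory C]

section

variable {M N : Corolla ⥤ C} (ψ : M ⟶ N) {A B D : 𝒢}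

/-- The tensor product of the components of a natural transformation. -/
noncomputable def vertexNat (A : 𝒢) : vertexTensor M A ⟶ vertexTensor N A :=
  reindex (j := id) (fun v => ψ.app (star A v)) (perm_ofCode Function.bijective_id)

theorem rel_vertexNat (A : 𝒢) :
    Rel (mapObj (j := id) (fun v => ψ.app (star A v)) (ofCode A.V)) (vertexNat ψ A) :=
  rel_reindex _ _

theorem comp_vertexNat {S : C} {t : TensorTree A.V} {s : S ⟶ vertexTensor M A}
    {s' : S ⟶ t.obj (fam M A)} (h : Rel s s') :
    Rel (s ≫ vertexNat ψ A) (s' ≫ mapObj (j := id) (fun v => ψ.app (star A v)) t) :=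
  h.comp_reindex _ _

theorem rel_famMap_naturality (f : Loc A B) (t : TensorTree A.V) :
    Rel (mapObj (famMap M f) t ≫ mapObj (j := id) (fun v => ψ.app (star B v)) (t.map f.v))
      (mapObj (j := id) (fun v => ψ.app (star A v)) t ≫ mapObj (famMap N f) (t.map id)) := by
  have e : (fun v => famMap M f v ≫ ψ.app (star B (f.v v))) =
      fun v => ψ.app (star A v) ≫ famMap N f v := funext fun v => ψ.naturality _
  exact (rel_mapObj_comp (j' := id) (famMap M f) (fun v => ψ.app (star B v)) t).trans
    ((Rel.of_eq (congrArg (fun φ => mapObj (j := f.v) φ t) e)).trans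
      (rel_mapObj_comp (j := id) (fun v => ψ.app (star A v)) (famMap N f) t).symm)

theorem rel_vertexNat_vertexMap (f : Loc A B) :
    Rel (vertexMap M f ≫ mapObj (j := id) (fun v => ψ.app (star B v)) ((ofCode A.V).map f.v))
      (vertexNat ψ A ≫ vertexMap N f) :=
  (rel_famMap_naturality ψ f _).trans ((rel_vertexNat ψ A).comp_mapObj _)

/-- The map of free preoperads given by a natural transformation. -/
noncomputable def freeNatTrans : freeFunctor M ⟶ freeFunctor N where
  app A := vertexNat ψ A.obj
  naturality _ B f := Rel.eq (t := ofCode B.obj.V)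
    ((comp_vertexNat ψ (rel_mapLoc M (loc f) (bijective_loc f)).symm).trans
      ((rel_vertexNat_vertexMap ψ (loc f)).trans
        ((rel_mapLoc N (loc f) (bijective_loc f)).comp _))) (nodup_leaves_ofCode _)

instance isMonoidal_freeNatTrans : NatTrans.IsMonoidal (freeNatTrans ψ) where
  unit := Rel.eq (t := ofCode (𝟙_ 𝒢).V) (((comp_vertexNat ψ (rel_vertexε M).symm).trans
    (.of_eq (Category.comp_id _))).trans (rel_vertexε N)) (nodup_leaves_ofCode _)
  tensor A B := Rel.eq (t := ofCode (A ⊗ B).obj.V)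
    ((comp_vertexNat ψ (.refl (t := node _ _) (vertexμ M A.obj B.obj))).trans
    ((Rel.of_eq (tensorHom_comp_tensorHom _ _ _ _)).trans
      (((rel_vertexNat_vertexMap ψ (Loc.inl A.obj B.obj)).tensor
        (rel_vertexNat_vertexMap ψ (Loc.inr A.obj B.obj))).trans
        (.of_eq (tensorHom_comp_tensorHom _ _ _ _).symm)))) (nodup_leaves_ofCode _)

end

variable (C) in
/-- The free preoperad functor. -/
noncomputable def free : (Corolla ⥤ C) ⥤ ModularPreoperad C where
  obj M := freePreoperad M
  map ψ := ⟨freeNatTrans ψ, isMonoidal_freeNatTrans ψ⟩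
  map_id M := SymmMonFunctor.hom_ext fun A => reindex_id (X := fam M A.obj)
    (perm_ofCode Function.bijective_id)
    (nodup_leaves_ofCode _)
  map_comp {M N K} ψ χ := SymmMonFunctor.hom_ext fun A =>
    (reindex_comp (X := fam M A.obj) (Y := fam N A.obj) (Z := fam K A.obj) (j := id) (j' := id) (fun v => ψ.app (star A.obj v))
      (fun v => χ.app (star A.obj v)) (perm_ofCode Function.bijective_id)
      (perm_ofCode Function.bijective_id) (perm_ofCode Function.bijective_id) (nodup_leaves_ofCode _)).symm

variable (C) in
/-- The restriction of a preoperad to the graphs with one vertex. -/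
noncomputable abbrev restrict : ModularPreoperad C ⥤ (Corolla ⥤ C) :=
  SymmMonFunctor.forget ℋ C ⋙ (Functor.whiskeringLeft Corolla ℋ C).obj incl

/-- A graph with one vertex is the type of that vertex. -/
noncomputable def toStar (k : Corolla) (v : (corolla k).V) : k ⟶ star (corolla k) v :=
  (exists_hom_star (Loc.id (corolla k)) fun _ => subsingleton_corolla _ _).choose

theorem toStar_incl (k : Corolla) (v : (corolla k).V) :
    (loc (toStar k v).hom).comp (starIncl (corolla k) v) = Loc.id (corolla k) :=
  (exists_hom_star (Loc.id (corolla k)) fun _ => subsingleton_corolla _ _).choose_spec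

theorem toStar_naturality {k k' : Corolla} (f : k ⟶ k') (v : (corolla k).V) :
    f ≫ toStar k' ((loc f.hom).v v) = toStar k v ≫ starMap (loc f.hom) v := by
  have e₁ : loc (f ≫ toStar k' ((loc f.hom).v v)).hom =
    (loc f.hom).comp (loc (toStar k' ((loc f.hom).v v)).hom) := loc_comp _ _
  have e₂ : loc (toStar k v ≫ starMap (loc f.hom) v).hom =
    (loc (toStar k v).hom).comp (loc (starMap (loc f.hom) v).hom) := loc_comp _ _
  refine hom_star_ext ((congrArg (fun g => Loc.comp g _) e₁).trans
    (Eq.trans ?_ (congrArg (fun g => Loc.comp g _) e₂).symm))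
  exact (congrArg (Loc.comp (loc f.hom)) (toStar_incl k' _)).trans
    ((congrArg (Loc.comp (loc (toStar k v).hom)) (starMap_incl (loc f.hom) v)).trans
    (congrArg (fun g => Loc.comp g (loc f.hom)) (toStar_incl k v))).symm

theorem perm_leaves_leaf (k : Corolla) :
    (leaf (W := (corolla k).V) (0 : Fin 1)).leaves.Perm (ofCode (corolla k).V).leaves :=
  .of_eq (leaves_ofList (List.finRange 1)).symm

section

variable (M : Corolla ⥤ C)

/-- The value at a graph with one vertex as a tensor product with one factor. -/
noncomputable def single (k : Corolla) : M.obj k ⟶ vertexTensor M (corolla k) :=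
  M.map (toStar k (0 : Fin 1)) ≫ (exists_coh (fam M (corolla k)) (perm_leaves_leaf k)).choose

instance isIso_single (k : Corolla) : IsIso (single M k) :=
  IsIso.comp_isIso' inferInstance
    (exists_coh (fam M (corolla k)) (perm_leaves_leaf k)).choose_spec.isIso

/-- Stated for every name `v` of the unique vertex, since naturality produces the image of `0` under
a morphism rather than `0`. -/
theorem rel_single (k : Corolla) (v : (corolla k).V) :
    Rel (t := leaf v) (X := fam M (corolla k)) (M.map (toStar k v)) (single M k) := by
  obtain rfl := subsingleton_corolla (0 : Fin 1) v
  exact .of_coh (exists_coh (fam M (corolla k)) (perm_leaves_leaf k)).choose_spec _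

theorem single_naturality {k k' : Corolla} (f : k ⟶ k') :
    M.map f ≫ single M k' = single M k ≫ mapLoc M (loc f.hom) (bijective_loc f.hom) := by
  have e : M.map f ≫ M.map (toStar k' ((loc f.hom).v (0 : Fin 1))) =
      M.map (toStar k (0 : Fin 1)) ≫ M.map (starMap (loc f.hom) (0 : Fin 1)) :=
    (M.map_comp _ _).symm.trans ((congrArg M.map (toStar_naturality f _)).trans (M.map_comp _ _))
  exact Rel.eq (t := ofCode (corolla k').V) (((rel_single M k' _).symm.comp (M.map f)).trans
    ((Rel.of_eq e).trans
      (comp_mapLoc M (rel_single M k (0 : Fin 1)).symm _ _).symm)) (nodup_leaves_ofCode _)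

end

theorem single_vertexNat {M N : Corolla ⥤ C} (ψ : M ⟶ N) (k : Corolla) :
    ψ.app k ≫ single N k = single M k ≫ vertexNat ψ (corolla k) :=
  Rel.eq (t := ofCode (corolla k).V)
    (((rel_single N k (0 : Fin 1)).symm.comp (ψ.app k)).trans
    ((Rel.of_eq (ψ.naturality _).symm).trans
      (comp_vertexNat ψ (rel_single M k (0 : Fin 1)).symm).symm)) (nodup_leaves_ofCode _)

/-- The restriction of a free preoperad. -/
noncomputable def singleIso (M : Corolla ⥤ C) : M ≅ incl ⋙ freeFunctor M :=
  NatIso.ofComponents (fun k => @asIso _ _ (M.obj k) ((incl ⋙ freeFunctor M).obj k)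
    (single M k) (isIso_single M k)) (single_naturality M)

variable (C) in
/-- The unit of the equivalence between functors on graphs with one vertex and preoperads. -/
noncomputable def unitIso : 𝟭 (Corolla ⥤ C) ≅ free C ⋙ restrict C :=
  NatIso.ofComponents (fun M => singleIso M)
    (fun ψ => NatTrans.ext (funext (single_vertexNat ψ)))

end Corolla

/-! ### A preoperad is free on its values at one-vertex graphs -/

namespace Corolla

open TensorTree

section

variable {W : Type} {W' : Type} {X : W → ℋ} {Y : W' → ℋ} {A B : 𝒢}

/-- The map from a disjoint union determined by a map on each part. -/
noncomputable def glue (i : ∀ w, Loc (X w).obj A) : ∀ t : TensorTree W, Loc (t.obj X).obj A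
  | unit => Loc.ofEmpty A
  | leaf w => i w
  | node a b => Loc.copair (glue i a) (glue i b)

theorem loc_hom_comp_eq {D E : ℋ} (e : D ≅ E) {f : Loc E.obj A} {g : Loc D.obj A}
    (h : (loc e.hom).comp f = g) : (loc e.inv).comp g = f := by
  subst h
  exact congrArg (fun k => Loc.comp k f) ((loc_comp e.inv e.hom).symm.trans
    ((congrArg loc e.inv_hom_id).trans (loc_id E)))

theorem loc_tensor_comp {D E D' E' : ℋ} (f : D ⟶ E) (g : D' ⟶ E') (h : Loc (E ⊗ E').obj A) :
    (loc (f ⊗ₘ g)).comp h = Loc.copair ((loc f).comp ((Loc.inl _ _).comp h))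
      ((loc g).comp ((Loc.inr _ _).comp h)) :=
  (congrArg (fun k => Loc.comp k h) (loc_tensor f g)).trans (Loc.copair_comp _ _ _)

/-- A map out of a disjoint union is given by its restrictions to the parts, so neither rebracketing
nor reordering the parts affects it. -/
theorem loc_coh_comp_glue (i : ∀ w, Loc (X w).obj A) {t t' : TensorTree W}
    {f : t.obj X ⟶ t'.obj X} (hf : Coh X f) : (loc f).comp (glue i t') = glue i t := by
  have assoc (a b c : TensorTree W) :
      (loc (α_ (a.obj X) (b.obj X) (c.obj X)).hom).comp (glue i (node a (node b c))) =
        glue i (node (node a b) c) :=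
    (congrArg (fun k => Loc.comp k (glue i (node a (node b c)))) (loc_associator _ _ _)).trans
      ((Loc.copair_comp _ _ _).trans (congrArg (fun k => Loc.copair k _)
        (Loc.copair_comp _ _ _)))
  have leftUnitor (a : TensorTree W) :
      (loc (λ_ (a.obj X)).hom).comp (glue i a) = glue i (node unit a) :=
    (congrArg (fun k => Loc.comp k (glue i a)) (loc_leftUnitor _)).trans
      ((Loc.copair_comp _ _ _).trans (congrArg (fun k => Loc.copair k _)
        (Loc.ofEmpty_comp _)))
  induction hf with
  | id t => exact congrArg (fun k => Loc.comp k (glue i t)) (loc_id _)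
  | @comp _ _ _ f g _ _ ihf ihg =>
    exact (congrArg (fun k => Loc.comp k _) (loc_comp f g)).trans
      ((congrArg (Loc.comp (loc f)) ihg).trans ihf)
  | @tensor _ _ _ _ f g _ _ ihf ihg =>
    exact (loc_tensor_comp f g _).trans (congrArg₂ Loc.copair ihf ihg)
  | assoc a b c => exact assoc a b c
  | assocInv a b c => exact loc_hom_comp_eq (α_ _ _ _) (assoc a b c)
  | leftUnitor a => exact leftUnitor a
  | leftUnitorInv a => exact loc_hom_comp_eq (λ_ _) (leftUnitor a)
  | braiding a b =>
    exact (congrArg (fun k => Loc.comp k (glue i (node b a))) (loc_braiding _ _)).trans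
      (Loc.copair_comp _ _ _)

theorem loc_mapObj_comp_glue {j : W → W'} (φ : ∀ w, X w ⟶ Y (j w)) {i : ∀ w, Loc (X w).obj A}
    {i' : ∀ w, Loc (Y w).obj B} {f : Loc A B} (h : ∀ w, (loc (φ w)).comp (i' (j w)) = (i w).comp f)
    (t : TensorTree W) : (loc (mapObj φ t)).comp (glue i' (t.map j)) = (glue i t).comp f := by
  induction t with
  | unit => exact (Loc.ofEmpty_comp f).symm ▸ congrArg (fun k => Loc.comp k _) (loc_id (𝟙_ ℋ))
  | leaf w => exact h w
  | node a b iha ihb =>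
    exact (loc_tensor_comp _ _ _).trans ((congrArg₂ Loc.copair iha ihb).trans
      (Loc.copair_comp _ _ _).symm)

end

/-- The inclusion of a tensor product of vertices. -/
noncomputable def glueStar (A : 𝒢) (t : TensorTree A.V) :
    Loc (t.obj fun v => incl.obj (star A v)).obj A :=
  glue (fun v => A.starIncl v) t

/-- With the next two lemmas: the vertices reached are the leaves, each once if the leaves are
distinct. For `ofCode` this gives a bijection on vertices. -/
theorem glueStar_v_mem (A : 𝒢) (t : TensorTree A.V) :
    ∀ x, (glueStar A t).v x ∈ t.leaves := by
  induction t with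
  | unit => exact fun x => Fin.elim0 x
  | leaf w => exact fun x => List.mem_singleton_self _
  | node a b iha ihb =>
    rintro (x | x)
    · exact List.mem_append_left _ (iha x)
    · exact List.mem_append_right _ (ihb x)

theorem exists_glueStar_v_eq {A : 𝒢} {t : TensorTree A.V} {v : A.V} (h : v ∈ t.leaves) :
    ∃ x, (glueStar A t).v x = v := by
  induction t with
  | unit => cases h
  | leaf w => exact ⟨(0 : Fin 1), (List.mem_singleton.1 h).symm⟩
  | node a b iha ihb =>
    rcases List.mem_append.1 h with h | h
    · obtain ⟨x, hx⟩ := iha h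
      exact ⟨Sum.inl x, hx⟩
    · obtain ⟨x, hx⟩ := ihb h
      exact ⟨Sum.inr x, hx⟩

theorem injective_glueStar_v {A : 𝒢} {t : TensorTree A.V} (h : t.leaves.Nodup) :
    Function.Injective (glueStar A t).v := by
  induction t with
  | unit => exact fun x => Fin.elim0 x
  | leaf w => exact fun _ _ _ => subsingleton_corolla _ _
  | node a b iha ihb =>
    obtain ⟨ha, hb, hab⟩ := List.nodup_append.1 h
    rintro (x | x) (y | y) e
    · exact congrArg Sum.inl (iha ha e)
    · exact absurd e (hab _ (glueStar_v_mem A a x) _ (glueStar_v_mem A b y))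
    · exact absurd e.symm (hab _ (glueStar_v_mem A a y) _ (glueStar_v_mem A b x))
    · exact congrArg Sum.inr (ihb hb e)

theorem bijective_glueStar_v (A : 𝒢) : Function.Bijective (glueStar A (ofCode A.V)).v :=
  ⟨injective_glueStar_v (nodup_leaves_ofCode _),
    fun v => exists_glueStar_v_eq (mem_leaves_ofCode _ v)⟩

/-- The decomposition of a graph without edges into its vertices. -/
noncomputable def decomp (A : ℋ) : (ofCode A.obj.V).obj (fun v => incl.obj (star A.obj v)) ⟶ A :=
  (exists_loc_eq (glueStar A.obj (ofCode A.obj.V)) (bijective_glueStar_v _)).choose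

theorem loc_decomp (A : ℋ) : loc (decomp A) = glueStar A.obj (ofCode A.obj.V) :=
  (exists_loc_eq (glueStar A.obj (ofCode A.obj.V)) (bijective_glueStar_v _)).choose_spec

theorem loc_mapObj_comp_glueStar {A B : 𝒢} (f : Loc A B) (t : TensorTree A.V) :
    (loc (mapObj (X := fun v => incl.obj (star A v)) (Y := fun v => incl.obj (star B v))
      (fun v => incl.map (starMap f v)) t)).comp (glueStar B (t.map f.v)) =
      (glueStar A t).comp f :=
  loc_mapObj_comp_glue _ (fun v => starMap_incl f v) t

variable {C : Type u} [Category.{v} C] [MonoidalCategory C] [SymmetricCategory C]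
  (P : ModularPreoperad C)

/-- The comparison of tensor products of values at vertices. -/
noncomputable abbrev starComparison (A : 𝒢) (t : TensorTree A.V) :
    t.obj (fam ((restrict C).obj P) A) ⟶ P.obj (t.obj fun v => incl.obj (star A v)) :=
  comparison P.toFunctor (fun v => incl.obj (star A v)) t

-- How equations in `C` follow from equations of maps of graphs: the coherence morphism relating `s`
-- and `s'` comes from one in `ℋ`, which is compatible with the gluing maps, and morphisms of `ℋ`
-- are determined by their underlying maps.
variable {P} in
theorem starComparison_eq_of_rel {A : 𝒢} {S : C} {D : ℋ} {t t' : TensorTree A.V}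
    {s : S ⟶ t.obj (fam ((restrict C).obj P) A)} {s' : S ⟶ t'.obj (fam ((restrict C).obj P) A)}
    (h : Rel s s') {a : (t.obj fun v => incl.obj (star A v)) ⟶ D}
    {a' : (t'.obj fun v => incl.obj (star A v)) ⟶ D} {m : Loc A D.obj}
    (ha : loc a = (glueStar A t).comp m) (ha' : loc a' = (glueStar A t').comp m) :
    s ≫ starComparison P A t ≫ P.map a = s' ≫ starComparison P A t' ≫ P.map a' := by
  obtain ⟨c, hc, rfl⟩ := h
  obtain ⟨g, hg, e⟩ := Coh.exists_comparison (F := P.toFunctor) hc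
  have e' : g ≫ a' = a := loc_injective ((loc_comp g a').trans
    ((congrArg (Loc.comp (loc g)) ha').trans
      ((congrArg (fun k => Loc.comp k m) (loc_coh_comp_glue _ hg)).trans ha.symm)))
  have e₂ : c ≫ starComparison P A t' ≫ P.map a' = starComparison P A t ≫ P.map a := by
    rw [← e', P.map_comp]
    exact (Category.assoc _ _ _).symm.trans ((congrArg (· ≫ P.map a') e).trans
      (Category.assoc _ _ _))
  rw [Category.assoc, e₂]

/-- The components of the counit. -/
noncomputable def counitApp (A : ℋ) : vertexTensor ((restrict C).obj P) A.obj ⟶ P.obj A :=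
  starComparison P A.obj (ofCode A.obj.V) ≫ P.map (decomp A)

instance isIso_counitApp (A : ℋ) : IsIso (counitApp P A) :=
  IsIso.comp_isIso' (isIso_comparison _ _ _) inferInstance

theorem vertexMap_starComparison {A B : 𝒢} (f : Loc A B) :
    vertexMap ((restrict C).obj P) f ≫ starComparison P B ((ofCode A.V).map f.v) =
      starComparison P A (ofCode A.V) ≫ P.map (mapObj (X := fun v => incl.obj (star A v))
        (Y := fun v => incl.obj (star B v)) (fun v => incl.map (starMap f v)) _) :=
  mapObj_comparison P.toFunctor (X := fun v => incl.obj (star A v))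
    (Y := fun v => incl.obj (star B v)) (fun v => incl.map (starMap f v)) _

theorem counitApp_naturality {A B : ℋ} (f : A ⟶ B) :
    mapLoc ((restrict C).obj P) (loc f) (bijective_loc f) ≫ counitApp P B =
      counitApp P A ≫ P.map f := by
  let q := mapObj (X := fun v => incl.obj (star A.obj v)) (Y := fun v => incl.obj (star B.obj v))
    (fun v => incl.map (starMap (loc f) v)) (ofCode A.obj.V)
  have hq : (loc q).comp (glueStar B.obj _) = loc (decomp A ≫ f) :=
    (loc_mapObj_comp_glueStar (loc f) _).trans
      ((congrArg (fun k => Loc.comp k (loc f)) (loc_decomp A)).symm.trans (loc_comp _ _).symm)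
  -- The bracketing of the vertices of `B` is replaced by that of `A` relabelled along `f`; there
  -- the decomposition of `B` takes the form `inv q ≫ decomp A ≫ f`.
  have e₁ := starComparison_eq_of_rel (P := P) (m := Loc.id B.obj)
    (rel_mapLoc _ (loc f) (bijective_loc f)) (a := inv q ≫ decomp A ≫ f)
    ((loc_comp _ _).trans (loc_hom_comp_eq (asIso q) hq)) (loc_decomp B)
  refine e₁.symm.trans ((Category.assoc _ _ _).symm.trans
    ((congrArg (· ≫ _) (vertexMap_starComparison P (loc f))).trans ?_))
  refine (Category.assoc _ _ _).trans (Eq.trans (congrArg (_ ≫ ·) ?_) (Category.assoc _ _ _).symm)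
  rw [← P.map_comp, ← P.map_comp]
  exact congrArg P.map (IsIso.hom_inv_id_assoc q _)

theorem vertexε_counitApp :
    vertexε ((restrict C).obj P) ≫ counitApp P (𝟙_ ℋ) = ε P.toFunctor := by
  have e := starComparison_eq_of_rel (P := P) (rel_vertexε ((restrict C).obj P))
    (a := 𝟙 (𝟙_ ℋ)) (m := Loc.id _)
    ((loc_id (𝟙_ ℋ)).trans (Loc.ext (funext fun x => Fin.elim0 x) (funext fun x => Fin.elim0 x)))
    (loc_decomp (𝟙_ ℋ))
  exact e.symm.trans ((Category.id_comp _).trans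
    ((congrArg (ε P.toFunctor ≫ ·) (P.map_id _)).trans (Category.comp_id _)))

theorem vertexμ_counitApp (A B : ℋ) :
    vertexμ ((restrict C).obj P) A.obj B.obj ≫ counitApp P (A ⊗ B) =
      (counitApp P A ⊗ₘ counitApp P B) ≫ μ P.toFunctor A B := by
  let X (A : 𝒢) (v : A.V) : ℋ := incl.obj (star A v)
  let q := mapObj (X := X A.obj) (Y := X (A ⊗ B).obj)
    (fun v => incl.map (starMap (Loc.inl A.obj B.obj) v)) (ofCode A.obj.V)
  let r := mapObj (X := X B.obj) (Y := X (A ⊗ B).obj)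
    (fun v => incl.map (starMap (Loc.inr A.obj B.obj) v)) (ofCode B.obj.V)
  -- Decomposing the two summands separately agrees with decomposing their union, because both
  -- include each vertex in `A ⊗ B` in the same way.
  have e : (q ⊗ₘ r) ≫ decomp (A ⊗ B) = decomp A ⊗ₘ decomp B := by
    refine loc_injective ((loc_comp _ _).trans ((congrArg (Loc.comp _) (loc_decomp _)).trans
      ((loc_tensor_comp _ _ _).trans (Eq.trans ?_ (loc_tensor _ _).symm))))
    refine congrArg₂ Loc.copair ?_ ?_
    · exact (loc_mapObj_comp_glueStar (Loc.inl A.obj B.obj) _).trans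
        (congrArg (fun k => Loc.comp k _) (loc_decomp A).symm)
    · exact (loc_mapObj_comp_glueStar (Loc.inr A.obj B.obj) _).trans
        (congrArg (fun k => Loc.comp k _) (loc_decomp B).symm)
  have e₁ : vertexμ ((restrict C).obj P) A.obj B.obj ≫
      starComparison P (A ⊗ B).obj (ofCode (A ⊗ B).obj.V) =
      ((starComparison P A.obj (ofCode A.obj.V) ⊗ₘ starComparison P B.obj (ofCode B.obj.V)) ≫
        μ P.toFunctor _ _) ≫ P.map (q ⊗ₘ r) :=
    (tensorHom_comp_tensorHom_assoc _ _ _ _ _).trans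
      ((congrArg (· ≫ _) (congrArg₂ (· ⊗ₘ ·) (vertexMap_starComparison P (Loc.inl A.obj B.obj))
        (vertexMap_starComparison P (Loc.inr A.obj B.obj)))).trans
      ((tensorHom_comp_tensorHom_assoc _ _ _ _ _).symm.trans
        ((congrArg (_ ≫ ·) (μ_natural P.toFunctor q r)).trans (Category.assoc _ _ _).symm)))
  refine (Category.assoc _ _ _).symm.trans ((congrArg (· ≫ _) e₁).trans
    ((Category.assoc _ _ _).trans ((congrArg (_ ≫ ·)
      ((P.map_comp _ _).symm.trans (congrArg P.map e))).trans ((Category.assoc _ _ _).trans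
        ((congrArg (_ ≫ ·) (μ_natural P.toFunctor (decomp A) (decomp B)).symm).trans
          (tensorHom_comp_tensorHom_assoc _ _ _ _ _))))))

variable {P} in
theorem vertexNat_counitApp {Q : ModularPreoperad C} (α : P ⟶ Q) (A : ℋ) :
    vertexNat ((restrict C).map α) A.obj ≫ counitApp Q A =
      counitApp P A ≫ (SymmMonFunctor.Hom.hom α).app A := by
  have := SymmMonFunctor.Hom.isMonoidal α
  obtain ⟨f, hf, e⟩ := naturality_comparison P.toFunctor (SymmMonFunctor.Hom.hom α)
    (fun v => incl.obj (star A.obj v)) (ofCode A.obj.V)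
  have e' : vertexNat ((restrict C).map α) A.obj = f :=
    Rel.eq ((rel_vertexNat ((restrict C).map α) A.obj).symm.trans hf) (nodup_leaves_ofCode _)
  subst e'
  refine (Category.assoc _ _ _).symm.trans ((congrArg (· ≫ Q.map (decomp A)) e).trans ?_)
  refine (Category.assoc _ _ _).trans (Eq.trans (congrArg (_ ≫ ·) ?_) (Category.assoc _ _ _).symm)
  exact ((SymmMonFunctor.Hom.hom α).naturality _).symm

/-- The functor underlying a preoperad is determined by its restriction. -/
noncomputable def counitFunctorIso : freeFunctor ((restrict C).obj P) ≅ P.toFunctor :=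
  NatIso.ofComponents (fun A => @asIso _ _ ((freeFunctor ((restrict C).obj P)).obj A) (P.obj A)
    (counitApp P A) (isIso_counitApp P A)) (counitApp_naturality P)

instance isMonoidal_counitFunctorIso : NatTrans.IsMonoidal (F₁ := freeFunctor ((restrict C).obj P))
    (counitFunctorIso P).hom where
  unit := vertexε_counitApp P
  tensor := vertexμ_counitApp P

variable (C) in
/-- The counit of the equivalence between functors on graphs with one vertex and preoperads. -/
noncomputable def counitIso : restrict C ⋙ free C ≅ 𝟭 (ModularPreoperad C) :=
  NatIso.ofComponents (fun P => 
      have : NatTrans.IsMonoidal (F₁ := (freePreoperad ((restrict C).obj P)).toFunctor)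
        (counitFunctorIso P).hom := isMonoidal_counitFunctorIso P
      SymmMonFunctor.isoMk (F := freePreoperad ((restrict C).obj P)) (G := P)
        (counitFunctorIso P))
    (fun α => SymmMonFunctor.hom_ext (vertexNat_counitApp α))

variable (C) in
/-- Preoperads are functors on graphs with one vertex. -/
noncomputable def equivalence : (Corolla ⥤ C) ≌ ModularPreoperad C :=
  .mk (free C) (restrict C) (unitIso C) (counitIso C)

end Corolla

/-! ### Cocompleteness and local presentability -/

namespace CategoryTheory

/-- Colimits in the source of a conservative right adjoint preserving reflexive coequalizers. -/
theorem hasColimitsOfShape_of_isRightAdjoint {D : Type u₁} [Category.{v} D] {E : Type u₂}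
    [Category.{v} E] (U : D ⥤ E) [U.IsRightAdjoint] [U.ReflectsIsomorphisms]
    [HasColimitsOfShape WalkingReflexivePair D] [PreservesColimitsOfShape WalkingReflexivePair U]
    (J : Type v) [SmallCategory J] [HasColimitsOfShape J E] : HasColimitsOfShape J D := by
  let U' := (Functor.whiskeringRight J D E).obj U
  let adj : _ ⊣ U' := (Adjunction.ofIsRightAdjoint U).whiskerRight J
  have : HasReflexiveCoequalizers D := hasReflexiveCoequalizers_of_hasColimitsOfShape
  have : HasReflexiveCoequalizers (J ⥤ D) := hasReflexiveCoequalizers_of_hasColimitsOfShape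
  have := preservesColimitOfIsReflexivePair U'
  have : U'.ReflectsIsomorphisms :=
    { reflects := fun f hf => by
        rw [NatTrans.isIso_iff_isIso_app] at hf ⊢
        intro j
        have : IsIso (U.map (f.app j)) := hf j
        exact isIso_of_reflects_iso _ U }
  let : MonadicRightAdjoint U' :=
    Monad.monadicOfHasPreservesReflexiveCoequalizersOfReflectsIsomorphisms adj
  -- Colimits of shape `J` exist exactly when the constant diagram functor is a right adjoint. For
  -- `D` this holds after composition with `U'`, since the composite is `U` followed by constant
  -- diagrams in `E`. The adjoint triangle theorem for the monadic functor `U'` removes the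
  -- composition.
  have : (Functor.const J : E ⥤ J ⥤ E).IsRightAdjoint :=
    hasColimitsOfShape_iff_isRightAdjoint_const.1 inferInstance
  have : ((Functor.const J : D ⥤ J ⥤ D) ⋙ U').IsRightAdjoint :=
    Functor.isRightAdjoint_of_iso (Functor.compConstIso J U)
  exact hasColimitsOfShape_iff_isRightAdjoint_const.2 (isRightAdjoint_triangle_lift_monadic U')

/-- A category with jointly faithful and conservative accessible right adjoints to a locally
presentable category is locally presentable. -/
theorem IsCardinalLocallyPresentable.of_isRightAdjoint {C : Type u₁} [Category.{v₁} C]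
    {D : Type u₂} [Category.{v₂} D] {κ : Cardinal.{w}} [Fact κ.IsRegular]
    [IsCardinalLocallyPresentable C κ] [HasColimitsOfSize.{w, w} D] [LocallySmall.{w} D]
    {ι : Type u₃} [Small.{w} ι] (R : ι → D ⥤ C) [∀ i, (R i).IsRightAdjoint]
    [∀ i, (R i).IsCardinalAccessible κ]
    (h : ∀ ⦃X Y : D⦄ (f g : X ⟶ Y), (∀ i, (R i).map f = (R i).map g) → f = g)
    (h' : ∀ ⦃X Y : D⦄ (f : X ⟶ Y), (∀ i, IsIso ((R i).map f)) → IsIso f) :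
    IsCardinalLocallyPresentable D κ := by
  obtain ⟨P, _, hP, hP'⟩ :=
    (IsCardinalLocallyPresentable.iff_exists_isStrongGenerator C κ).1 inferInstance
  let adj (i : ι) := Adjunction.ofIsRightAdjoint (R i)
  rw [IsCardinalLocallyPresentable.iff_exists_isStrongGenerator]
  -- The generators are the values of the left adjoints on the generators of `C`. Morphisms out of
  -- them are morphisms from `G` to values of `R i`, whence strong generation; they are
  -- `κ`-presentable because `R i` preserves `κ`-filtered colimits.
  refine ⟨.ofObj fun T : ι × Subtype P => (R T.1).leftAdjoint.obj T.2.1, inferInstance, ?_, ?_⟩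
  · refine ObjectProperty.isStrongGenerator_iff.2 ⟨fun X Y f g hfg => h f g fun i => ?_,
      fun X Y f _ hf => h' f fun i => ?_⟩
    · refine hP.isSeparating _ _ fun G hG k => ((adj i).homEquiv _ _).symm.injective ?_
      rw [Adjunction.homEquiv_naturality_right_symm, Adjunction.homEquiv_naturality_right_symm]
      exact hfg _ ⟨(i, ⟨G, hG⟩)⟩ _
    -- The right adjoint `R i` preserves the monomorphism `f`, so invertibility of its image can be
    -- tested by lifting along generators.
    · refine hP.isIso_of_mono _ fun G hG k => ?_
      obtain ⟨l, hl⟩ := hf _ ⟨(i, ⟨G, hG⟩)⟩ (((adj i).homEquiv _ _).symm k)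
      refine ⟨(adj i).homEquiv _ _ l, ?_⟩
      have hl' : l ≫ f = ((adj i).homEquiv _ _).symm k := hl
      refine (Adjunction.homEquiv_naturality_right _ _ _).symm.trans ?_
      rw [hl', Equiv.apply_symm_apply]
  · rintro _ ⟨i, G, hG⟩
    have := hP' _ hG
    rw [isCardinalPresentable_iff] at this ⊢
    exact (adj i).isCardinalPresentable_leftAdjoint_obj κ G

end CategoryTheory

section

variable (C : Type u) [Category.{v} C] [MonoidalCategory C] [SymmetricCategory C]
    [HasColimits C] [∀ X : C, PreservesColimits (tensorLeft X)]
    [∀ X : C, PreservesColimits (tensorRight X)]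

instance : (τUpperStar C).IsRightAdjoint := (τAdjunction C).isRightAdjoint

/-- `ℋ` has the same objects as `𝒢`, so restriction loses no component of a transformation. -/
instance : (τUpperStar C).Faithful where
  map_injective h := SymmMonFunctor.hom_ext fun X =>
    congrArg (fun k => (SymmMonFunctor.Hom.hom k).app (⟨X⟩ : ℋ)) h

instance : (Corolla.restrict C).IsEquivalence :=
  (Corolla.equivalence C).isEquivalence_inverse

/-- General colimits need not be pointwise. They are lifted from `Corolla ⥤ C` along a conservative
right adjoint, using only that reflexive coequalizers are pointwise. -/
instance : HasColimitsOfSize.{v, v} (ModularOperad C) where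
  has_colimits_of_shape J _ := by
    have : HasColimitsOfSize.{0, 0} C := hasColimitsOfSizeShrink.{0, 0, v, v} C
    have (X : C) := preservesColimitsOfSize_shrink.{0, v, 0, v} (tensorLeft X)
    have (X : C) := preservesColimitsOfSize_shrink.{0, v, 0, v} (tensorRight X)
    have := SymmMonFunctor.hasColimitsOfShape 𝒢 C WalkingReflexivePair
    have := SymmMonFunctor.preservesColimitsOfShape_restrict 𝒢 C WalkingReflexivePair τ
    exact hasColimitsOfShape_of_isRightAdjoint (τUpperStar C ⋙ Corolla.restrict C) J

/-- A `κ`-filtered category is filtered, hence sifted. -/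
instance {κ : Cardinal.{v}} [Fact κ.IsRegular] : (τUpperStar C).IsCardinalAccessible κ where
  preservesColimitOfShape J _ _ := by
    have := isFiltered_of_isCardinalFiltered J κ
    have : IsSifted J := IsFiltered.isSifted
    exact SymmMonFunctor.preservesColimitsOfShape_restrict 𝒢 C J τ

/-- The evaluations at one-vertex graphs form a small family, indexed by number of legs and genus.
They are jointly faithful and conservative because `U` is faithful and conservative and these
properties are tested pointwise. -/
theorem isCardinalLocallyPresentable_modularOperad (κ : Cardinal.{v}) [Fact κ.IsRegular]
    [IsCardinalLocallyPresentable C κ] : IsCardinalLocallyPresentable (ModularOperad C) κ := by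
  have : HasColimitsOfSize.{0, 0} C := hasColimitsOfSizeShrink.{0, 0, v, v} C
  have (k : Corolla) : ((evaluation Corolla C).obj k).IsRightAdjoint :=
    evaluationIsRightAdjoint C k
  let U := τUpperStar C ⋙ Corolla.restrict C
  exact .of_isRightAdjoint (fun k : Corolla => U ⋙ (evaluation Corolla C).obj k)
    (fun X Y f g h => U.map_injective (NatTrans.ext (funext h)))
    (fun X Y f h => by
      have : IsIso (U.map f) := (NatTrans.isIso_iff_isIso_app _).2 h
      exact isIso_of_reflects_iso f U)

end

theorem mainTheorem2 (C : Type u) [Category.{v} C] [MonoidalCategory C] [SymmetricCategory C]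
    [HasColimits C] [∀ X : C, PreservesColimits (tensorLeft X)]
    [∀ X : C, PreservesColimits (tensorRight X)] :
    (∃ (τLowerStar : ModularPreoperad C ⥤ ModularOperad C)
        (adj : τLowerStar ⊣ τUpperStar C)
        (e : τLowerStar ⋙ SymmMonFunctor.forget 𝒢 C ≅
          SymmMonFunctor.forget ℋ C ⋙ coendExtension C),
      (∀ (P : ModularPreoperad C) (A : ℋ),
        (adj.unit.app P).hom.app A ≫ (e.hom.app P).app (τ.obj A) = coendUnit P.toFunctor A) ∧
      (Monad.comparison adj).IsEquivalence) ∧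
    (IsLocallyFinitelyPresentable.{v} C →
      IsLocallyFinitelyPresentable.{v} (ModularOperad C)) := by
  refine ⟨⟨τLowerStar C, τAdjunction C, τLowerStarIso C, τLowerStarIso_hom_app_app,
    isEquivalence_comparison_τAdjunction C⟩, fun h => ?_⟩
  have : Fact (Cardinal.aleph0.{v}).IsRegular := Cardinal.fact_isRegular_aleph0
  have : IsCardinalLocallyPresentable C Cardinal.aleph0.{v} := h
  exact isCardinalLocallyPresentable_modularOperad C Cardinal.aleph0.{v}
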